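/- Let $\Delta$ be the simplex category. A *simplicial category* is a simplicial object in the category of small categories; a simplicial category $M$ is identified with the simplicial space formed by the nerves of the categories $M_k$, and a *path* in $M$ (in simplicial degree $k$) is a map out of $\Delta^1$ in the nerve direction, i.e. a morphism of the category $M_k$. Paths with matching endpoints are composed in $M_k$; write $\odot$ for this composition. Let $\mathcal D$ be a small permutative category enriched in simplicial categories: a small category enriched in simplicial categories, with an enriched functor $\oplus:\mathcal D\times\mathcal D\to\mathcal D$ that is strictly associative and strictly unital with unit $0$, and an enriched natural symmetry $\tau_{A,B}:A\oplus B\to B\oplus A$ with $\tau_{B,A}\tau_{A,B}=\mathrm{id}$, $\tau_{A,0}=\mathrm{id}$ and $\tau_{A\oplus B,C}=(\tau_{A,C}\oplus\mathrm{id}_B)(\mathrm{id}_A\oplus\tau_{B,C})$. For $n\ge 0$ let $\underline n$ be the pointed set $\{0,1,\dots,n\}$ with base point $0$. Below, $S,T,U$ always denote pairwise disjoint subsets of $\{1,\dots,n\}$. **Objects.** The objects of both $\widehat{\mathcal D}(\underline n)$ and $\widetilde{\mathcal D}(\underline n)$ are the families $\{A_S,a_{S,T}\}$ of objects $A_S$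 of $\mathcal D$ and isomorphisms $a_{S,T}:A_{S\cup T}\to A_S\oplus A_T$ (0-simplices of the morphism objects) such that $A_\emptyset=0$; $a_{\emptyset,S}=a_{S,\emptyset}=\mathrm{id}_{A_S}$; $(a_{S,T}\oplus\mathrm{id}_{A_U})\,a_{S\cup T,U}=(\mathrm{id}_{A_S}\oplus a_{T,U})\,a_{S,T\cup U}$; and $\tau_{A_S,A_T}\,a_{S,T}=a_{T,S}$. **Morphisms of $\widehat{\mathcal D}(\underline n)$.** The simplicial category of morphisms from $\{A_S,a_{S,T}\}$ to $\{B_S,b_{S,T}\}$ is the simplicial subcategory of $\prod_S\mathcal D(A_S,B_S)$ of those $\{f_S\}$ with $f_\emptyset=\mathrm{id}_0$ and $(f_S\oplus f_T)\,a_{S,T}=b_{S,T}\,f_{S\cup T}$ for all $S,T$ (for objects and for morphisms of the categories $\mathcal D(A_S,B_S)_k$). Composition and units are componentwise. **Morphisms of $\widetilde{\mathcal D}(\underline n)$.** In simplicial degree $k$, the category of morphisms from $\{A_S,a_{S,T}\}$ to $\{B_S,b_{S,T}\}$ has as objects the families $\{f_S,\varphi_{S,T}\}$ of objects $f_S$ of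 $\mathcal D(A_S,B_S)_k$ and paths $$\varphi_{S,T}:\ (f_S\oplus f_T)\,a_{S,T}\longrightarrow b_{S,T}\,f_{S\cup T}\qquad\text{in } \mathcal D(A_{S\cup T},B_S\oplus B_T)_k$$ such that $f_\emptyset=\mathrm{id}_0$; $\varphi_{\emptyset,S}$ and $\varphi_{S,\emptyset}$ are constant; $\varphi_{T,S}=\tau_{B_S,B_T}\,\varphi_{S,T}$; and the two paths from $(f_S\oplus f_T\oplus f_U)(a_{S,T}\oplus \mathrm{id})\,a_{S\cup T,U}$ to $(b_{S,T}\oplus\mathrm{id})\,b_{S\cup T,U}\,f_{S\cup T\cup U}$ agree: $$\big((\varphi_{S,T}\oplus f_U)\,a_{S\cup T,U}\big)\odot\big((b_{S,T}\oplus\mathrm{id})\,\varphi_{S\cup T,U}\big)=\big((f_S\oplus\varphi_{T,U})\,a_{S,T\cup U}\big)\odot\big((\mathrm{id}\oplus b_{T,U})\,\varphi_{S,T\cup U}\big),$$ where $x\odot y$ is $x$ followed by $y$. A morphism $\{f_S,\varphi_{S,T}\}\to\{g_S,\gamma_{S,T}\}$ is a family of morphisms $\psi_S:f_S\to g_S$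 of $\mathcal D(A_S,B_S)_k$ with $\psi_\emptyset=\mathrm{id}$ and $\big((\psi_S\oplus\psi_T)\,a_{S,T}\big)\odot\gamma_{S,T}=\varphi_{S,T}\odot(b_{S,T}\,\psi_{S\cup T})$. The composite of $\{f_S,\varphi_{S,T}\}$ followed by $\{g_S,\gamma_{S,T}\}$ is $\{g_Sf_S,\ ((g_S\oplus g_T)\,\varphi_{S,T})\odot(\gamma_{S,T}\,f_{S\cup T})\}$, and units are the identities with constant paths. Both constructions are functorial in pointed maps $\theta:\underline n\to\underline m$ by taking the $\theta^{-1}S$- and $(\theta^{-1}S,\theta^{-1}T)$-components as the new $S$- and $(S,T)$-components, and so are $\Gamma$-categories (functors from the pointed sets $\underline n$ to categories enriched in simplicial categories). Let $i:\widehat{\mathcal D}(\underline n)\to\widetilde{\mathcal D}(\underline n)$ be the inclusion, which is the identity on objects and adds constant paths to a family $\{f_S\}$, and let $q:\widetilde{\mathcal D}(\underline n)\to\mathcal D^{\times n}$ be the projection onto the components of $\{1\},\dots,\{n\}$. A functor enriched in simplicial categories is a *weak equivalence* if it induces a homotopy equivalence on classifying spaces, where the classifying space is the realization of the (multisimplicial)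 nerve. **Proposition.** For every $n\ge 0$ the functors $i:\widehat{\mathcal D}(\underline n)\to\widetilde{\mathcal D}(\underline n)$ and $q:\widetilde{\mathcal D}(\underline n)\to\mathcal D^{\times n}$ are weak equivalences. Consequently, the functors $i$ forming a map of $\Gamma$-categories, $\widetilde{\mathcal D}$ is levelwise weakly equivalent to $\widehat{\mathcal D}$ via $i$, and $\widetilde{\mathcal D}$ is special: for every $n\ge 0$ the map $\widetilde{\mathcal D}(\underline n)\to\widetilde{\mathcal D}(\underline 1)^{\times n}$ induced by the $n$ pointed maps $\underline n\to\underline 1$ that send one element to $1$ and all others to $0$ is a weak equivalence. -/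

import Mathlib

open CategoryTheory Opposite

universe u v w

set_option linter.unusedVariables false

noncomputable section

namespace SegalGamma

/-! ## Arrows of a category

An object of `Arrow C` is a path `Δ¹ → C`.  Working with arrows, an equation between morphisms
whose sources and targets agree only up to a propositional equality is a plain equation. -/

section Arrows

variable {C C' C'' : Type u} [Category.{u} C] [Category.{u} C'] [Category.{u} C'']

/-- The constant path at an object. -/
abbrev const (X : C) : Arrow C := Arrow.mk (𝟙 X)

/-- The action of a functor of two variables on arrows. -/
abbrev map₂ (F : C × C' ⥤ C'') (x : Arrow C) (y : Arrow C') : Arrow C'' :=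
  Arrow.mk (F.map (X := (x.left, y.left)) (Y := (x.right, y.right)) (x.hom, y.hom))

/-- The composite of two composable paths. -/
def paste (x y : Arrow C) (h : x.right = y.left) : Arrow C :=
  Arrow.mk (x.hom ≫ eqToHom h ≫ y.hom)

@[simp] theorem paste_left (x y : Arrow C) (h : x.right = y.left) : (paste x y h).left = x.left := rfl

@[simp] theorem paste_right (x y : Arrow C) (h : x.right = y.left) :
    (paste x y h).right = y.right := rfl

theorem paste_mk {X Y Z : C} (f : X ⟶ Y) (g : Y ⟶ Z) :
    paste (Arrow.mk f) (Arrow.mk g) rfl = Arrow.mk (f ≫ g) := by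
  simp [paste]

theorem paste_congr {x x' y y' : Arrow C} (h : x.right = y.left) (hx : x = x') (hy : y = y') :
    paste x y h = paste x' y' (hx ▸ hy ▸ h) := by
  subst hx hy; rfl

theorem paste_assoc (x y z : Arrow C) (h : x.right = y.left) (h' : y.right = z.left) :
    paste (paste x y h) z h' = paste x (paste y z h') h := by
  simp [paste]

theorem const_paste (X : C) (x : Arrow C) (h : X = x.left) : paste (const X) x h = x := by
  subst h; simp [paste, const]

theorem paste_const (X : C) (x : Arrow C) (h : x.right = X) : paste x (const X) h = x := by
  subst h; simp [paste, const]

theorem map₂_paste (F : C × C' ⥤ C'') (x x' : Arrow C) (y y' : Arrow C')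
    (h : x.right = x'.left) (h' : y.right = y'.left) :
    map₂ F (paste x x' h) (paste y y' h') =
      paste (map₂ F x y) (map₂ F x' y') (by simp [h, h']) := by
  obtain ⟨X, Y, f, rfl⟩ := x.mk_surjective
  obtain ⟨X', Y', f', rfl⟩ := x'.mk_surjective
  obtain ⟨U, V, g, rfl⟩ := y.mk_surjective
  obtain ⟨U', V', g', rfl⟩ := y'.mk_surjective
  dsimp at h h'
  subst h h'
  rw [paste_mk, paste_mk]
  refine Eq.trans ?_ (paste_mk (F.map (X := (X, U)) (Y := (Y, V)) (f, g))
    (F.map (X := (Y, V)) (Y := (Y', V')) (f', g'))).symm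
  rw [← F.map_comp]
  rfl

theorem map₂_const (F : C × C' ⥤ C'') (X : C) (Y : C') :
    map₂ F (const X) (const Y) = const (F.obj (X, Y)) := by
  exact congrArg Arrow.mk (F.map_id (X, Y))

theorem mapArrow_paste (F : C ⥤ C') (x y : Arrow C) (h : x.right = y.left) :
    F.mapArrow.obj (paste x y h) =
      paste (F.mapArrow.obj x) (F.mapArrow.obj y) (congrArg F.obj h) := by
  obtain ⟨X, Y, f, rfl⟩ := x.mk_surjective
  obtain ⟨X', Y', f', rfl⟩ := y.mk_surjective
  dsimp at h
  subst h
  rw [paste_mk]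
  change Arrow.mk (F.map (f ≫ f')) = paste (Arrow.mk (F.map f)) (Arrow.mk (F.map f')) rfl
  rw [paste_mk, F.map_comp]

theorem mapArrow_const (F : C ⥤ C') (X : C) :
    F.mapArrow.obj (const X) = const (F.obj X) := by
  exact congrArg Arrow.mk (F.map_id X)

/-- Two functors that agree on arrows are equal. -/
theorem functor_ext {J : Type v} [Category.{w} J] {F G : J ⥤ C}
    (h : ∀ {i j : J} (f : i ⟶ j), Arrow.mk (F.map f) = Arrow.mk (G.map f)) : F = G := by
  have hobj : ∀ i, F.obj i = G.obj i := fun i => congrArg Comma.left (h (𝟙 i))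
  have key : ∀ {A B A' B' : C} (p : A ⟶ B) (q : A' ⟶ B'), Arrow.mk p = Arrow.mk q → p ≍ q := by
    intro A B A' B' p q e
    cases e; rfl
  exact Functor.hext hobj fun i j f => key _ _ (h f)

/-- Two functors that agree on arrows are equal. -/
theorem functor_ext_arrow {F G : C ⥤ C'}
    (h : ∀ x : Arrow C, F.mapArrow.obj x = G.mapArrow.obj x) : F = G :=
  functor_ext fun f => h (Arrow.mk f)

end Arrows

/-! ## Categories enriched over simplicial categories -/

/-- A small category enriched over simplicial categories, i.e. over simplicial objects in the
category of small categories: simplicial categories of morphisms, and unital and associative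
composition functors compatible with the simplicial structure.  The laws are stated on arrows of
the categories of morphisms, hence hold on their objects and on their morphisms. -/
structure SCat where
  Obj : Type u
  Hom : Obj → Obj → SimplexCategoryᵒᵖ ⥤ Cat.{u, u}
  unit : ∀ (A : Obj) (k : SimplexCategoryᵒᵖ), (Hom A A).obj k
  comp : ∀ {A B C : Obj} (k : SimplexCategoryᵒᵖ),
    ((Hom A B).obj k × (Hom B C).obj k) ⥤ (Hom A C).obj k
  map_unit : ∀ (A : Obj) {k l : SimplexCategoryᵒᵖ} (θ : k ⟶ l),
    ((Hom A A).map θ).toFunctor.obj (unit A k) = unit A l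
  map_comp : ∀ {A B C : Obj} {k l : SimplexCategoryᵒᵖ} (θ : k ⟶ l)
    (x : Arrow ((Hom A B).obj k)) (y : Arrow ((Hom B C).obj k)),
    ((Hom A C).map θ).toFunctor.mapArrow.obj (map₂ (comp k) x y) =
      map₂ (comp l) (((Hom A B).map θ).toFunctor.mapArrow.obj x)
        (((Hom B C).map θ).toFunctor.mapArrow.obj y)
  unit_comp : ∀ {A B : Obj} {k : SimplexCategoryᵒᵖ} (x : Arrow ((Hom A B).obj k)),
    map₂ (comp k) (const (unit A k)) x = x
  comp_unit : ∀ {A B : Obj} {k : SimplexCategoryᵒᵖ} (x : Arrow ((Hom A B).obj k)),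
    map₂ (comp k) x (const (unit B k)) = x
  assoc : ∀ {A B C D : Obj} {k : SimplexCategoryᵒᵖ} (x : Arrow ((Hom A B).obj k))
    (y : Arrow ((Hom B C).obj k)) (z : Arrow ((Hom C D).obj k)),
    map₂ (comp k) (map₂ (comp k) x y) z = map₂ (comp k) x (map₂ (comp k) y z)

namespace SCat

/-- The paths in the category of morphisms from `A` to `B` in simplicial degree `k`. -/
abbrev Cell (E : SCat.{u}) (k : SimplexCategoryᵒᵖ) (A B : E.Obj) : Type u :=
  Arrow ((E.Hom A B).obj k)

/-- The simplicial structure on paths. -/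
def res (E : SCat.{u}) {A B : E.Obj} {k l : SimplexCategoryᵒᵖ} (θ : k ⟶ l)
    (x : E.Cell k A B) : E.Cell l A B :=
  ((E.Hom A B).map θ).toFunctor.mapArrow.obj x

/-- Composition (in diagrammatic order) on paths. -/
def hcomp {E : SCat.{u}} {A B C : E.Obj} {k : SimplexCategoryᵒᵖ}
    (x : E.Cell k A B) (y : E.Cell k B C) : E.Cell k A C :=
  map₂ (E.comp k) x y

/-- A functor enriched over simplicial categories. -/
@[ext]
structure EFunctor (E F : SCat.{u}) where
  obj : E.Obj → F.Obj
  map : ∀ A B : E.Obj, E.Hom A B ⟶ F.Hom (obj A) (obj B)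
  map_unit : ∀ (A : E.Obj) (k : SimplexCategoryᵒᵖ),
    ((map A A).app k).toFunctor.obj (E.unit A k) = F.unit (obj A) k
  map_comp : ∀ {A B C : E.Obj} {k : SimplexCategoryᵒᵖ} (x : E.Cell k A B) (y : E.Cell k B C),
    ((map A C).app k).toFunctor.mapArrow.obj (hcomp x y) =
      hcomp (((map A B).app k).toFunctor.mapArrow.obj x)
        (((map B C).app k).toFunctor.mapArrow.obj y)

instance : Category SCat.{u} where
  Hom E F := EFunctor E F
  id E :=
    { obj := fun A => A
      map := fun A B => 𝟙 _
      map_unit := fun _ _ => rfl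
      map_comp := fun _ _ => rfl }
  comp F G :=
    { obj := fun A => G.obj (F.obj A)
      map := fun A B => F.map A B ≫ G.map _ _
      map_unit := fun A k => (congrArg _ (F.map_unit A k)).trans (G.map_unit _ k)
      map_comp := fun x y => (congrArg _ (F.map_comp x y)).trans (G.map_comp _ _) }


/-! ### The underlying category -/

/-- A morphism of the underlying category: a `0`-simplex of the simplicial category of morphisms,
given together with its degeneracies as a compatible family of objects, one in each simplicial
degree. -/
@[ext]
structure Mor (E : SCat.{u}) (A B : E.Obj) where
  app : ∀ k : SimplexCategoryᵒᵖ, (E.Hom A B).obj k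
  map_app : ∀ {k l : SimplexCategoryᵒᵖ} (θ : k ⟶ l),
    ((E.Hom A B).map θ).toFunctor.obj (app k) = app l

instance (E : SCat.{u}) : Category E.Obj where
  Hom A B := E.Mor A B
  id A := ⟨E.unit A, E.map_unit A⟩
  comp f g := ⟨fun k => (E.comp k).obj (f.app k, g.app k), fun {k l} θ => by
    have h := congrArg Comma.left (E.map_comp θ (const (f.app k)) (const (g.app k)))
    rw [← f.map_app θ, ← g.map_app θ]
    exact h⟩
  id_comp f := Mor.ext (funext fun k => congrArg Comma.left (E.unit_comp (const (f.app k))))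
  comp_id f := Mor.ext (funext fun k => congrArg Comma.left (E.comp_unit (const (f.app k))))
  assoc f g h := Mor.ext (funext fun k => congrArg Comma.left
    (E.assoc (const (f.app k)) (const (g.app k)) (const (h.app k))))

/-- The constant path, in simplicial degree `k`, at a morphism of the underlying category. -/
def cst {E : SCat.{u}} {A B : E.Obj} (f : A ⟶ B) (k : SimplexCategoryᵒᵖ) : E.Cell k A B :=
  const (Mor.app f k)

theorem cst_comp {E : SCat.{u}} {A B C : E.Obj} (f : A ⟶ B) (g : B ⟶ C)
    (k : SimplexCategoryᵒᵖ) : cst (f ≫ g) k = hcomp (cst f k) (cst g k) :=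
  (map₂_const _ _ _).symm

theorem res_cst (E : SCat.{u}) {A B : E.Obj} (f : A ⟶ B) {k l : SimplexCategoryᵒᵖ} (θ : k ⟶ l) :
    E.res θ (cst f k) = cst f l := by
  exact (mapArrow_const _ _).trans (congrArg const (Mor.map_app f θ))

end SCat

open SCat

/-! ## Permutative categories enriched over simplicial categories -/

/-- A category enriched over simplicial categories whose objects form a monoid, with an enriched
functor of two variables extending the sum of objects. -/
structure SumSCat extends SCat.{u} where
  [addMonoid : AddMonoid Obj]
  add : ∀ {A A' B B' : Obj} (k : SimplexCategoryᵒᵖ),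
    ((Hom A A').obj k × (Hom B B').obj k) ⥤ (Hom (A + B) (A' + B')).obj k
  map_add : ∀ {A A' B B' : Obj} {k l : SimplexCategoryᵒᵖ} (θ : k ⟶ l)
    (x : toSCat.Cell k A A') (y : toSCat.Cell k B B'),
    toSCat.res θ (map₂ (add k) x y) = map₂ (add l) (toSCat.res θ x) (toSCat.res θ y)
  add_unit : ∀ (A B : Obj) (k : SimplexCategoryᵒᵖ),
    (add k).obj (unit A k, unit B k) = unit (A + B) k
  add_comp : ∀ {A A' A'' B B' B'' : Obj} {k : SimplexCategoryᵒᵖ}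
    (x : toSCat.Cell k A A') (x' : toSCat.Cell k A' A'')
    (y : toSCat.Cell k B B') (y' : toSCat.Cell k B' B''),
    map₂ (add k) (hcomp x x') (hcomp y y') =
      hcomp (E := toSCat) (map₂ (add k) x y) (map₂ (add k) x' y')

attribute [instance] SumSCat.addMonoid

namespace SumSCat

/-- The sum of two paths. -/
def hadd {D : SumSCat.{u}} {A A' B B' : D.Obj} {k : SimplexCategoryᵒᵖ}
    (x : D.Cell k A A') (y : D.Cell k B B') : D.Cell k (A + B) (A' + B') :=
  map₂ (D.add k) x y

/-- The sum of two morphisms of the underlying category. -/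
def madd {D : SumSCat.{u}} {A A' B B' : D.Obj} (f : A ⟶ A') (g : B ⟶ B') : A + B ⟶ A' + B' where
  app k := (D.add k).obj (Mor.app f k, Mor.app g k)
  map_app {k l} θ := by
    have h := congrArg Comma.left (D.map_add θ (const (Mor.app f k)) (const (Mor.app g k)))
    rw [← Mor.map_app f θ, ← Mor.map_app g θ]
    exact h

theorem cst_madd {D : SumSCat.{u}} {A A' B B' : D.Obj} (f : A ⟶ A') (g : B ⟶ B')
    (k : SimplexCategoryᵒᵖ) : cst (madd f g) k = hadd (cst f k) (cst g k) :=
  (map₂_const _ _ _).symm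

end SumSCat

open SumSCat

/-- A family of morphisms `A + B ⟶ B + A` of the underlying category. -/
abbrev Braiding (D : SumSCat.{u}) : Type u := ∀ A B : D.Obj, A + B ⟶ B + A

/-- The axioms of a permutative category: the sum is strictly associative and strictly unital also
on paths, and `braid` is an enriched natural symmetry.  As strict associativity and unitality hold
on objects as propositional equalities, on paths they are expressed with the identity morphisms
`eqToHom` of the underlying category. -/
structure IsPermutative (D : SumSCat.{u}) (braid : Braiding D) : Prop where
  assoc : ∀ {A A' B B' C C' : D.Obj} {k : SimplexCategoryᵒᵖ}
    (x : D.Cell k A A') (y : D.Cell k B B') (z : D.Cell k C C'),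
    hcomp (hadd (hadd x y) z) (cst (eqToHom (add_assoc A' B' C')) k) =
      hcomp (cst (eqToHom (add_assoc A B C)) k) (hadd x (hadd y z))
  zero_hadd : ∀ {A A' : D.Obj} {k : SimplexCategoryᵒᵖ} (x : D.Cell k A A'),
    hcomp (hadd (cst (𝟙 (0 : D.Obj)) k) x) (cst (eqToHom (zero_add A')) k) =
      hcomp (cst (eqToHom (zero_add A)) k) x
  hadd_zero : ∀ {A A' : D.Obj} {k : SimplexCategoryᵒᵖ} (x : D.Cell k A A'),
    hcomp (hadd x (cst (𝟙 (0 : D.Obj)) k)) (cst (eqToHom (add_zero A')) k) =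
      hcomp (cst (eqToHom (add_zero A)) k) x
  natural : ∀ {A A' B B' : D.Obj} {k : SimplexCategoryᵒᵖ} (x : D.Cell k A A') (y : D.Cell k B B'),
    hcomp (hadd x y) (cst (braid A' B') k) = hcomp (cst (braid A B) k) (hadd y x)
  braid_braid : ∀ A B : D.Obj, braid A B ≫ braid B A = 𝟙 (A + B)
  braid_zero : ∀ A : D.Obj, braid A 0 = eqToHom ((add_zero A).trans (zero_add A).symm)
  braid_add : ∀ A B C : D.Obj, braid (A + B) C =
    eqToHom (add_assoc A B C) ≫ madd (𝟙 A) (braid B C) ≫ eqToHom (add_assoc A C B).symm ≫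
      madd (braid A C) (𝟙 B) ≫ eqToHom (add_assoc C A B)

/-- A permutative category enriched over simplicial categories. -/
structure PermSCat extends SumSCat.{u} where
  braid : Braiding toSumSCat
  isPermutative : IsPermutative toSumSCat braid

/-! ## The `Γ`-categories of a permutative category -/

/-- The pointed finite set `{0, 1, ..., n}` with base point `0`. -/
structure FinPtd where
  n : ℕ

/-- Pointed maps. -/
@[ext]
structure FinPtd.PtdMap (X Y : FinPtd) where
  toFun : Fin (X.n + 1) → Fin (Y.n + 1)
  map_zero : toFun 0 = 0

instance : Category FinPtd where
  Hom X Y := FinPtd.PtdMap X Y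
  id X := ⟨fun j => j, rfl⟩
  comp f g := ⟨fun j => g.toFun (f.toFun j), by rw [f.map_zero, g.map_zero]⟩

/-- The pointed map `{0, ..., n} → {0, 1}` that sends `k` to `1` and all other elements to `0`;
here the elements `k ≠ 0` are written as `i + 1`. -/
def FinPtd.segal (X : FinPtd) (i : Fin X.n) : X ⟶ FinPtd.mk 1 where
  toFun j := if j = i.succ then 1 else 0
  map_zero := if_neg (Fin.succ_ne_zero i).symm

/-- The subsets of `{0, 1, ..., n}` that do not contain the base point. -/
def PtSub (X : FinPtd) : Type := {S : Set (Fin (X.n + 1)) // 0 ∉ S}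

namespace PtSub

variable {X Y : FinPtd}

/-- The empty subset. -/
def empty (X : FinPtd) : PtSub X := ⟨∅, fun h => h⟩

/-- The subset `{i + 1}`. -/
def single (i : Fin X.n) : PtSub X := ⟨{i.succ}, fun h => Fin.succ_ne_zero i h.symm⟩

/-- The preimage under a pointed map. -/
def preimage (θ : X ⟶ Y) (S : PtSub Y) : PtSub X :=
  ⟨{j | FinPtd.PtdMap.toFun θ j ∈ S.1},
    fun h => S.2 ((congrArg (· ∈ S.1) (FinPtd.PtdMap.map_zero θ)).mp h)⟩

/-- `W` is the disjoint union of `S` and `T`.  Families indexed by pairs `(S, T)` of disjoint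
subsets are indexed below by triples `(S, T, W)` with this property, so that for instance
`(S ∪ T) ∪ U` and `S ∪ (T ∪ U)` need not be identified. -/
structure IsUnion (S T W : PtSub X) : Prop where
  disjoint : ∀ j, j ∈ S.1 → j ∈ T.1 → False
  union : ∀ j, j ∈ W.1 ↔ j ∈ S.1 ∨ j ∈ T.1

theorem IsUnion.symm {S T W : PtSub X} (h : IsUnion S T W) : IsUnion T S W :=
  ⟨fun j hT hS => h.disjoint j hS hT, fun j => (h.union j).trans or_comm⟩

theorem IsUnion.preimage {S T W : PtSub Y} (h : IsUnion S T W) (θ : X ⟶ Y) :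
    IsUnion (S.preimage θ) (T.preimage θ) (W.preimage θ) :=
  ⟨fun _ => h.disjoint _, fun _ => h.union _⟩

end PtSub

open PtSub

/-- The objects `{A_S, a_{S,T}}` of both `Γ`-categories at `X = {0, 1, ..., n}`: objects `A_S` and
isomorphisms `a_{S,T} : A_{S ∪ T} ≅ A_S + A_T` of the underlying category, strictly unital,
associative and symmetric. -/
@[ext]
structure GammaObj (D : PermSCat.{u}) (X : FinPtd) where
  A : PtSub X → D.Obj
  a : ∀ {S T W : PtSub X}, IsUnion S T W → (A W ⟶ A S + A T)
  A_empty : A (empty X) = 0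
  a_isIso : ∀ {S T W : PtSub X} (h : IsUnion S T W), IsIso (a h)
  a_empty_left : ∀ {S : PtSub X} (h : IsUnion (empty X) S S),
    a h = eqToHom (by rw [A_empty, zero_add])
  a_empty_right : ∀ {S : PtSub X} (h : IsUnion S (empty X) S),
    a h = eqToHom (by rw [A_empty, add_zero])
  a_assoc : ∀ {S T U ST TU STU : PtSub X} (h₁ : IsUnion S T ST) (h₂ : IsUnion ST U STU)
    (h₃ : IsUnion T U TU) (h₄ : IsUnion S TU STU),
    a h₂ ≫ madd (a h₁) (𝟙 (A U)) ≫ eqToHom (add_assoc _ _ _) = a h₄ ≫ madd (𝟙 (A S)) (a h₃)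
  a_symm : ∀ {S T W : PtSub X} (h : IsUnion S T W), a h ≫ D.braid (A S) (A T) = a h.symm

/-- The object `{A_{θ⁻¹ S}, a_{θ⁻¹ S, θ⁻¹ T}}`. -/
def GammaObj.push {D : PermSCat.{u}} {X Y : FinPtd} (θ : X ⟶ Y) (A : GammaObj D X) :
    GammaObj D Y where
  A S := A.A (S.preimage θ)
  a h := A.a (h.preimage θ)
  A_empty := A.A_empty
  a_isIso h := A.a_isIso (h.preimage θ)
  a_empty_left h := A.a_empty_left (h.preimage θ)
  a_empty_right h := A.a_empty_right (h.preimage θ)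
  a_assoc h₁ h₂ h₃ h₄ :=
    A.a_assoc (h₁.preimage θ) (h₂.preimage θ) (h₃.preimage θ) (h₄.preimage θ)
  a_symm h := A.a_symm (h.preimage θ)

section Interchange

variable {C C' C'' : Type u} [Category.{u} C] [Category.{u} C'] [Category.{u} C'']

theorem map₂_paste_const (F : C × C' ⥤ C'') (x x' : Arrow C) (h : x.right = x'.left) (Y : C') :
    map₂ F (paste x x' h) (const Y) =
      paste (map₂ F x (const Y)) (map₂ F x' (const Y)) (by simp [h]) := by
  rw [← map₂_paste F x x' (const Y) (const Y) h rfl, const_paste]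

theorem map₂_const_paste (F : C × C' ⥤ C'') (X : C) (y y' : Arrow C') (h : y.right = y'.left) :
    map₂ F (const X) (paste y y' h) =
      paste (map₂ F (const X) y) (map₂ F (const X) y') (by simp [h]) := by
  rw [← map₂_paste F (const X) (const X) y y' rfl h, const_paste]

theorem paste_map₂ (F : C × C' ⥤ C'') (x : Arrow C) (y : Arrow C') (X : C) (Y : C')
    (hX : x.right = X) (hY : Y = y.left) :
    paste (map₂ F x (const Y)) (map₂ F (const X) y) (by simp [hX, hY]) = map₂ F x y := by
  rw [← map₂_paste F x (const X) (const Y) y hX hY, const_paste, paste_const]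

theorem paste_map₂' (F : C × C' ⥤ C'') (x : Arrow C) (y : Arrow C') (X : C) (Y : C')
    (hX : X = x.left) (hY : y.right = Y) :
    paste (map₂ F (const X) y) (map₂ F x (const Y)) (by simp [hX, hY]) = map₂ F x y := by
  rw [← map₂_paste F (const X) x y (const Y) hX hY, const_paste, paste_const]

end Interchange


namespace SCat

section

variable {E : SCat.{u}} {A B C M : E.Obj} {k l : SimplexCategoryᵒᵖ}

theorem hcomp_assoc (x : E.Cell k A B) (y : E.Cell k B C) (z : E.Cell k C M) :
    hcomp (hcomp x y) z = hcomp x (hcomp y z) := E.assoc x y z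

theorem cst_id_hcomp (x : E.Cell k A B) : hcomp (cst (𝟙 A) k) x = x := E.unit_comp x

theorem hcomp_cst_id (x : E.Cell k A B) : hcomp x (cst (𝟙 B) k) = x := E.comp_unit x

theorem res_const (θ : k ⟶ l) (f : (E.Hom A B).obj k) :
    E.res θ (const f) = const (((E.Hom A B).map θ).toFunctor.obj f) := mapArrow_const _ _

theorem res_paste (θ : k ⟶ l) (x y : E.Cell k A B) (h : x.right = y.left) :
    E.res θ (paste x y h) = paste (E.res θ x) (E.res θ y) (congrArg _ h) := mapArrow_paste _ _ _ _

theorem res_id (x : E.Cell k A B) : E.res (𝟙 k) x = x := by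
  rw [res, CategoryTheory.Functor.map_id]; rfl

theorem res_comp {m : SimplexCategoryᵒᵖ} (θ : k ⟶ l) (θ' : l ⟶ m) (x : E.Cell k A B) :
    E.res (θ ≫ θ') x = E.res θ' (E.res θ x) := by
  rw [res, CategoryTheory.Functor.map_comp]; rfl

theorem res_hcomp (θ : k ⟶ l) (x : E.Cell k A B) (y : E.Cell k B C) :
    E.res θ (hcomp x y) = hcomp (E.res θ x) (E.res θ y) := E.map_comp θ x y

end

end SCat

namespace SumSCat

variable {D : SumSCat.{u}} {A A' A'' B B' B'' : D.Obj} {k l : SimplexCategoryᵒᵖ}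

theorem hadd_hcomp (x : D.Cell k A A') (x' : D.Cell k A' A'') (y : D.Cell k B B')
    (y' : D.Cell k B' B'') :
    hadd (hcomp x x') (hcomp y y') = hcomp (hadd x y) (hadd x' y') := D.add_comp x x' y y'

theorem res_hadd (θ : k ⟶ l) (x : D.Cell k A A') (y : D.Cell k B B') :
    D.res θ (hadd x y) = hadd (D.res θ x) (D.res θ y) := D.map_add θ x y

end SumSCat

namespace GammaObj

variable {D : PermSCat.{u}} {X : FinPtd} {k : SimplexCategoryᵒᵖ}

/-- The map `(x, y) ↦ (x + y) ∘ a_{S,T}` on paths. -/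
def pre (A : GammaObj D X) {S T W : PtSub X} (h : IsUnion S T W) {M N : D.Obj}
    (x : D.Cell k (A.A S) M) (y : D.Cell k (A.A T) N) : D.Cell k (A.A W) (M + N) :=
  hcomp (cst (A.a h) k) (hadd x y)

/-- The map `z ↦ b_{S,T} ∘ z` on paths. -/
def post (B : GammaObj D X) {S T W : PtSub X} (h : IsUnion S T W) {M : D.Obj}
    (z : D.Cell k M (B.A W)) : D.Cell k M (B.A S + B.A T) :=
  hcomp z (cst (B.a h) k)

variable {A B : GammaObj D X} {S T U ST TU STU : PtSub X}

theorem pre_post_left (h₁ : IsUnion S T ST) (h₂ : IsUnion ST U STU)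
    (x : D.Cell k (A.A ST) (B.A ST)) (y : D.Cell k (A.A U) (B.A U)) :
    A.pre h₂ (B.post h₁ x) y =
      hcomp (A.pre h₂ x y) (hadd (cst (B.a h₁) k) (cst (𝟙 (B.A U)) k)) := by
  rw [pre, pre, post, hcomp_assoc, ← hadd_hcomp, hcomp_cst_id]

theorem pre_post_right (h₃ : IsUnion T U TU) (h₄ : IsUnion S TU STU)
    (x : D.Cell k (A.A S) (B.A S)) (y : D.Cell k (A.A TU) (B.A TU)) :
    A.pre h₄ x (B.post h₃ y) =
      hcomp (A.pre h₄ x y) (hadd (cst (𝟙 (B.A S)) k) (cst (B.a h₃) k)) := by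
  rw [pre, pre, post, hcomp_assoc, ← hadd_hcomp, hcomp_cst_id]

theorem pre_paste {S T W : PtSub X} (h : IsUnion S T W) {M N : D.Obj}
    {x x' : D.Cell k (A.A S) M} {y y' : D.Cell k (A.A T) N} (e : x.right = x'.left)
    (e' : y.right = y'.left) :
    A.pre h (paste x x' e) (paste y y' e') =
      paste (A.pre h x y) (A.pre h x' y')
        (congrArg (fun z => (D.comp k).obj (_, z)) (by
          change (D.add k).obj (x.right, y.right) = (D.add k).obj (x'.left, y'.left)
          rw [e, e'])) := by
  unfold pre hcomp hadd
  rw [map₂_paste]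
  exact map₂_const_paste _ _ _ _ _

theorem post_paste {S T W : PtSub X} (h : IsUnion S T W) {M : D.Obj}
    {x y : D.Cell k M (B.A W)} (e : x.right = y.left) :
    B.post h (paste x y e) = paste (B.post h x) (B.post h y)
      (congrArg (fun z => (D.comp k).obj (z, _)) e) :=
  map₂_paste_const _ _ _ _ _

theorem res_pre {l : SimplexCategoryᵒᵖ} (θ : k ⟶ l) {S T W : PtSub X} (h : IsUnion S T W)
    {M N : D.Obj} (x : D.Cell k (A.A S) M) (y : D.Cell k (A.A T) N) :
    D.res θ (A.pre h x y) = A.pre h (D.res θ x) (D.res θ y) := by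
  rw [pre, pre, res_hcomp, SumSCat.res_hadd, res_cst]

theorem res_post {l : SimplexCategoryᵒᵖ} (θ : k ⟶ l) {S T W : PtSub X} (h : IsUnion S T W)
    {M : D.Obj} (x : D.Cell k M (B.A W)) :
    D.res θ (B.post h x) = B.post h (D.res θ x) := by
  rw [post, post, res_hcomp, res_cst]

theorem glue_left (h₁ : IsUnion S T ST) (h₂ : IsUnion ST U STU)
    {f : (D.Hom (A.A ST) (B.A ST)).obj k} {g : (D.Hom (A.A U) (B.A U)).obj k}
    {x : D.Cell k (A.A ST) (B.A S + B.A T)} {y : D.Cell k (A.A STU) (B.A ST + B.A U)}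
    (hx : x.right = (B.post h₁ (const f)).right)
    (hy : y.left = (A.pre h₂ (const f) (const g)).left) :
    (A.pre h₂ x (const g)).right =
      (hcomp y (hadd (cst (B.a h₁) k) (cst (𝟙 (B.A U)) k))).left := by
  have := congrArg Comma.right (pre_post_left h₁ h₂ (const f) (const g))
  change (D.comp k).obj (_, (D.add k).obj (x.right, g)) = (D.comp k).obj (y.left, _)
  rw [hx, hy]
  exact this

theorem glue_right (h₃ : IsUnion T U TU) (h₄ : IsUnion S TU STU)
    {f : (D.Hom (A.A S) (B.A S)).obj k} {g : (D.Hom (A.A TU) (B.A TU)).obj k}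
    {x : D.Cell k (A.A TU) (B.A T + B.A U)} {y : D.Cell k (A.A STU) (B.A S + B.A TU)}
    (hx : x.right = (B.post h₃ (const g)).right)
    (hy : y.left = (A.pre h₄ (const f) (const g)).left) :
    (A.pre h₄ (const f) x).right =
      (hcomp y (hadd (cst (𝟙 (B.A S)) k) (cst (B.a h₃) k))).left := by
  have := congrArg Comma.right (pre_post_right h₃ h₄ (const f) (const g))
  change (D.comp k).obj (_, (D.add k).obj (f, x.right)) = (D.comp k).obj (y.left, _)
  rw [hx, hy]
  exact this

end GammaObj

/-! ### The standard `Γ`-category -/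

section Thin

variable {D : PermSCat.{u}} {X : FinPtd}

/-- The objects, in simplicial degree `k`, of the simplicial category of morphisms from `A` to `B`
in the standard `Γ`-category: families `{f_S}` such that `(f_S + f_T) ∘ a_{S,T}` and
`b_{S,T} ∘ f_{S ∪ T}` are equal. -/
@[ext]
structure ThinHom (k : SimplexCategoryᵒᵖ) (A B : GammaObj D X) where
  f : ∀ S : PtSub X, (D.Hom (A.A S) (B.A S)).obj k
  f_empty : f (empty X) = Mor.app (eqToHom (A.A_empty.trans B.A_empty.symm)) k
  comm : ∀ {S T W : PtSub X} (h : IsUnion S T W),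
    A.pre h (const (f S)) (const (f T)) = B.post h (const (f W))

/-- The morphisms between such families: families `{ψ_S}` satisfying the same equations. -/
@[ext]
structure ThinHom₂ {k : SimplexCategoryᵒᵖ} {A B : GammaObj D X} (f g : ThinHom k A B) where
  ψ : ∀ S : PtSub X, f.f S ⟶ g.f S
  ψ_empty : Arrow.mk (ψ (empty X)) = const (f.f (empty X))
  comm : ∀ {S T W : PtSub X} (h : IsUnion S T W),
    A.pre h (Arrow.mk (ψ S)) (Arrow.mk (ψ T)) = B.post h (Arrow.mk (ψ W))

end Thin

/-! ### The `Γ`-category with paths -/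

section Fat

variable {D : PermSCat.{u}} {X : FinPtd}

/-- The objects, in simplicial degree `k`, of the simplicial category of morphisms from `A` to `B`
in the `Γ`-category with paths: families `{f_S}` together with paths `φ_{S,T}` from
`(f_S + f_T) ∘ a_{S,T}` to `b_{S,T} ∘ f_{S ∪ T}`. They are normalized, compatible with the symmetry,
and for pairwise disjoint `S, T, U` the two composite paths from
`(f_S + f_T + f_U) ∘ a_{S,T,U}` to `b_{S,T,U} ∘ f_{S ∪ T ∪ U}` coincide. -/
@[ext]
structure FatHom (k : SimplexCategoryᵒᵖ) (A B : GammaObj D X) where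
  f : ∀ S : PtSub X, (D.Hom (A.A S) (B.A S)).obj k
  φ : ∀ {S T W : PtSub X}, IsUnion S T W → D.Cell k (A.A W) (B.A S + B.A T)
  φ_left : ∀ {S T W : PtSub X} (h : IsUnion S T W),
    (φ h).left = (A.pre h (const (f S)) (const (f T))).left
  φ_right : ∀ {S T W : PtSub X} (h : IsUnion S T W),
    (φ h).right = (B.post h (const (f W))).right
  f_empty : f (empty X) = Mor.app (eqToHom (A.A_empty.trans B.A_empty.symm)) k
  φ_empty_left : ∀ {S : PtSub X} (h : IsUnion (empty X) S S), φ h = B.post h (const (f S))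
  φ_empty_right : ∀ {S : PtSub X} (h : IsUnion S (empty X) S), φ h = B.post h (const (f S))
  φ_symm : ∀ {S T W : PtSub X} (h : IsUnion S T W),
    φ h.symm = hcomp (φ h) (cst (D.braid (B.A S) (B.A T)) k)
  φ_assoc : ∀ {S T U ST TU STU : PtSub X} (h₁ : IsUnion S T ST) (h₂ : IsUnion ST U STU)
    (h₃ : IsUnion T U TU) (h₄ : IsUnion S TU STU),
    hcomp
      (paste (A.pre h₂ (φ h₁) (const (f U)))
        (hcomp (φ h₂) (hadd (cst (B.a h₁) k) (cst (𝟙 (B.A U)) k)))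
        (GammaObj.glue_left h₁ h₂ (φ_right h₁) (φ_left h₂)))
      (cst (eqToHom (add_assoc (B.A S) (B.A T) (B.A U))) k) =
    paste (A.pre h₄ (const (f S)) (φ h₃))
      (hcomp (φ h₄) (hadd (cst (𝟙 (B.A S)) k) (cst (B.a h₃) k)))
      (GammaObj.glue_right h₃ h₄ (φ_right h₃) (φ_left h₄))

/-- The morphisms between such families: families `{ψ_S}` compatible with the paths. -/
@[ext]
structure FatHom₂ {k : SimplexCategoryᵒᵖ} {A B : GammaObj D X} (f g : FatHom k A B) where
  ψ : ∀ S : PtSub X, f.f S ⟶ g.f S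
  ψ_empty : Arrow.mk (ψ (empty X)) = const (f.f (empty X))
  comm : ∀ {S T W : PtSub X} (h : IsUnion S T W),
    paste (A.pre h (Arrow.mk (ψ S)) (Arrow.mk (ψ T))) (g.φ h) (g.φ_left h).symm =
      paste (f.φ h) (B.post h (Arrow.mk (ψ W))) (f.φ_right h)

end Fat

section FatCategory

variable {D : PermSCat.{u}} {X : FinPtd}

open GammaObj

instance (k : SimplexCategoryᵒᵖ) (A B : GammaObj D X) : Category (FatHom k A B) where
  Hom f g := FatHom₂ f g
  id f :=
    { ψ := fun S => 𝟙 (f.f S)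
      ψ_empty := rfl
      comm := fun {S T W} h => by
        have h₁ : A.pre h (const (f.f S)) (const (f.f T)) = const _ :=
          (congrArg (hcomp _) (map₂_const _ _ _)).trans (map₂_const _ _ _)
        have h₂ : B.post h (const (f.f W)) = const _ := map₂_const _ _ _
        exact ((paste_congr _ h₁ rfl).trans (const_paste _ _ _)).trans
          ((paste_congr _ rfl h₂).trans (paste_const _ _ _)).symm }
  comp {f g g'} a b :=
    { ψ := fun S => a.ψ S ≫ b.ψ S
      ψ_empty := by
        have ha := a.ψ_empty
        have hb := b.ψ_empty
        rw [← paste_mk, paste_congr rfl ha rfl, const_paste, hb]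
        exact congrArg const (congrArg Comma.right ha)
      comm := fun {S T W} h => by
        have e₁ : A.pre h (Arrow.mk (a.ψ S ≫ b.ψ S)) (Arrow.mk (a.ψ T ≫ b.ψ T)) = _ :=
          (congrArg₂ (A.pre h) (paste_mk _ _).symm (paste_mk _ _).symm).trans (pre_paste h rfl rfl)
        have e₂ : B.post h (Arrow.mk (a.ψ W ≫ b.ψ W)) = _ :=
          (congrArg (B.post h) (paste_mk _ _).symm).trans (post_paste h rfl)
        refine (paste_congr _ e₁ rfl).trans ?_
        refine Eq.trans ?_ (paste_congr _ rfl e₂).symm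
        refine (paste_assoc _ _ _ _ _).trans ?_
        refine (paste_congr _ rfl (b.comm h)).trans ?_
        refine (paste_assoc _ _ _ _ _).symm.trans ?_
        refine (paste_congr _ (a.comm h) rfl).trans ?_
        exact paste_assoc _ _ _ _ _ }
  id_comp a := FatHom₂.ext (funext fun S => Category.id_comp _)
  comp_id a := FatHom₂.ext (funext fun S => Category.comp_id _)
  assoc a b c := FatHom₂.ext (funext fun S => Category.assoc _ _ _)

theorem FatHom.arrow_ext {k : SimplexCategoryᵒᵖ} {A B : GammaObj D X}
    {x y : Arrow (FatHom k A B)}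
    (hψ : ∀ S, Arrow.mk (FatHom₂.ψ x.hom S) = Arrow.mk (FatHom₂.ψ y.hom S))
    (hl : ∀ {S T W : PtSub X} (h : IsUnion S T W), x.left.φ h = y.left.φ h)
    (hr : ∀ {S T W : PtSub X} (h : IsUnion S T W), x.right.φ h = y.right.φ h) : x = y := by
  obtain ⟨f, g, a, rfl⟩ := x.mk_surjective
  obtain ⟨f', g', a', rfl⟩ := y.mk_surjective
  obtain rfl : f = f' := FatHom.ext (funext fun S => congrArg Comma.left (hψ S))
    (by funext S T W h; exact hl h)
  obtain rfl : g = g' := FatHom.ext (funext fun S => congrArg Comma.right (hψ S))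
    (by funext S T W h; exact hr h)
  exact congrArg Arrow.mk (FatHom₂.ext (funext fun S => Arrow.mk_injective _ _ (hψ S)))

/-- The simplicial structure on objects. -/
def FatHom.res {k l : SimplexCategoryᵒᵖ} (θ : k ⟶ l) {A B : GammaObj D X} (f : FatHom k A B) :
    FatHom l A B where
  f S := ((D.Hom (A.A S) (B.A S)).map θ).toFunctor.obj (f.f S)
  φ h := D.res θ (f.φ h)
  φ_left {S T W} h := by
    rw [← res_const, ← res_const, ← res_pre]
    exact congrArg ((D.Hom _ _).map θ).toFunctor.obj (f.φ_left h)
  φ_right {S T W} h := by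
    rw [← res_const, ← res_post]
    exact congrArg ((D.Hom _ _).map θ).toFunctor.obj (f.φ_right h)
  f_empty := by rw [f.f_empty, Mor.map_app]
  φ_empty_left h := by rw [f.φ_empty_left h, res_post, res_const]
  φ_empty_right h := by rw [f.φ_empty_right h, res_post, res_const]
  φ_symm h := by rw [f.φ_symm h, res_hcomp, res_cst]
  φ_assoc {S T U _ _ _} h₁ h₂ h₃ h₄ := by
    have key := congrArg (D.res θ) (f.φ_assoc h₁ h₂ h₃ h₄)
    rw [res_hcomp, res_paste, res_paste, res_cst] at key
    refine Eq.trans (congrArg (fun z => hcomp z _) (paste_congr _ ?_ ?_)) (key.trans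
      (paste_congr _ ?_ ?_))
    · rw [res_pre, res_const]
    · rw [res_hcomp, SumSCat.res_hadd, res_cst, res_cst]
    · rw [res_pre, res_const]
    · rw [res_hcomp, SumSCat.res_hadd, res_cst, res_cst]

/-- The simplicial structure. -/
def FatHom.resFunctor {k l : SimplexCategoryᵒᵖ} (θ : k ⟶ l) (A B : GammaObj D X) :
    FatHom k A B ⥤ FatHom l A B where
  obj f := f.res θ
  map {f g} a :=
    { ψ := fun S => ((D.Hom (A.A S) (B.A S)).map θ).toFunctor.map (FatHom₂.ψ a S)
      ψ_empty := (congrArg (D.res θ) (FatHom₂.ψ_empty a)).trans (res_const _ _)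
      comm := fun {S T W} h => by
        have key := (res_paste θ _ _ _).symm.trans
          ((congrArg (D.res θ) (FatHom₂.comm a h)).trans (res_paste θ _ _ _))
        refine (paste_congr _ ?_ rfl).trans (key.trans (paste_congr _ rfl ?_))
        · rw [res_pre]; rfl
        · rw [res_post]; rfl }
  map_id f := FatHom₂.ext (funext fun S => CategoryTheory.Functor.map_id _ _)
  map_comp a b := FatHom₂.ext (funext fun S => CategoryTheory.Functor.map_comp _ _ _)

/-- The simplicial category of morphisms from `A` to `B`. -/
def fatHom (A B : GammaObj D X) : SimplexCategoryᵒᵖ ⥤ Cat.{u, u} where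
  obj k := Cat.of (FatHom k A B)
  map θ := (FatHom.resFunctor θ A B).toCatHom
  map_id _ := Cat.ext (functor_ext_arrow fun x => FatHom.arrow_ext
    (fun S => res_id (E := D.toSCat) (Arrow.mk (FatHom₂.ψ x.hom S)))
    (fun _ => res_id _) (fun _ => res_id _))
  map_comp θ θ' := Cat.ext (functor_ext_arrow fun x => FatHom.arrow_ext
    (fun S => res_comp (E := D.toSCat) θ θ' (Arrow.mk (FatHom₂.ψ x.hom S)))
    (fun _ => res_comp _ _ _) (fun _ => res_comp _ _ _))

end FatCategory

section FatComposition

variable {D : PermSCat.{u}} {X : FinPtd}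

open GammaObj

section

variable {k : SimplexCategoryᵒᵖ} {A B C : GammaObj D X}

/-- The composable paths `(g_S + g_T) ∘ φ_{S,T}` and `γ_{S,T} ∘ f_{S ∪ T}`. -/
theorem FatHom.glue_comp (f : FatHom k A B) (g : FatHom k B C) {S T W : PtSub X}
    (h : IsUnion S T W) :
    (hcomp (f.φ h) (hadd (const (g.f S)) (const (g.f T)))).right =
      (hcomp (const (f.f W)) (g.φ h)).left := by
  have := congrArg Comma.right (hcomp_assoc (const (f.f W)) (cst (B.a h) k)
    (hadd (const (g.f S)) (const (g.f T))))
  change (D.comp k).obj ((f.φ h).right, _) = (D.comp k).obj (_, (g.φ h).left)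
  rw [f.φ_right h, g.φ_left h]
  exact this

/-- The path of a composite. -/
def FatHom.compφ (f : FatHom k A B) (g : FatHom k B C) {S T W : PtSub X} (h : IsUnion S T W) :
    D.Cell k (A.A W) (C.A S + C.A T) :=
  paste (hcomp (f.φ h) (hadd (const (g.f S)) (const (g.f T)))) (hcomp (const (f.f W)) (g.φ h))
    (f.glue_comp g h)

theorem const_comp {E : SCat.{u}} {A B C : E.Obj} (f : (E.Hom A B).obj k)
    (g : (E.Hom B C).obj k) :
    const ((E.comp k).obj (f, g)) = hcomp (const f) (const g) := (map₂_const _ _ _).symm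

theorem pre_hcomp {S T W : PtSub X} (h : IsUnion S T W) {M M' N N' : D.Obj}
    (x : D.Cell k (A.A S) M) (x' : D.Cell k M M') (y : D.Cell k (A.A T) N)
    (y' : D.Cell k N N') :
    A.pre h (hcomp x x') (hcomp y y') = hcomp (A.pre h x y) (hadd x' y') := by
  rw [pre, pre, SumSCat.hadd_hcomp, hcomp_assoc]

theorem post_hcomp {S T W : PtSub X} (h : IsUnion S T W) {M N : D.Obj}
    (x : D.Cell k M N) (y : D.Cell k N (B.A W)) :
    B.post h (hcomp x y) = hcomp x (B.post h y) := by
  rw [post, post, hcomp_assoc]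

theorem hcomp_paste_const {E : SCat.{u}} {A B C : E.Obj} (x y : E.Cell k A B)
    (h : x.right = y.left) (f : (E.Hom B C).obj k) :
    hcomp (paste x y h) (const f) = paste (hcomp x (const f)) (hcomp y (const f))
      (congrArg (fun z => (E.comp k).obj (z, f)) h) := map₂_paste_const _ _ _ _ _

theorem hcomp_const_paste {E : SCat.{u}} {A B C : E.Obj} (x y : E.Cell k B C)
    (h : x.right = y.left) (f : (E.Hom A B).obj k) :
    hcomp (const f) (paste x y h) = paste (hcomp (const f) x) (hcomp (const f) y)
      (congrArg (fun z => (E.comp k).obj (f, z)) h) := map₂_const_paste _ _ _ _ _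

theorem paste_four {K : Type u} [Category.{u} K] {a b c d v w : Arrow K}
    (hab : a.right = b.left) (hbc : b.right = c.left) (hcd : c.right = d.left)
    (hav : a.right = v.left) (hvw : v.right = w.left) (hwd : w.right = d.left)
    (e : paste b c hbc = paste v w hvw) :
    paste (paste a b hab) (paste c d hcd) hbc = paste (paste a v hav) (paste w d hwd) hvw := by
  calc paste (paste a b hab) (paste c d hcd) hbc
      = paste a (paste b (paste c d hcd) hbc) hab := paste_assoc _ _ _ _ _
    _ = paste a (paste (paste b c hbc) d hcd) hab :=
        paste_congr _ rfl (paste_assoc _ _ _ _ _).symm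
    _ = paste a (paste (paste v w hvw) d hwd) hav :=
        paste_congr _ rfl (paste_congr _ e rfl)
    _ = paste a (paste v (paste w d hwd) hvw) hav := paste_congr _ rfl (paste_assoc _ _ _ _ _)
    _ = paste (paste a v hav) (paste w d hwd) hvw := (paste_assoc _ _ _ _ _).symm

/-- The exchange of two paths in `hcomp x y`. -/
theorem exchange {E : SCat.{u}} {A B C : E.Obj} {x : E.Cell k A B} {y : E.Cell k B C}
    {x₀ x₁ : E.Cell k A B} {y₀ y₁ : E.Cell k B C} (hx₀ : x₀ = const x.left)
    (hx₁ : x₁ = const x.right) (hy₀ : y₀ = const y.left) (hy₁ : y₁ = const y.right)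
    (h : (hcomp x₀ y).right = (hcomp x y₁).left) (h' : (hcomp x y₀).right = (hcomp x₁ y).left) :
    paste (hcomp x₀ y) (hcomp x y₁) h = paste (hcomp x y₀) (hcomp x₁ y) h' := by
  subst hx₀ hx₁ hy₀ hy₁
  exact (paste_map₂' (E.comp k) x y _ _ rfl rfl).trans
    (paste_map₂ (E.comp k) x y _ _ rfl rfl).symm

theorem hcomp_const_const {E : SCat.{u}} {A B C : E.Obj} (f : (E.Hom A B).obj k)
    (g : (E.Hom B C).obj k) : hcomp (const f) (const g) = const ((E.comp k).obj (f, g)) :=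
  map₂_const _ _ _

theorem hadd_const_const {D : SumSCat.{u}} {A A' B B' : D.Obj} (f : (D.Hom A A').obj k)
    (g : (D.Hom B B').obj k) : hadd (const f) (const g) = const ((D.add k).obj (f, g)) :=
  map₂_const _ _ _

/-- The rearrangement behind the associativity condition for composites. -/
theorem rearrange {E : SCat.{u}} {A N M M' N' P : E.Obj} {a : E.Cell k A M} {φ : E.Cell k A N}
    {y : E.Cell k N M'} {γ : E.Cell k P N'} {x : E.Cell k A N} {m : E.Cell k N M}
    {n : E.Cell k M M'} {g : E.Cell k N N'} {c : E.Cell k N' M'} {F : E.Cell k A P}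
    {b : E.Cell k P N} (hm : ∃ Z, m = const Z) (hn : ∃ Z, n = const Z) (hg : ∃ Z, g = const Z)
    (hc : ∃ Z, c = const Z) (hF : ∃ Z, F = const Z) (hb : ∃ Z, b = const Z)
    (hx : const φ.left = x) (hy₀ : const y.left = hcomp m n)
    (hy₁ : const y.right = hcomp g c) (hφ : const φ.right = hcomp F b) (p₁ p₂ p₃ p₄ p₅ p₆) :
    paste (paste (hcomp a n) (hcomp x y) p₁)
      (paste (hcomp (hcomp φ g) c) (hcomp (hcomp F γ) c) p₂) p₃ =
    paste (hcomp (paste a (hcomp φ m) p₄) n) (hcomp F (paste (hcomp b y) (hcomp γ c) p₅)) p₆ := by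
  obtain ⟨m, rfl⟩ := hm
  obtain ⟨n, rfl⟩ := hn
  obtain ⟨g, rfl⟩ := hg
  obtain ⟨c, rfl⟩ := hc
  obtain ⟨F, rfl⟩ := hF
  obtain ⟨b, rfl⟩ := hb
  subst hx
  have e₁ : hcomp (hcomp φ (const g)) (const c) = hcomp φ (const y.right) := by
    rw [hcomp_assoc, hy₁]
  have e₂ : hcomp (hcomp φ (const m)) (const n) = hcomp φ (const y.left) := by
    rw [hcomp_assoc, hy₀]
  have e₃ : hcomp (const F) (hcomp (const b) y) = hcomp (const φ.right) y := by
    rw [← hcomp_assoc, hφ]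
  have q₁ : (hcomp (const φ.left) y).right = (hcomp (hcomp φ (const g)) (const c)).left := by
    rw [e₁]; rfl
  have q₂ : (hcomp (hcomp φ (const m)) (const n)).right =
      (hcomp (const F) (hcomp (const b) y)).left := by rw [e₂, e₃]; rfl
  have q₃ : (hcomp a (const n)).right = (hcomp (hcomp φ (const m)) (const n)).left :=
    congrArg (fun z => (E.comp k).obj (z, n)) p₄
  have q₄ : (hcomp (const F) (hcomp (const b) y)).right =
      (hcomp (const F) (hcomp γ (const c))).left :=
    congrArg (fun z => (E.comp k).obj (F, z)) p₅
  have q₅ : (hcomp (hcomp φ (const g)) (const c)).right =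
      (hcomp (const F) (hcomp γ (const c))).left := by
    rw [← hcomp_assoc]; exact p₂
  refine (paste_congr p₃ rfl (paste_congr p₂ rfl (hcomp_assoc _ _ _))).trans ?_
  refine (paste_four p₁ q₁ q₅ q₃ q₂ q₄ ?_).trans
    (paste_congr _ (hcomp_paste_const _ _ p₄ n).symm (hcomp_const_paste _ _ p₅ F).symm)
  refine (paste_congr _ rfl e₁).trans (Eq.trans ?_ (paste_congr _ e₂ e₃).symm)
  exact exchange rfl rfl rfl rfl _ _

theorem pre_const {S T W : PtSub X} (h : IsUnion S T W) {M N : D.Obj}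
    (f : (D.Hom (A.A S) M).obj k) (g : (D.Hom (A.A T) N).obj k) :
    A.pre h (const f) (const g) = const (A.pre h (const f) (const g)).left := by
  rw [pre, hadd_const_const]; exact hcomp_const_const _ _

theorem const_φ_left (f : FatHom k A B) {S T W : PtSub X} (h : IsUnion S T W) :
    const (f.φ h).left = A.pre h (const (f.f S)) (const (f.f T)) := by
  rw [f.φ_left h]; exact (pre_const h _ _).symm

theorem const_φ_right (f : FatHom k A B) {S T W : PtSub X} (h : IsUnion S T W) :
    const (f.φ h).right = B.post h (const (f.f W)) := by
  rw [f.φ_right h]; exact (hcomp_const_const _ _).symm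

theorem ex_cst {E : SCat.{u}} {A B : E.Obj} (f : A ⟶ B) : ∃ Z, cst f k = const Z := ⟨_, rfl⟩

theorem ex_const {K : Type u} [Category.{u} K] (f : K) : ∃ Z, const f = const Z := ⟨_, rfl⟩

theorem ex_hadd {D : SumSCat.{u}} {A A' B B' : D.Obj} {x : D.Cell k A A'} {y : D.Cell k B B'}
    (hx : ∃ Z, x = const Z) (hy : ∃ Z, y = const Z) : ∃ Z, hadd x y = const Z := by
  obtain ⟨X, rfl⟩ := hx
  obtain ⟨Y, rfl⟩ := hy
  exact ⟨_, hadd_const_const _ _⟩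

theorem compφ_left₃ (f : FatHom k A B) (g : FatHom k B C) {S T U ST STU : PtSub X}
    (h₁ : IsUnion S T ST) (h₂ : IsUnion ST U STU) (pf pg pf' p) :
    paste (A.pre h₂ (f.compφ g h₁) (const ((D.comp k).obj (f.f U, g.f U))))
      (hcomp (f.compφ g h₂) (hadd (cst (C.a h₁) k) (cst (𝟙 (C.A U)) k))) p =
    paste
      (hcomp (paste (A.pre h₂ (f.φ h₁) (const (f.f U)))
        (hcomp (f.φ h₂) (hadd (cst (B.a h₁) k) (cst (𝟙 (B.A U)) k))) pf)
        (hadd (hadd (const (g.f S)) (const (g.f T))) (const (g.f U))))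
      (hcomp (const (f.f STU)) (paste (B.pre h₂ (g.φ h₁) (const (g.f U)))
        (hcomp (g.φ h₂) (hadd (cst (C.a h₁) k) (cst (𝟙 (C.A U)) k))) pg)) pf' := by
  have hc := ex_hadd (ex_cst (k := k) (C.a h₁)) (ex_cst (𝟙 (C.A U)))
  have q := f.glue_comp g h₁
  have q' : (hcomp (A.pre h₂ (f.φ h₁) (const (f.f U)))
      (hadd (hadd (const (g.f S)) (const (g.f T))) (const (g.f U)))).right =
      (hcomp (A.pre h₂ (const (f.f ST)) (const (f.f U)))
        (hadd (g.φ h₁) (const (g.f U)))).left := by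
    rw [← pre_hcomp, ← pre_hcomp]
    exact congrArg (fun z => (D.comp k).obj (_, (D.add k).obj (z, _))) q
  have q'' : (hcomp (hcomp (f.φ h₂) (hadd (const (g.f ST)) (const (g.f U))))
        (hadd (cst (C.a h₁) k) (cst (𝟙 (C.A U)) k))).right =
      (hcomp (hcomp (const (f.f STU)) (g.φ h₂))
        (hadd (cst (C.a h₁) k) (cst (𝟙 (C.A U)) k))).left :=
    congrArg (fun z => (D.comp k).obj (z, _)) (f.glue_comp g h₂)
  have e₁ : A.pre h₂ (f.compφ g h₁) (const ((D.comp k).obj (f.f U, g.f U))) =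
      paste _ _ q' := by
    refine (congrArg (A.pre h₂ _) (const_paste _ _ rfl).symm).trans
      ((pre_paste (A := A) h₂ q rfl).trans (paste_congr _ ?_ ?_))
    · exact (congrArg (A.pre h₂ _) (const_comp _ _)).trans (pre_hcomp _ _ _ _ _)
    · exact (congrArg (A.pre h₂ _) (const_comp _ _)).trans (pre_hcomp _ _ _ _ _)
  have e₂ : hcomp (f.compφ g h₂) (hadd (cst (C.a h₁) k) (cst (𝟙 (C.A U)) k)) =
      paste _ _ q'' := by
    obtain ⟨c, hc⟩ := hc
    refine (congrArg (hcomp _) hc).trans ((hcomp_paste_const _ _ (f.glue_comp g h₂) c).trans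
      (paste_congr _ (congrArg (hcomp _) hc.symm) (congrArg (hcomp _) hc.symm)))
  refine (paste_congr p e₁ e₂).trans ?_
  refine rearrange (ex_hadd (ex_cst _) (ex_cst _))
    (ex_hadd (ex_hadd (ex_const _) (ex_const _)) (ex_const _))
    (ex_hadd (ex_const _) (ex_const _)) hc (ex_const _) (ex_cst (B.a h₂))
    (const_φ_left f h₂) ?_ ?_ (const_φ_right f h₂) _ _ _ pf pg pf'
  · rw [← SumSCat.hadd_hcomp, cst_id_hcomp]
    exact (hadd_const_const _ _).symm.trans
      (congrArg (fun z => hadd z _) (const_φ_left g h₁))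
  · rw [← SumSCat.hadd_hcomp, hcomp_cst_id]
    exact (hadd_const_const _ _).symm.trans
      (congrArg (fun z => hadd z _) (const_φ_right g h₁))

theorem compφ_right₃ (f : FatHom k A B) (g : FatHom k B C) {S T U TU STU : PtSub X}
    (h₃ : IsUnion T U TU) (h₄ : IsUnion S TU STU) (pf pg pf' p) :
    paste (A.pre h₄ (const ((D.comp k).obj (f.f S, g.f S))) (f.compφ g h₃))
      (hcomp (f.compφ g h₄) (hadd (cst (𝟙 (C.A S)) k) (cst (C.a h₃) k))) p =
    paste
      (hcomp (paste (A.pre h₄ (const (f.f S)) (f.φ h₃))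
        (hcomp (f.φ h₄) (hadd (cst (𝟙 (B.A S)) k) (cst (B.a h₃) k))) pf)
        (hadd (const (g.f S)) (hadd (const (g.f T)) (const (g.f U)))))
      (hcomp (const (f.f STU)) (paste (B.pre h₄ (const (g.f S)) (g.φ h₃))
        (hcomp (g.φ h₄) (hadd (cst (𝟙 (C.A S)) k) (cst (C.a h₃) k))) pg)) pf' := by
  have hc := ex_hadd (ex_cst (k := k) (𝟙 (C.A S))) (ex_cst (C.a h₃))
  have q := f.glue_comp g h₃
  have q' : (hcomp (A.pre h₄ (const (f.f S)) (f.φ h₃))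
      (hadd (const (g.f S)) (hadd (const (g.f T)) (const (g.f U))))).right =
      (hcomp (A.pre h₄ (const (f.f S)) (const (f.f TU)))
        (hadd (const (g.f S)) (g.φ h₃))).left := by
    rw [← pre_hcomp, ← pre_hcomp]
    exact congrArg (fun z => (D.comp k).obj (_, (D.add k).obj (_, z))) q
  have q'' : (hcomp (hcomp (f.φ h₄) (hadd (const (g.f S)) (const (g.f TU))))
        (hadd (cst (𝟙 (C.A S)) k) (cst (C.a h₃) k))).right =
      (hcomp (hcomp (const (f.f STU)) (g.φ h₄))
        (hadd (cst (𝟙 (C.A S)) k) (cst (C.a h₃) k))).left :=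
    congrArg (fun z => (D.comp k).obj (z, _)) (f.glue_comp g h₄)
  have e₁ : A.pre h₄ (const ((D.comp k).obj (f.f S, g.f S))) (f.compφ g h₃) =
      paste _ _ q' := by
    refine (congrArg (fun z => A.pre h₄ z _) (const_paste _ _ rfl).symm).trans
      ((pre_paste (A := A) h₄ rfl q).trans (paste_congr _ ?_ ?_))
    · exact (congrArg (fun z => A.pre h₄ z _) (const_comp _ _)).trans (pre_hcomp _ _ _ _ _)
    · exact (congrArg (fun z => A.pre h₄ z _) (const_comp _ _)).trans (pre_hcomp _ _ _ _ _)
  have e₂ : hcomp (f.compφ g h₄) (hadd (cst (𝟙 (C.A S)) k) (cst (C.a h₃) k)) =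
      paste _ _ q'' := by
    obtain ⟨c, hc⟩ := hc
    refine (congrArg (hcomp _) hc).trans ((hcomp_paste_const _ _ (f.glue_comp g h₄) c).trans
      (paste_congr _ (congrArg (hcomp _) hc.symm) (congrArg (hcomp _) hc.symm)))
  refine (paste_congr p e₁ e₂).trans ?_
  refine rearrange (ex_hadd (ex_cst _) (ex_cst _))
    (ex_hadd (ex_const _) (ex_hadd (ex_const _) (ex_const _)))
    (ex_hadd (ex_const _) (ex_const _)) hc (ex_const _) (ex_cst (B.a h₄))
    (const_φ_left f h₄) ?_ ?_ (const_φ_right f h₄) _ _ _ pf pg pf'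
  · rw [← SumSCat.hadd_hcomp, cst_id_hcomp]
    exact (hadd_const_const _ _).symm.trans
      (congrArg (fun z => hadd _ z) (const_φ_left g h₃))
  · rw [← SumSCat.hadd_hcomp, hcomp_cst_id]
    exact (hadd_const_const _ _).symm.trans
      (congrArg (fun z => hadd _ z) (const_φ_right g h₃))

theorem ex_hcomp {E : SCat.{u}} {A B C : E.Obj} {x : E.Cell k A B} {y : E.Cell k B C}
    (hx : ∃ Z, x = const Z) (hy : ∃ Z, y = const Z) : ∃ Z, hcomp x y = const Z := by
  obtain ⟨X, rfl⟩ := hx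
  obtain ⟨Y, rfl⟩ := hy
  exact ⟨_, hcomp_const_const _ _⟩

theorem ex_paste {K : Type u} [Category.{u} K] {x y : Arrow K} (hx : ∃ Z, x = const Z)
    (h : x.right = y.left) : paste x y h = y := by
  obtain ⟨X, rfl⟩ := hx
  exact const_paste _ _ _

theorem compφ_of_const (f : FatHom k A B) (g : FatHom k B C) {S T W : PtSub X}
    (h : IsUnion S T W) (hf : f.φ h = B.post h (const (f.f W)))
    (hg : g.φ h = C.post h (const (g.f W))) :
    f.compφ g h = C.post h (const ((D.comp k).obj (f.f W, g.f W))) := by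
  have hf' : ∃ Z, f.φ h = const Z := ⟨_, hf.trans (hcomp_const_const _ _)⟩
  refine (ex_paste (ex_hcomp hf' (ex_hadd (ex_const _) (ex_const _))) _).trans ?_
  rw [hg, ← post_hcomp]
  exact congrArg (C.post h) (const_comp _ _).symm

theorem glue_left₃ (f : FatHom k A B) (g : FatHom k B C) {S T U ST STU : PtSub X}
    (h₁ : IsUnion S T ST) (h₂ : IsUnion ST U STU) (pf pg) :
    (hcomp (paste (A.pre h₂ (f.φ h₁) (const (f.f U)))
        (hcomp (f.φ h₂) (hadd (cst (B.a h₁) k) (cst (𝟙 (B.A U)) k))) pf)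
        (hadd (hadd (const (g.f S)) (const (g.f T))) (const (g.f U)))).right =
      (hcomp (const (f.f STU)) (paste (B.pre h₂ (g.φ h₁) (const (g.f U)))
        (hcomp (g.φ h₂) (hadd (cst (C.a h₁) k) (cst (𝟙 (C.A U)) k))) pg)).left := by
  have e : hcomp (hcomp (const (f.φ h₂).right) (hadd (cst (B.a h₁) k) (cst (𝟙 (B.A U)) k)))
      (hadd (hadd (const (g.f S)) (const (g.f T))) (const (g.f U))) =
      hcomp (const (f.f STU)) (B.pre h₂ (const (g.φ h₁).left) (const (g.f U))) := by
    rw [const_φ_right, const_φ_left, post, pre, pre, hcomp_assoc, hcomp_assoc,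
      ← SumSCat.hadd_hcomp, cst_id_hcomp]
  exact congrArg Comma.right e

theorem glue_right₃ (f : FatHom k A B) (g : FatHom k B C) {S T U TU STU : PtSub X}
    (h₃ : IsUnion T U TU) (h₄ : IsUnion S TU STU) (pf pg) :
    (hcomp (paste (A.pre h₄ (const (f.f S)) (f.φ h₃))
        (hcomp (f.φ h₄) (hadd (cst (𝟙 (B.A S)) k) (cst (B.a h₃) k))) pf)
        (hadd (const (g.f S)) (hadd (const (g.f T)) (const (g.f U))))).right =
      (hcomp (const (f.f STU)) (paste (B.pre h₄ (const (g.f S)) (g.φ h₃))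
        (hcomp (g.φ h₄) (hadd (cst (𝟙 (C.A S)) k) (cst (C.a h₃) k))) pg)).left := by
  have e : hcomp (hcomp (const (f.φ h₄).right) (hadd (cst (𝟙 (B.A S)) k) (cst (B.a h₃) k)))
      (hadd (const (g.f S)) (hadd (const (g.f T)) (const (g.f U)))) =
      hcomp (const (f.f STU)) (B.pre h₄ (const (g.f S)) (const (g.φ h₃).left)) := by
    rw [const_φ_right, const_φ_left, post, pre, pre, hcomp_assoc, hcomp_assoc,
      ← SumSCat.hadd_hcomp, cst_id_hcomp]
  exact congrArg Comma.right e

theorem assemble {E : SCat.{u}} {A P M M' N N' : E.Obj} {l : E.Cell k A M} {r : E.Cell k A M'}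
    {n : E.Cell k M N} {n' : E.Cell k M' N'} {F : E.Cell k A P} {l' : E.Cell k P N}
    {r' : E.Cell k P N'} {α : E.Cell k M M'} {β : E.Cell k N N'} (hβ : ∃ Z, β = const Z)
    (e : hcomp l α = r) (e' : hcomp l' β = r') (nat : hcomp n β = hcomp α n') (p q) :
    hcomp (paste (hcomp l n) (hcomp F l') p) β = paste (hcomp r n') (hcomp F r') q := by
  obtain ⟨β, rfl⟩ := hβ
  refine (hcomp_paste_const _ _ p β).trans (paste_congr _ ?_ ?_)
  · rw [← e, hcomp_assoc, hcomp_assoc, nat]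
  · rw [← e', hcomp_assoc]

/-- The composite of `{f_S, φ_{S,T}}` and `{g_S, γ_{S,T}}`: it consists of the composites
`g_S ∘ f_S` and of the composite paths
`(g_S f_S + g_T f_T) ∘ a_{S,T} → (g_S + g_T) ∘ b_{S,T} ∘ f_{S ∪ T} → c_{S,T} ∘ g_{S ∪ T} f_{S ∪ T}`. -/
def FatHom.comp (f : FatHom k A B) (g : FatHom k B C) : FatHom k A C where
  f S := (D.comp k).obj (f.f S, g.f S)
  φ h := f.compφ g h
  φ_left {S T W} h := by
    have e : hcomp (A.pre h (const (f.f S)) (const (f.f T)))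
        (hadd (const (g.f S)) (const (g.f T))) =
        A.pre h (const ((D.comp k).obj (f.f S, g.f S))) (const ((D.comp k).obj (f.f T, g.f T))) := by
      rw [← pre_hcomp, const_comp, const_comp]
    refine Eq.trans ?_ (congrArg Comma.left e)
    exact congrArg (fun z => (D.comp k).obj (z, (D.add k).obj (g.f S, g.f T))) (f.φ_left h)
  φ_right {S T W} h := by
    have e : hcomp (const (f.f W)) (C.post h (const (g.f W))) =
        C.post h (const ((D.comp k).obj (f.f W, g.f W))) := by
      rw [← post_hcomp, const_comp]
    refine Eq.trans ?_ (congrArg Comma.right e)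
    exact congrArg (fun z => (D.comp k).obj (f.f W, z)) (g.φ_right h)
  f_empty := by
    rw [f.f_empty, g.f_empty]
    exact congrArg (fun z => Mor.app z k) (eqToHom_trans
      (A.A_empty.trans B.A_empty.symm) (B.A_empty.trans C.A_empty.symm))
  φ_empty_left {S} h := compφ_of_const f g h (f.φ_empty_left h) (g.φ_empty_left h)
  φ_empty_right {S} h := compφ_of_const f g h (f.φ_empty_right h) (g.φ_empty_right h)
  φ_symm {S T W} h := by
    refine Eq.trans (paste_congr _ ?_ ?_) (hcomp_paste_const _ _ (f.glue_comp g h) _).symm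
    · rw [f.φ_symm h, hcomp_assoc, hcomp_assoc]
      exact congrArg (hcomp (f.φ h)) (D.isPermutative.natural _ _).symm
    · rw [g.φ_symm h, hcomp_assoc]; rfl
  φ_assoc {S T U ST TU STU} h₁ h₂ h₃ h₄ := by
    have pf := GammaObj.glue_left h₁ h₂ (f.φ_right h₁) (f.φ_left h₂)
    have pg := GammaObj.glue_left h₁ h₂ (g.φ_right h₁) (g.φ_left h₂)
    have qf := GammaObj.glue_right h₃ h₄ (f.φ_right h₃) (f.φ_left h₄)
    have qg := GammaObj.glue_right h₃ h₄ (g.φ_right h₃) (g.φ_left h₄)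
    exact (congrArg (fun z => hcomp z _)
      (compφ_left₃ f g h₁ h₂ pf pg (glue_left₃ f g h₁ h₂ pf pg) _)).trans
      ((assemble (ex_cst _) (f.φ_assoc h₁ h₂ h₃ h₄) (g.φ_assoc h₁ h₂ h₃ h₄)
        (D.isPermutative.assoc _ _ _) _ (glue_right₃ f g h₃ h₄ qf qg)).trans
      (compφ_right₃ f g h₃ h₄ qf qg (glue_right₃ f g h₃ h₄ qf qg) _).symm)

theorem hadd_cst_id {D : SumSCat.{u}} (A B : D.Obj) :
    hadd (cst (𝟙 A) k) (cst (𝟙 B) k) = cst (𝟙 (A + B)) k :=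
  (hadd_const_const _ _).trans (congrArg const (D.add_unit A B k))

/-- The identity of `{A_S, a_{S,T}}`: identities and constant paths. -/
def FatHom.unit (k : SimplexCategoryᵒᵖ) (A : GammaObj D X) : FatHom k A A where
  f S := Mor.app (𝟙 (A.A S)) k
  φ h := cst (A.a h) k
  φ_left {S T W} h := by
    have e : A.pre h (cst (𝟙 (A.A S)) k) (cst (𝟙 (A.A T)) k) = cst (A.a h) k := by
      rw [pre, hadd_cst_id, hcomp_cst_id]
    exact (congrArg Comma.left e).symm
  φ_right {S T W} h := by
    have e : A.post h (cst (𝟙 (A.A W)) k) = cst (A.a h) k := cst_id_hcomp _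
    exact (congrArg Comma.right e).symm
  f_empty := rfl
  φ_empty_left h := (cst_id_hcomp _).symm
  φ_empty_right h := (cst_id_hcomp _).symm
  φ_symm h := by rw [← cst_comp, A.a_symm]
  φ_assoc {S T U ST TU STU} h₁ h₂ h₃ h₄ := by
    have e : cst (A.a h₂ ≫ SumSCat.madd (A.a h₁) (𝟙 (A.A U)) ≫ eqToHom (add_assoc _ _ _)) k =
        cst (A.a h₄ ≫ SumSCat.madd (𝟙 (A.A S)) (A.a h₃)) k :=
      congrArg (fun z => cst z k) (A.a_assoc h₁ h₂ h₃ h₄)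
    rw [cst_comp, cst_comp, cst_comp, cst_madd, cst_madd] at e
    refine (congrArg (fun z => hcomp z _) (ex_paste (ex_hcomp (ex_cst _)
      (ex_hadd (ex_cst _) (ex_const _))) _)).trans (Eq.trans ?_ (ex_paste (ex_hcomp (ex_cst _)
      (ex_hadd (ex_const _) (ex_cst _))) _).symm)
    rw [hcomp_assoc]
    exact e

theorem hcomp_paste {E : SCat.{u}} {A B C : E.Obj} {x x' : E.Cell k A B} {y y' : E.Cell k B C}
    (h : x.right = x'.left) (h' : y.right = y'.left) (p) :
    hcomp (paste x x' h) (paste y y' h') = paste (hcomp x y) (hcomp x' y') p :=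
  map₂_paste _ _ _ _ _ _ _

/-- Composition. -/
def FatHom.compFunctor (k : SimplexCategoryᵒᵖ) (A B C : GammaObj D X) :
    FatHom k A B × FatHom k B C ⥤ FatHom k A C where
  obj x := x.1.comp x.2
  map {x y} a :=
    { ψ := fun S => (D.comp k).map (X := (x.1.f S, x.2.f S)) (Y := (y.1.f S, y.2.f S))
        (FatHom₂.ψ a.1 S, FatHom₂.ψ a.2 S)
      ψ_empty := (congrArg₂ hcomp (FatHom₂.ψ_empty a.1) (FatHom₂.ψ_empty a.2)).trans
        (hcomp_const_const _ _)
      comm := fun {S T W} h => by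
        obtain ⟨f, g⟩ := x
        obtain ⟨f', g'⟩ := y
        obtain ⟨a, b⟩ := a
        have ca := FatHom₂.comm a h
        have cb := FatHom₂.comm b h
        let χ := hadd (Arrow.mk (FatHom₂.ψ b S)) (Arrow.mk (FatHom₂.ψ b T))
        have r₁ : χ.right = (hadd (const (g'.f S)) (const (g'.f T))).left := rfl
        have r₂ : (hadd (const (g.f S)) (const (g.f T))).right = χ.left := rfl
        have s₁ : paste χ (hadd (const (g'.f S)) (const (g'.f T))) r₁ = χ :=
          (paste_congr _ rfl (hadd_const_const _ _)).trans (paste_const _ _ _)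
        have s₂ : paste (hadd (const (g.f S)) (const (g.f T))) χ r₂ = χ :=
          (paste_congr _ (hadd_const_const _ _) rfl).trans (const_paste _ _ _)
        have e₁ : A.pre h (hcomp (Arrow.mk (FatHom₂.ψ a S)) (Arrow.mk (FatHom₂.ψ b S)))
            (hcomp (Arrow.mk (FatHom₂.ψ a T)) (Arrow.mk (FatHom₂.ψ b T))) =
            hcomp (A.pre h (Arrow.mk (FatHom₂.ψ a S)) (Arrow.mk (FatHom₂.ψ a T))) χ :=
          pre_hcomp _ _ _ _ _
        have e₂ : hcomp (B.post h (Arrow.mk (FatHom₂.ψ a W))) χ =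
            hcomp (Arrow.mk (FatHom₂.ψ a W))
              (B.pre h (Arrow.mk (FatHom₂.ψ b S)) (Arrow.mk (FatHom₂.ψ b T))) :=
          hcomp_assoc _ _ _
        have e₃ : hcomp (Arrow.mk (FatHom₂.ψ a W)) (C.post h (Arrow.mk (FatHom₂.ψ b W))) =
            C.post h (hcomp (Arrow.mk (FatHom₂.ψ a W)) (Arrow.mk (FatHom₂.ψ b W))) :=
          (post_hcomp _ _ _).symm
        have t₁ : (hcomp (A.pre h (Arrow.mk (FatHom₂.ψ a S)) (Arrow.mk (FatHom₂.ψ a T)))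
            χ).right = (hcomp (f'.φ h) (hadd (const (g'.f S)) (const (g'.f T)))).left :=
          congrArg (fun z => (D.comp k).obj (z, χ.right)) (f'.φ_left h).symm
        have t₂ : (hcomp (f.φ h) (hadd (const (g.f S)) (const (g.f T)))).right =
            (hcomp (B.post h (Arrow.mk (FatHom₂.ψ a W))) χ).left :=
          congrArg (fun z => (D.comp k).obj (z, χ.left)) (f.φ_right h)
        have t₃ : (hcomp (Arrow.mk (FatHom₂.ψ a W))
            (B.pre h (Arrow.mk (FatHom₂.ψ b S)) (Arrow.mk (FatHom₂.ψ b T)))).right =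
            (hcomp (const (f'.f W)) (g'.φ h)).left :=
          congrArg (fun z => (D.comp k).obj (f'.f W, z)) (g'.φ_left h).symm
        have t₄ : (hcomp (const (f.f W)) (g.φ h)).right =
            (hcomp (Arrow.mk (FatHom₂.ψ a W)) (C.post h (Arrow.mk (FatHom₂.ψ b W)))).left :=
          congrArg (fun z => (D.comp k).obj (f.f W, z)) (g.φ_right h)
        have c₁ : paste _ _ t₁ = paste _ _ t₂ := by
          refine (hcomp_paste (f'.φ_left h).symm r₁ t₁).symm.trans (Eq.trans ?_
            (hcomp_paste (f.φ_right h) r₂ t₂))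
          rw [s₁, s₂, ca]
        have c₂ : paste _ _ t₃ = paste _ _ t₄ := by
          have u₁ : paste (Arrow.mk (FatHom₂.ψ a W)) (const (f'.f W)) rfl = _ := paste_const _ _ _
          have u₂ : paste (const (f.f W)) (Arrow.mk (FatHom₂.ψ a W)) rfl = _ := const_paste _ _ _
          refine (hcomp_paste rfl (g'.φ_left h).symm t₃).symm.trans (Eq.trans ?_
            (hcomp_paste rfl (g.φ_right h) t₄))
          rw [u₁, u₂, cb]
        have v₁ : (hcomp (B.post h (Arrow.mk (FatHom₂.ψ a W))) χ).right =
            (hcomp (const (f'.f W)) (g'.φ h)).left := (congrArg Comma.right e₂).trans t₃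
        have v₂ : (hcomp (f.φ h) (hadd (const (g.f S)) (const (g.f T)))).right =
            (hcomp (Arrow.mk (FatHom₂.ψ a W))
            (B.pre h (Arrow.mk (FatHom₂.ψ b S)) (Arrow.mk (FatHom₂.ψ b T)))).left :=
          t₂.trans (congrArg Comma.left e₂)
        have v₃ := f.glue_comp g h
        calc paste (A.pre h (hcomp (Arrow.mk (FatHom₂.ψ a S)) (Arrow.mk (FatHom₂.ψ b S)))
              (hcomp (Arrow.mk (FatHom₂.ψ a T)) (Arrow.mk (FatHom₂.ψ b T)))) (f'.compφ g' h) _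
            = paste _ (paste _ _ (f'.glue_comp g' h)) t₁ := paste_congr _ e₁ rfl
          _ = paste (paste _ _ t₁) _ (f'.glue_comp g' h) := (paste_assoc _ _ _ _ _).symm
          _ = paste (paste _ _ t₂) _ v₁ := paste_congr _ c₁ rfl
          _ = paste _ (paste _ _ v₁) t₂ := paste_assoc _ _ _ _ _
          _ = paste _ (paste _ _ t₃) v₂ := paste_congr _ rfl (paste_congr _ e₂ rfl)
          _ = paste _ (paste _ _ t₄) v₃ := paste_congr _ rfl c₂
          _ = paste (paste _ _ v₃) _ t₄ := (paste_assoc _ _ _ _ _).symm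
          _ = _ := paste_congr _ rfl e₃ }
  map_id x := FatHom₂.ext (funext fun S => CategoryTheory.Functor.map_id (D.comp k) _)
  map_comp {x y z} a b := FatHom₂.ext (funext fun S => (D.comp k).map_comp
    (X := (x.1.f S, x.2.f S)) (Y := (y.1.f S, y.2.f S)) (Z := (z.1.f S, z.2.f S))
    (FatHom₂.ψ a.1 S, FatHom₂.ψ a.2 S) (FatHom₂.ψ b.1 S, FatHom₂.ψ b.2 S))

theorem unit_compφ (f : FatHom k A B) {S T W : PtSub X} (h : IsUnion S T W) :
    (FatHom.unit k A).compφ f h = f.φ h := by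
  refine (ex_paste (ex_hcomp (ex_cst _) (ex_hadd (ex_const _) (ex_const _))) _).trans ?_
  exact cst_id_hcomp _

theorem compφ_unit (f : FatHom k A B) {S T W : PtSub X} (h : IsUnion S T W) :
    f.compφ (FatHom.unit k B) h = f.φ h := by
  have e : hcomp (f.φ h) (hadd (cst (𝟙 (B.A S)) k) (cst (𝟙 (B.A T)) k)) = f.φ h := by
    rw [hadd_cst_id, hcomp_cst_id]
  refine (paste_congr _ e (hcomp_const_const _ _)).trans (paste_const _ _ _)

theorem compφ_assoc {M : GammaObj D X} (f : FatHom k A B) (g : FatHom k B C) (g' : FatHom k C M)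
    {S T W : PtSub X} (h : IsUnion S T W) :
    (f.comp g).compφ g' h = f.compφ (g.comp g') h := by
  obtain ⟨n, hn⟩ := ex_hadd (ex_const (g'.f S)) (ex_const (g'.f T))
  have p₁ : (hcomp (hcomp (f.φ h) (hadd (const (g.f S)) (const (g.f T)))) (const n)).right =
      (hcomp (hcomp (const (f.f W)) (g.φ h)) (const n)).left :=
    congrArg (fun z => (D.comp k).obj (z, n)) (f.glue_comp g h)
  have p₂ : (hcomp (const (f.f W)) (hcomp (g.φ h) (const n))).right =
      (hcomp (const (f.f W)) (hcomp (const (g.f W)) (g'.φ h))).left := by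
    rw [← hn]
    exact congrArg (fun z => (D.comp k).obj (f.f W, z)) (g.glue_comp g' h)
  have e₁ : hcomp ((f.comp g).φ h) (hadd (const (g'.f S)) (const (g'.f T))) = paste _ _ p₁ :=
    (congrArg (hcomp _) hn).trans (hcomp_paste_const _ _ (f.glue_comp g h) n)
  have e₂ : hcomp (const (f.f W)) ((g.comp g').φ h) = paste _ _ p₂ :=
    (hcomp_const_paste _ _ (g.glue_comp g' h) _).trans
      (paste_congr _ (congrArg (fun z => hcomp _ (hcomp _ z)) hn) rfl)
  have e₃ : hcomp (const ((f.comp g).f W)) (g'.φ h) =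
      hcomp (const (f.f W)) (hcomp (const (g.f W)) (g'.φ h)) :=
    (congrArg (fun z => hcomp z _) (const_comp _ _)).trans (hcomp_assoc _ _ _)
  have e₄ : hcomp (f.φ h) (hadd (const ((g.comp g').f S)) (const ((g.comp g').f T))) =
      hcomp (hcomp (f.φ h) (hadd (const (g.f S)) (const (g.f T)))) (const n) := by
    refine (congrArg (hcomp _) (congrArg₂ hadd (const_comp _ _) (const_comp _ _))).trans ?_
    rw [SumSCat.hadd_hcomp, hn, hcomp_assoc]
  have p₃ := (congrArg Comma.right (hcomp_assoc (const (f.f W)) (g.φ h) (const n))).trans p₂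
  have p₁' := p₁.trans (congrArg Comma.left (hcomp_assoc (const (f.f W)) (g.φ h) (const n)))
  calc (f.comp g).compφ g' h
      = paste (paste _ _ p₁) (hcomp (const (f.f W)) (hcomp (const (g.f W)) (g'.φ h))) p₃ :=
        (paste_congr _ e₁ e₃).trans (by rfl)
    _ = paste (paste _ (hcomp (const (f.f W)) (hcomp (g.φ h) (const n))) p₁') _ p₂ :=
        paste_congr _ (paste_congr _ rfl (hcomp_assoc _ _ _)) rfl
    _ = paste _ (paste _ _ p₂) p₁' := paste_assoc _ _ _ _ _
    _ = f.compφ (g.comp g') h := (paste_congr _ e₄ e₂).symm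

theorem res_compφ {l : SimplexCategoryᵒᵖ} (θ : k ⟶ l) (f : FatHom k A B) (g : FatHom k B C)
    {S T W : PtSub X} (h : IsUnion S T W) :
    D.res θ (f.compφ g h) = (f.res θ).compφ (g.res θ) h := by
  refine (res_paste _ _ _ _).trans (paste_congr _ ?_ ?_)
  · rw [res_hcomp, SumSCat.res_hadd, res_const, res_const]; rfl
  · rw [res_hcomp, res_const]; rfl

end

end FatComposition

/-- The value at `X = {0, 1, ..., n}` of the `Γ`-category with paths. -/
def fat (D : PermSCat.{u}) (X : FinPtd) : SCat.{u} where
  Obj := GammaObj D X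
  Hom A B := fatHom A B
  unit A k := FatHom.unit k A
  comp {A B C} k := FatHom.compFunctor k A B C
  map_unit A k l θ := FatHom.ext (funext fun _ => D.map_unit _ θ)
    (by funext S T W h; exact res_cst _ _ θ)
  map_comp θ x y := FatHom.arrow_ext
    (fun S => D.map_comp θ (Arrow.mk (FatHom₂.ψ x.hom S)) (Arrow.mk (FatHom₂.ψ y.hom S)))
    (fun h => res_compφ θ x.left y.left h) (fun h => res_compφ θ x.right y.right h)
  unit_comp x := FatHom.arrow_ext (fun S => D.unit_comp (Arrow.mk (FatHom₂.ψ x.hom S)))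
    (fun h => unit_compφ x.left h) (fun h => unit_compφ x.right h)
  comp_unit x := FatHom.arrow_ext (fun S => D.comp_unit (Arrow.mk (FatHom₂.ψ x.hom S)))
    (fun h => compφ_unit x.left h) (fun h => compφ_unit x.right h)
  assoc x y z := FatHom.arrow_ext
    (fun S => D.assoc (Arrow.mk (FatHom₂.ψ x.hom S)) (Arrow.mk (FatHom₂.ψ y.hom S))
      (Arrow.mk (FatHom₂.ψ z.hom S)))
    (fun h => compφ_assoc x.left y.left z.left h)
    (fun h => compφ_assoc x.right y.right z.right h)

section ThinCategory

variable {D : PermSCat.{u}} {X : FinPtd}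

open GammaObj

instance (k : SimplexCategoryᵒᵖ) (A B : GammaObj D X) : Category (ThinHom k A B) where
  Hom f g := ThinHom₂ f g
  id f :=
    { ψ := fun S => 𝟙 (f.f S)
      ψ_empty := rfl
      comm := fun h => f.comm h }
  comp {f g g'} a b :=
    { ψ := fun S => a.ψ S ≫ b.ψ S
      ψ_empty := by
        have ha := a.ψ_empty
        have hb := b.ψ_empty
        rw [← paste_mk, paste_congr rfl ha rfl, const_paste, hb]
        exact congrArg const (congrArg Comma.right ha)
      comm := fun {S T W} h => by
        refine (congrArg₂ (A.pre h) (paste_mk _ _).symm (paste_mk _ _).symm).trans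
          ((pre_paste h rfl rfl).trans ?_)
        refine Eq.trans ?_ (congrArg (B.post h) (paste_mk _ _).symm |>.trans (post_paste h rfl)).symm
        exact paste_congr _ (a.comm h) (b.comm h) }
  id_comp a := ThinHom₂.ext (funext fun S => Category.id_comp _)
  comp_id a := ThinHom₂.ext (funext fun S => Category.comp_id _)
  assoc a b c := ThinHom₂.ext (funext fun S => Category.assoc _ _ _)

theorem ThinHom.arrow_ext {k : SimplexCategoryᵒᵖ} {A B : GammaObj D X}
    {x y : Arrow (ThinHom k A B)}
    (hψ : ∀ S, Arrow.mk (ThinHom₂.ψ x.hom S) = Arrow.mk (ThinHom₂.ψ y.hom S)) : x = y := by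
  obtain ⟨f, g, a, rfl⟩ := x.mk_surjective
  obtain ⟨f', g', a', rfl⟩ := y.mk_surjective
  obtain rfl : f = f' := ThinHom.ext (funext fun S => congrArg Comma.left (hψ S))
  obtain rfl : g = g' := ThinHom.ext (funext fun S => congrArg Comma.right (hψ S))
  exact congrArg Arrow.mk (ThinHom₂.ext (funext fun S => Arrow.mk_injective _ _ (hψ S)))

/-- The simplicial structure. -/
def ThinHom.resFunctor {k l : SimplexCategoryᵒᵖ} (θ : k ⟶ l) (A B : GammaObj D X) :
    ThinHom k A B ⥤ ThinHom l A B where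
  obj f :=
    { f := fun S => ((D.Hom (A.A S) (B.A S)).map θ).toFunctor.obj (f.f S)
      f_empty := by rw [f.f_empty, Mor.map_app]
      comm := fun h => by
        rw [← res_const, ← res_const, ← res_const, ← res_pre, ← res_post, f.comm h] }
  map {f g} a :=
    { ψ := fun S => ((D.Hom (A.A S) (B.A S)).map θ).toFunctor.map (ThinHom₂.ψ a S)
      ψ_empty := (congrArg (D.res θ) (ThinHom₂.ψ_empty a)).trans (res_const _ _)
      comm := fun h => (res_pre θ h _ _).symm.trans
        ((congrArg (D.res θ) (ThinHom₂.comm a h)).trans (res_post θ h _)) }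
  map_id f := ThinHom₂.ext (funext fun S => CategoryTheory.Functor.map_id _ _)
  map_comp a b := ThinHom₂.ext (funext fun S => CategoryTheory.Functor.map_comp _ _ _)

/-- The simplicial category of morphisms from `A` to `B`. -/
def thinHom (A B : GammaObj D X) : SimplexCategoryᵒᵖ ⥤ Cat.{u, u} where
  obj k := Cat.of (ThinHom k A B)
  map θ := (ThinHom.resFunctor θ A B).toCatHom
  map_id _ := Cat.ext (functor_ext_arrow fun x => ThinHom.arrow_ext
    (fun S => res_id (E := D.toSCat) (Arrow.mk (ThinHom₂.ψ x.hom S))))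
  map_comp θ θ' := Cat.ext (functor_ext_arrow fun x => ThinHom.arrow_ext
    (fun S => res_comp (E := D.toSCat) θ θ' (Arrow.mk (ThinHom₂.ψ x.hom S))))

theorem thin_comm_comp {k : SimplexCategoryᵒᵖ} {A B C : GammaObj D X} {S T W : PtSub X}
    (h : IsUnion S T W) {x : D.Cell k (A.A S) (B.A S)} {y : D.Cell k (A.A T) (B.A T)}
    {z : D.Cell k (A.A W) (B.A W)} {x' : D.Cell k (B.A S) (C.A S)}
    {y' : D.Cell k (B.A T) (C.A T)} {z' : D.Cell k (B.A W) (C.A W)}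
    (e : A.pre h x y = B.post h z) (e' : B.pre h x' y' = C.post h z') :
    A.pre h (hcomp x x') (hcomp y y') = C.post h (hcomp z z') := by
  rw [pre_hcomp, e, post_hcomp, ← e', post, pre, hcomp_assoc]

/-- Composition. -/
def ThinHom.compFunctor (k : SimplexCategoryᵒᵖ) (A B C : GammaObj D X) :
    ThinHom k A B × ThinHom k B C ⥤ ThinHom k A C where
  obj x :=
    { f := fun S => (D.comp k).obj (x.1.f S, x.2.f S)
      f_empty := by
        rw [x.1.f_empty, x.2.f_empty]
        exact congrArg (fun z => Mor.app z k) (eqToHom_trans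
          (A.A_empty.trans B.A_empty.symm) (B.A_empty.trans C.A_empty.symm))
      comm := fun h => by
        rw [const_comp, const_comp, const_comp]
        exact thin_comm_comp h (x.1.comm h) (x.2.comm h) }
  map {x y} a :=
    { ψ := fun S => (D.comp k).map (X := (x.1.f S, x.2.f S)) (Y := (y.1.f S, y.2.f S))
        (ThinHom₂.ψ a.1 S, ThinHom₂.ψ a.2 S)
      ψ_empty := (congrArg₂ hcomp (ThinHom₂.ψ_empty a.1) (ThinHom₂.ψ_empty a.2)).trans
        (hcomp_const_const _ _)
      comm := fun h => thin_comm_comp h (ThinHom₂.comm a.1 h) (ThinHom₂.comm a.2 h) }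
  map_id x := ThinHom₂.ext (funext fun S => CategoryTheory.Functor.map_id (D.comp k) _)
  map_comp {x y z} a b := ThinHom₂.ext (funext fun S => (D.comp k).map_comp
    (X := (x.1.f S, x.2.f S)) (Y := (y.1.f S, y.2.f S)) (Z := (z.1.f S, z.2.f S))
    (ThinHom₂.ψ a.1 S, ThinHom₂.ψ a.2 S) (ThinHom₂.ψ b.1 S, ThinHom₂.ψ b.2 S))

end ThinCategory

/-- The value at `X = {0, 1, ..., n}` of the standard `Γ`-category. -/
def thin (D : PermSCat.{u}) (X : FinPtd) : SCat.{u} where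
  Obj := GammaObj D X
  Hom A B := thinHom A B
  unit A k :=
    { f := fun S => Mor.app (𝟙 (A.A S)) k
      f_empty := rfl
      comm := fun h => by
        change A.pre h (cst (𝟙 _) k) (cst (𝟙 _) k) = A.post h (cst (𝟙 _) k)
        rw [GammaObj.pre, GammaObj.post, hadd_cst_id, hcomp_cst_id, cst_id_hcomp] }
  comp {A B C} k := ThinHom.compFunctor k A B C
  map_unit A k l θ := ThinHom.ext (funext fun _ => D.map_unit _ θ)
  map_comp θ x y := ThinHom.arrow_ext
    (fun S => D.map_comp θ (Arrow.mk (ThinHom₂.ψ x.hom S)) (Arrow.mk (ThinHom₂.ψ y.hom S)))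
  unit_comp x := ThinHom.arrow_ext (fun S => D.unit_comp (Arrow.mk (ThinHom₂.ψ x.hom S)))
  comp_unit x := ThinHom.arrow_ext (fun S => D.comp_unit (Arrow.mk (ThinHom₂.ψ x.hom S)))
  assoc x y z := ThinHom.arrow_ext
    (fun S => D.assoc (Arrow.mk (ThinHom₂.ψ x.hom S)) (Arrow.mk (ThinHom₂.ψ y.hom S))
      (Arrow.mk (ThinHom₂.ψ z.hom S)))

/-! ### Functoriality in the finite pointed set -/

section Push

variable {D : PermSCat.{u}} {X Y : FinPtd}

/-- The functor `{f_S} ↦ {f_{θ⁻¹ S}}`. -/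
def ThinHom.push (θ : X ⟶ Y) (k : SimplexCategoryᵒᵖ) (A B : GammaObj D X) :
    ThinHom k A B ⥤ ThinHom k (A.push θ) (B.push θ) where
  obj f :=
    { f := fun S => f.f (S.preimage θ)
      f_empty := f.f_empty
      comm := fun h => f.comm (h.preimage θ) }
  map a :=
    { ψ := fun S => ThinHom₂.ψ a (S.preimage θ)
      ψ_empty := ThinHom₂.ψ_empty a
      comm := fun h => ThinHom₂.comm a (h.preimage θ) }
  map_id _ := rfl
  map_comp _ _ := rfl

/-- The functor `{f_S, φ_{S,T}} ↦ {f_{θ⁻¹ S}, φ_{θ⁻¹ S, θ⁻¹ T}}`. -/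
def FatHom.push (θ : X ⟶ Y) (k : SimplexCategoryᵒᵖ) (A B : GammaObj D X) :
    FatHom k A B ⥤ FatHom k (A.push θ) (B.push θ) where
  obj f :=
    { f := fun S => f.f (S.preimage θ)
      φ := fun h => f.φ (h.preimage θ)
      φ_left := fun h => f.φ_left (h.preimage θ)
      φ_right := fun h => f.φ_right (h.preimage θ)
      f_empty := f.f_empty
      φ_empty_left := fun h => f.φ_empty_left (h.preimage θ)
      φ_empty_right := fun h => f.φ_empty_right (h.preimage θ)
      φ_symm := fun h => f.φ_symm (h.preimage θ)
      φ_assoc := fun h₁ h₂ h₃ h₄ => f.φ_assoc (h₁.preimage θ) (h₂.preimage θ)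
        (h₃.preimage θ) (h₄.preimage θ) }
  map a :=
    { ψ := fun S => FatHom₂.ψ a (S.preimage θ)
      ψ_empty := FatHom₂.ψ_empty a
      comm := fun h => FatHom₂.comm a (h.preimage θ) }
  map_id _ := rfl
  map_comp _ _ := rfl

/-- The enriched functor induced by a pointed map on the values of the standard `Γ`-category. -/
def thinPush (D : PermSCat.{u}) (θ : X ⟶ Y) : thin D X ⟶ thin D Y where
  obj (A : GammaObj D X) := A.push θ
  map (A B : GammaObj D X) :=
    { app := fun k => (ThinHom.push θ k A B).toCatHom
      naturality := fun _ _ _ => rfl }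
  map_unit _ _ := rfl
  map_comp _ _ := rfl

/-- The enriched functor induced by a pointed map on the values of the `Γ`-category with paths. -/
def fatPush (D : PermSCat.{u}) (θ : X ⟶ Y) : fat D X ⟶ fat D Y where
  obj (A : GammaObj D X) := A.push θ
  map (A B : GammaObj D X) :=
    { app := fun k => (FatHom.push θ k A B).toCatHom
      naturality := fun _ _ _ => rfl }
  map_unit _ _ := rfl
  map_comp _ _ := rfl

end Push

/-- The standard `Γ`-category of a permutative category. -/
def thinGamma (D : PermSCat.{u}) : FinPtd ⥤ SCat.{u} where
  obj X := thin D X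
  map θ := thinPush D θ
  map_id _ := rfl
  map_comp _ _ := rfl

/-- The `Γ`-category with paths of a permutative category. -/
def fatGamma (D : PermSCat.{u}) : FinPtd ⥤ SCat.{u} where
  obj X := fat D X
  map θ := fatPush D θ
  map_id _ := rfl
  map_comp _ _ := rfl

/-! ### The inclusion and the projection -/

section Inclusion

variable {D : PermSCat.{u}} {X : FinPtd} {k : SimplexCategoryᵒᵖ}

open GammaObj

/-- A family `{f_S}` with `(f_S + f_T) ∘ a_{S,T} = b_{S,T} ∘ f_{S ∪ T}`, together with the constant
paths at these morphisms. -/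
def FatHom.ofThin {A B : GammaObj D X} (f : ThinHom k A B) : FatHom k A B where
  f := f.f
  φ {S T W} h := B.post h (const (f.f W))
  φ_left h := (congrArg Comma.left (f.comm h)).symm
  φ_right h := rfl
  f_empty := f.f_empty
  φ_empty_left h := rfl
  φ_empty_right h := rfl
  φ_symm {S T W} h := by rw [post, post, hcomp_assoc, ← cst_comp, B.a_symm]
  φ_assoc {S T U ST TU STU} h₁ h₂ h₃ h₄ := by
    have e : cst (B.a h₂ ≫ SumSCat.madd (B.a h₁) (𝟙 (B.A U)) ≫ eqToHom (add_assoc _ _ _)) k =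
        cst (B.a h₄ ≫ SumSCat.madd (𝟙 (B.A S)) (B.a h₃)) k :=
      congrArg (fun z => cst z k) (B.a_assoc h₁ h₂ h₃ h₄)
    rw [cst_comp, cst_comp, cst_comp, cst_madd, cst_madd] at e
    have c : ∀ {S T W : PtSub X} (h : IsUnion S T W), ∃ Z, B.post h (const (f.f W)) = const Z :=
      fun h => ex_hcomp (ex_const _) (ex_cst _)
    refine (congrArg (fun z => hcomp z _) (ex_paste (ex_hcomp (ex_cst _)
      (ex_hadd (c h₁) (ex_const _))) _)).trans (Eq.trans ?_ (ex_paste (ex_hcomp (ex_cst _)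
      (ex_hadd (ex_const _) (c h₃))) _).symm)
    rw [post, post, hcomp_assoc, hcomp_assoc, hcomp_assoc, ← e]

/-- The inclusion on categories of morphisms. -/
def ThinHom.incl (k : SimplexCategoryᵒᵖ) (A B : GammaObj D X) : ThinHom k A B ⥤ FatHom k A B where
  obj f := FatHom.ofThin f
  map {f g} a :=
    { ψ := fun S => ThinHom₂.ψ a S
      ψ_empty := ThinHom₂.ψ_empty a
      comm := fun {S T W} h => by
        refine (paste_congr _ rfl (hcomp_const_const _ _)).trans ((paste_const _ _ _).trans ?_)
        refine (ThinHom₂.comm a h).trans (Eq.trans ?_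
          (paste_congr _ (hcomp_const_const _ _) rfl).symm)
        exact (const_paste _ _ _).symm }
  map_id _ := rfl
  map_comp _ _ := rfl

theorem FatHom.ofThin_res {l : SimplexCategoryᵒᵖ} (θ : k ⟶ l) {A B : GammaObj D X}
    (f : ThinHom k A B) {S T W : PtSub X} (h : IsUnion S T W) :
    ((FatHom.ofThin f).res θ).φ h = (FatHom.ofThin ((ThinHom.resFunctor θ A B).obj f)).φ h := by
  refine (res_post θ h _).trans ?_
  rw [res_const]
  rfl

end Inclusion

/-- The inclusion `i` of the standard `Γ`-category into the `Γ`-category with paths. -/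
def incl (D : PermSCat.{u}) : thinGamma D ⟶ fatGamma D where
  app X :=
    { obj := fun (A : GammaObj D X) => A
      map := fun (A B : GammaObj D X) =>
        { app := fun k => (ThinHom.incl k A B).toCatHom
          naturality := fun k l θ => Cat.ext (functor_ext_arrow fun x => FatHom.arrow_ext
            (fun S => rfl) (fun h => (FatHom.ofThin_res θ x.left h).symm)
            (fun h => (FatHom.ofThin_res θ x.right h).symm)) }
      map_unit := fun (A : GammaObj D X) k => FatHom.ext (A := A) (B := A) rfl
        (by funext S T W h; exact cst_id_hcomp (cst (A.a h) k))
      map_comp := fun {A B C k} x y => FatHom.arrow_ext (fun S => rfl)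
        (fun h => (compφ_of_const (FatHom.ofThin x.left) (FatHom.ofThin y.left) h rfl rfl).symm)
        (fun h =>
          (compφ_of_const (FatHom.ofThin x.right) (FatHom.ofThin y.right) h rfl rfl).symm) }
  naturality _ _ _ := rfl

theorem pi_arrow_ext {ι : Type} {C : ι → Type u} [∀ i, Category.{u} (C i)]
    {x y : Arrow (∀ i, C i)} (h : ∀ i, Arrow.mk (x.hom i) = Arrow.mk (y.hom i)) : x = y := by
  obtain ⟨f, g, a, rfl⟩ := x.mk_surjective
  obtain ⟨f', g', a', rfl⟩ := y.mk_surjective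
  obtain rfl : f = f' := funext fun i => congrArg Comma.left (h i)
  obtain rfl : g = g' := funext fun i => congrArg Comma.right (h i)
  exact congrArg Arrow.mk (funext fun i => Arrow.mk_injective _ _ (h i))

/-- The product of a family of categories enriched over simplicial categories. -/
def SCat.pi {ι : Type} (E : ι → SCat.{u}) : SCat.{u} where
  Obj := ∀ i, (E i).Obj
  Hom A B :=
    { obj := fun k => Cat.of (∀ i, ((E i).Hom (A i) (B i)).obj k)
      map := fun θ => (CategoryTheory.Functor.pi fun i =>
        (((E i).Hom (A i) (B i)).map θ).toFunctor).toCatHom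
      map_id := fun k => Cat.ext (functor_ext_arrow fun x => pi_arrow_ext
        (C := fun i => ((E i).Hom (A i) (B i)).obj k)
        fun i => res_id (E := E i) (Arrow.mk (x.hom i)))
      map_comp := fun {_ _ m} θ θ' => Cat.ext (functor_ext_arrow fun x => pi_arrow_ext
        (C := fun i => ((E i).Hom (A i) (B i)).obj m)
        fun i => res_comp (E := E i) θ θ' (Arrow.mk (x.hom i))) }
  unit A k := fun i => (E i).unit (A i) k
  comp {A B C} k :=
    { obj := fun x i => ((E i).comp k).obj (x.1 i, x.2 i)
      map := fun {x y} f i => ((E i).comp k).map (X := (x.1 i, x.2 i)) (Y := (y.1 i, y.2 i))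
        (f.1 i, f.2 i)
      map_id := fun x => funext fun i => CategoryTheory.Functor.map_id ((E i).comp k) _
      map_comp := fun {x y z} f g => funext fun i => ((E i).comp k).map_comp
        (X := (x.1 i, x.2 i)) (Y := (y.1 i, y.2 i)) (Z := (z.1 i, z.2 i))
        (f.1 i, f.2 i) (g.1 i, g.2 i) }
  map_unit A k l θ := funext fun i => (E i).map_unit (A i) θ
  map_comp {A B C k l} θ x y := pi_arrow_ext (C := fun i => ((E i).Hom (A i) (C i)).obj l)
    fun i => (E i).map_comp θ (Arrow.mk (x.hom i)) (Arrow.mk (y.hom i))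
  unit_comp {A B k} x := pi_arrow_ext (C := fun i => ((E i).Hom (A i) (B i)).obj k)
    fun i => (E i).unit_comp (Arrow.mk (x.hom i))
  comp_unit {A B k} x := pi_arrow_ext (C := fun i => ((E i).Hom (A i) (B i)).obj k)
    fun i => (E i).comp_unit (Arrow.mk (x.hom i))
  assoc {A B C M k} x y z := pi_arrow_ext (C := fun i => ((E i).Hom (A i) (M i)).obj k)
    fun i => (E i).assoc (Arrow.mk (x.hom i)) (Arrow.mk (y.hom i)) (Arrow.mk (z.hom i))

/-- The enriched functor to a product with given components. -/
def SCat.lift {ι : Type} {F : SCat.{u}} {E : ι → SCat.{u}} (p : ∀ i, F ⟶ E i) :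
    F ⟶ SCat.pi E where
  obj A i := (p i).obj A
  map A B :=
    { app := fun k => (Functor.pi' fun i => (((p i).map A B).app k).toFunctor).toCatHom
      naturality := fun k l θ => Cat.ext (functor_ext_arrow fun x => pi_arrow_ext
        (C := fun i => ((E i).Hom ((p i).obj A) ((p i).obj B)).obj l)
        fun i => congrArg (fun G => G.toFunctor.mapArrow.obj x) (((p i).map A B).naturality θ)) }
  map_unit A k := funext fun i => (p i).map_unit A k
  map_comp {A B C k} x y := pi_arrow_ext
    (C := fun i => ((E i).Hom ((p i).obj A) ((p i).obj C)).obj k)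
    fun i => (p i).map_comp x y

/-- The projection onto the component of `{i + 1}`. -/
def projComponent (D : PermSCat.{u}) (X : FinPtd) (i : Fin X.n) :
    (fatGamma D).obj X ⟶ D.toSCat where
  obj (A : GammaObj D X) := A.A (single i)
  map (A B : GammaObj D X) :=
    { app := fun k => Functor.toCatHom (C := FatHom k A B)
        { obj := fun f => f.f (single i)
          map := fun a => FatHom₂.ψ a (single i)
          map_id := fun _ => rfl
          map_comp := fun _ _ => rfl }
      naturality := fun _ _ _ => rfl }
  map_unit _ _ := rfl
  map_comp _ _ := rfl

/-- The projection `q` of the value at `{0, 1, ..., n}` of the `Γ`-category with paths onto the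
components of `{1}, ..., {n}`. -/
def proj (D : PermSCat.{u}) (X : FinPtd) :
    (fatGamma D).obj X ⟶ SCat.pi fun _ : Fin X.n => D.toSCat :=
  SCat.lift fun i => projComponent D X i

/-! ## Classifying spaces -/

/-- The category `E_k` with the same objects as `E` whose morphisms are the `k`-simplices of the
diagonals of the bisimplicial sets (the nerves of the simplicial categories) of morphisms of
`E`. -/
def Level (E : SCat.{u}) (_ : SimplexCategoryᵒᵖ) : Type u := E.Obj

instance (E : SCat.{u}) (k : SimplexCategoryᵒᵖ) : Category (Level E k) where
  Hom A B := (nerve ((E.Hom A B).obj k)).obj k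
  id A := (Functor.const _).obj (E.unit A k)
  comp F G := Functor.prod' F G ⋙ E.comp k
  id_comp F := functor_ext fun f => E.unit_comp (Arrow.mk (F.map f))
  comp_id F := functor_ext fun f => E.comp_unit (Arrow.mk (F.map f))
  assoc F G H := functor_ext fun f =>
    E.assoc (Arrow.mk (F.map f)) (Arrow.mk (G.map f)) (Arrow.mk (H.map f))

/-- The simplicial structure of the categories `E_k`. -/
def levelsMap (E : SCat.{u}) {k l : SimplexCategoryᵒᵖ} (θ : k ⟶ l) : Level E k ⥤ Level E l where
  obj A := A
  map {A B} F := (nerve ((E.Hom A B).obj l)).map θ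
    ((nerveMap ((E.Hom A B).map θ).toFunctor).app k F)
  map_id A := functor_ext fun f => (mapArrow_const ((E.Hom A A).map θ).toFunctor _).trans
    (congrArg const (E.map_unit A θ))
  map_comp F G := functor_ext fun f => E.map_comp θ
    (Arrow.mk (F.map ((SimplexCategory.toCat.map θ.unop).toFunctor.map f)))
    (Arrow.mk (G.map ((SimplexCategory.toCat.map θ.unop).toFunctor.map f)))

/-- The simplicial category formed by the `E_k`. -/
def levels (E : SCat.{u}) : SimplexCategoryᵒᵖ ⥤ Cat.{u, u} where
  obj k := Cat.of (Level E k)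
  map θ := (levelsMap E θ).toCatHom
  map_id k := Cat.ext (Functor.hext (fun _ => rfl) fun A B F => heq_of_eq
    (functor_ext fun f => res_id (E := E) (Arrow.mk (F.map f))))
  map_comp {k l m} θ θ' := Cat.ext (Functor.hext (fun _ => rfl) fun A B F => heq_of_eq
    (functor_ext fun f => res_comp (E := E) θ θ' (Arrow.mk (F.map 
      ((SimplexCategory.toCat.map θ.unop).toFunctor.map
        ((SimplexCategory.toCat.map θ'.unop).toFunctor.map f))))))

/-- The functor `E_k ⥤ F_k` induced by an enriched functor. -/
def levelFunctor {E F : SCat.{u}} (p : E ⟶ F) (k : SimplexCategoryᵒᵖ) : Level E k ⥤ Level F k where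
  obj A := EFunctor.obj p A
  map {A B} G := (nerveMap ((EFunctor.map p A B).app k).toFunctor).app k G
  map_id A := functor_ext fun f => (mapArrow_const ((EFunctor.map p A A).app k).toFunctor _).trans
    (congrArg const (EFunctor.map_unit p A k))
  map_comp G H := functor_ext fun f => EFunctor.map_comp p (Arrow.mk (G.map f)) (Arrow.mk (H.map f))

/-- The simplicial categories `k ↦ E_k`, as a functor of `E`. -/
def levelsFunctor : SCat.{u} ⥤ (SimplexCategoryᵒᵖ ⥤ Cat.{u, u}) where
  obj E := levels E
  map {E F} p :=
    { app := fun k => (levelFunctor p k).toCatHom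
      naturality := fun k l θ => Cat.ext (Functor.hext (fun _ => rfl) fun A B G => heq_of_eq
        (functor_ext fun f => congrArg (fun H => H.toFunctor.mapArrow.obj (Arrow.mk (G.map 
          ((SimplexCategory.toCat.map θ.unop).toFunctor.map f))))
          ((EFunctor.map p A B).naturality θ))) }

/-- The diagonal of a bisimplicial set. -/
def diagonal : (SimplexCategoryᵒᵖ ⥤ SSet.{u}) ⥤ SSet.{u} :=
  Functor.uncurry ⋙ (Functor.whiskeringLeft _ _ _).obj (Functor.diag _)

/-- The diagonal of the nerve of `E`: its `k`-simplices are the sequences of `k` composable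
morphisms of `E_k`. -/
def diagNerve : SCat.{u} ⥤ SSet.{u} :=
  levelsFunctor ⋙ (Functor.whiskeringRight _ _ _).obj nerveFunctor ⋙ diagonal

/-- The classifying space: the geometric realization of the (diagonal of the) nerve. -/
def classifyingSpace : SCat.{u} ⥤ TopCat.{u} := diagNerve ⋙ SSet.toTop

/-- An enriched functor is a weak equivalence if it induces a homotopy equivalence of classifying
spaces.  As classifying spaces are CW complexes, this is the same as a weak homotopy equivalence. -/
def IsWeakEquiv {E F : SCat.{u}} (p : E ⟶ F) : Prop :=
  ∃ e : ContinuousMap.HomotopyEquiv (classifyingSpace.obj E) (classifyingSpace.obj F),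
    e.toFun = (classifyingSpace.map p).hom

/-- The map `G({0, 1, ..., n}) ⟶ G({0, 1})^n` assembled from the pointed maps that send one element
to `1` and all the others to `0`. -/
def segalMap (G : FinPtd ⥤ SCat.{u}) (X : FinPtd) :
    G.obj X ⟶ SCat.pi fun _ : Fin X.n => G.obj (FinPtd.mk 1) :=
  SCat.lift fun i => G.map (X.segal i)

/-- A `Γ`-category is special if all these maps are weak equivalences. -/
def IsSpecial (G : FinPtd ⥤ SCat.{u}) : Prop := ∀ X : FinPtd, IsWeakEquiv (segalMap G X)

end SegalGamma

end

/-! Call a family `{f_S, φ_{S,T}}` strict if all its paths are constant. Everything rests on two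
facts about strict families in a fixed simplicial degree.

A strict family `t` is determined by its components at the one-element subsets, and these may be
prescribed arbitrarily (`IsStrict.ext`, `exists_isStrict`): since `b_{S,T}` is invertible, the
equation `(t_S ⊕ t_T) a = b t_{S ∪ T}` computes `t_{S ∪ T}` from `t_S` and `t_T`. Likewise a
morphism from a strict `t` to an arbitrary `f` is determined by its components at the one-element
subsets, and these may be prescribed arbitrarily (`IsStrict.hom_ext`, `IsStrict.exists_hom`).
Because the paths of `t` are constant, the compatibility condition becomes `b ψ_{S ∪ T} = ((ψ_S ⊕
ψ_T) a) ⊙ φ_{S,T}`, which defines `ψ_{S ∪ T}`. The cocycle condition, the symmetry and the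
normalization of `φ` say that this partially defined addition of paths ending at `f` is associative,
commutative and unital (`FatHom.sums`), so it extends consistently from one-element subsets to all
subsets (`Sums.exists_family`).

Hence in each category of morphisms the strict families form a coreflective subcategory which `q`
identifies with the category of morphisms of `D^n`. By uniqueness this is strictly compatible with
composition, units and simplicial operators. `GoodLifts` abstracts the situation. The counits, which
are morphisms inside the categories of morphisms, yield a simplicial homotopy on the diagonal nerve
that retracts onto the strict part (`GoodLifts.simplicialHomotopy`). Thus the source of `q` is
equivalent to the full image of `q`.

That image is all of `D^n`, because any family of objects `M_i` is realized by a sum of objects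
concentrated at one element (`GammaObj.exists_single`). The strict inclusion `i` followed by `q`
satisfies `GoodLifts` with every family good, so `i` is an equivalence by two-out-of-three. The
Segal map followed by the product of the projections in degree one is `q`, so two-out-of-three also
gives specialness.

The topological input is that simplicial homotopies realize to homotopies. It is proved with the
prism decomposition of `Δ^n × I` and the universal property of the realization alone. -/

noncomputable section

namespace SegalGamma

open SCat SumSCat PtSub GammaObj

/-! ## Simplicial homotopies and geometric realization -/

/-! ### Points of a simplex described by partial sums of their coordinates. -/

section CumulativeSums

/-- The sum of the barycentric coordinates of index less than `c`. -/
def cumSum {n : ℕ} (p : stdSimplex ℝ (Fin (n + 1))) (c : ℕ) : ℝ :=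
  ∑ i : Fin (n + 1), if i.val < c then p i else 0

theorem cumSum_zero {n : ℕ} (p : stdSimplex ℝ (Fin (n + 1))) : cumSum p 0 = 0 := by
  simp [cumSum]

theorem cumSum_of_le {n : ℕ} (p : stdSimplex ℝ (Fin (n + 1))) {c : ℕ} (h : n + 1 ≤ c) :
    cumSum p c = 1 := by
  rw [cumSum, ← p.2.2]
  exact Finset.sum_congr rfl fun i _ => if_pos (i.2.trans_le h)

theorem cumSum_succ {n : ℕ} (p : stdSimplex ℝ (Fin (n + 1))) (i : Fin (n + 1)) :
    cumSum p (i.val + 1) = cumSum p i.val + p i := by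
  have : p i = ∑ j : Fin (n + 1), if j = i then p j else 0 := by simp
  rw [cumSum, cumSum, this, ← Finset.sum_add_distrib]
  refine Finset.sum_congr rfl fun j _ => ?_
  rcases lt_trichotomy j i with h | h | h
  · rw [if_pos (Nat.lt_succ_of_lt h), if_pos (by exact h), if_neg h.ne, add_zero]
  · subst h; simp
  · rw [if_neg (by have : i.val < j.val := h; omega), if_neg (by have : i.val < j.val := h; omega),
      if_neg h.ne', add_zero]

theorem cumSum_mono {n : ℕ} (p : stdSimplex ℝ (Fin (n + 1))) : Monotone (cumSum p) := by
  intro c d h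
  refine Finset.sum_le_sum fun i _ => ?_
  split_ifs with h₁ h₂ h₂
  · exact le_rfl
  · omega
  · exact p.2.1 i
  · exact le_rfl

/-- The coordinates are the differences of consecutive partial sums. Points can therefore be
compared, and constructed, through nondecreasing sequences from `0` to `1`. -/
theorem cumSum_ext {n : ℕ} {p q : stdSimplex ℝ (Fin (n + 1))}
    (h : ∀ c ≤ n + 1, cumSum p c = cumSum q c) : p = q := by
  refine Subtype.ext (funext fun i => ?_)
  have h₁ := h _ (Nat.succ_le_of_lt i.2)
  rw [cumSum_succ, cumSum_succ, h _ i.2.le] at h₁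
  exact add_left_cancel h₁

theorem continuous_cumSum {n : ℕ} (c : ℕ) :
    Continuous fun p : stdSimplex ℝ (Fin (n + 1)) => cumSum p c := by
  refine continuous_finsetSum _ fun i _ => ?_
  by_cases h : i.val < c
  · simp only [if_pos h]
    exact (continuous_apply i).comp continuous_subtype_val
  · simp only [if_neg h]
    exact continuous_const

/-- The pushforward along `θ` gives an initial segment the mass of its preimage. When that preimage
is again an initial segment, simplicial operators merely reindex partial sums, and no sums over
fibres remain in later computations. -/
theorem cumSum_map {n m : ℕ} (θ : Fin (n + 1) → Fin (m + 1)) (p : stdSimplex ℝ (Fin (n + 1)))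
    {c d : ℕ} (h : ∀ i, (θ i).val < c ↔ i.val < d) : cumSum (stdSimplex.map θ p) c = cumSum p d := by
  have e : ∀ l : Fin (m + 1), (stdSimplex.map θ p) l =
      ∑ i : Fin (n + 1), if θ i = l then p i else 0 := by
    intro l
    rw [stdSimplex.map_coe, FunOnFinite.linearMap_apply_apply, Finset.sum_filter]
  simp only [cumSum, e]
  calc _ = ∑ l : Fin (m + 1), ∑ i : Fin (n + 1), if θ i = l then (if l.val < c then p i else 0)
        else 0 := Finset.sum_congr rfl fun l _ => by split_ifs <;> simp
    _ = ∑ i : Fin (n + 1), if (θ i).val < c then p i else 0 := by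
        rw [Finset.sum_comm]; simp
    _ = _ := by simp only [h]

/-- The point of the simplex with given partial sums. -/
def ofCumSum {n : ℕ} (R : ℕ → ℝ) (hR : Monotone R) (h₀ : R 0 = 0) (h₁ : R (n + 1) = 1) :
    stdSimplex ℝ (Fin (n + 1)) :=
  ⟨fun i => R (i.val + 1) - R i.val, fun i => sub_nonneg.2 (hR (Nat.le_succ _)), by
    rw [Fin.sum_univ_eq_sum_range (fun i => R (i + 1) - R i), Finset.sum_range_sub, h₀, h₁,
      sub_zero]⟩

theorem cumSum_ofCumSum {n : ℕ} (R : ℕ → ℝ) (hR : Monotone R) (h₀ : R 0 = 0)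
    (h₁ : R (n + 1) = 1) {c : ℕ} (hc : c ≤ n + 1) : cumSum (ofCumSum R hR h₀ h₁) c = R c := by
  induction c with
  | zero => rw [cumSum_zero, h₀]
  | succ c ih =>
    refine (cumSum_succ _ ⟨c, hc⟩).trans ?_
    rw [ih (by omega)]
    exact add_sub_cancel _ _

/-- Supplies the hypothesis of `cumSum_map` for monotone `θ`; `d` is the first index whose image is
at least `c`, or `n + 1` if there is none. -/
theorem exists_forall_lt_iff {n m : ℕ} (θ : Fin (n + 1) →o Fin (m + 1)) (c : ℕ) :
    ∃ d ≤ n + 1, ∀ i, (θ i).val < c ↔ i.val < d := by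
  by_cases h : ∀ i, (θ i).val < c
  · exact ⟨n + 1, le_rfl, fun i => ⟨fun _ => i.2, fun _ => h i⟩⟩
  · push Not at h
    classical
    let P : ℕ → Prop := fun j => ∃ hj : j < n + 1, c ≤ (θ ⟨j, hj⟩).val
    have hP : ∃ j, P j := by
      obtain ⟨i, hi⟩ := h
      exact ⟨i, i.2, hi⟩
    obtain ⟨hd, hd'⟩ := Nat.find_spec hP
    refine ⟨Nat.find hP, hd.le, fun i => ⟨fun hi => ?_, fun hi => ?_⟩⟩
    · by_contra hlt
      have : (θ ⟨Nat.find hP, hd⟩).val ≤ (θ i).val := θ.monotone (by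
        change Nat.find hP ≤ i.val; omega)
      omega
    · by_contra hlt
      exact Nat.find_min hP hi ⟨i.2, not_lt.1 hlt⟩

end CumulativeSums

/-! ### The decomposition of the prism `Δ^n × I` into `n + 1` simplices. -/

section Prism

variable {n : ℕ}

/-- The partial sums of the barycentric coordinates in the `j`-th simplex of a prism. -/
def prismSum (p : stdSimplex ℝ (Fin (n + 1))) (t : ℝ) (j c : ℕ) : ℝ :=
  if c ≤ j then cumSum p c else if c = j + 1 then t else cumSum p (c - 1)

/-- The sequence is that of `p` with `t` inserted at place `j + 1`. The two inequalities are the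
condition for `(p, t)` to lie in the `j`-th simplex, and they are what keeps the sequence monotone.
-/
theorem prismSum_mono (p : stdSimplex ℝ (Fin (n + 1))) {t : ℝ} {j : ℕ} (h : cumSum p j ≤ t)
    (h' : t ≤ cumSum p (j + 1)) : Monotone (prismSum p t j) := by
  refine monotone_nat_of_le_succ fun c => ?_
  unfold prismSum
  split_ifs with h₁ h₂ h₃ h₄ h₅ h₆ <;> first | omega | skip
  · exact cumSum_mono p (Nat.le_succ _)
  · obtain rfl : c = j := by omega
    exact h
  · subst h₄; exact h'
  · exact cumSum_mono p (by omega)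

/-- The point with parameters `(p, t)` in the `j`-th simplex of a prism. -/
def prismPoint (p : stdSimplex ℝ (Fin (n + 1))) (t : ℝ) (j : Fin (n + 1))
    (h : cumSum p j.val ≤ t ∧ t ≤ cumSum p (j.val + 1)) : stdSimplex ℝ (Fin (n + 1 + 1)) :=
  ofCumSum (prismSum p t j) (prismSum_mono p h.1 h.2)
    ((if_pos (Nat.zero_le _)).trans (cumSum_zero p)) (by
      unfold prismSum
      have := j.2
      split_ifs with h₁ h₂
      · omega
      · omega
      · exact cumSum_of_le p (by omega))

theorem cumSum_prismPoint (p : stdSimplex ℝ (Fin (n + 1))) (t : ℝ) (j : Fin (n + 1)) (h) {c : ℕ}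
    (hc : c ≤ n + 1 + 1) : cumSum (prismPoint p t j h) c = prismSum p t j c :=
  cumSum_ofCumSum _ _ _ _ hc

/-- Take the least `j` with `t ≤ cumSum p (j + 1)`; minimality gives the lower bound, or `j = 0` and
the bound is `0 ≤ t`. -/
theorem exists_mem_prism (p : stdSimplex ℝ (Fin (n + 1))) {t : ℝ} (h₀ : 0 ≤ t) (h₁ : t ≤ 1) :
    ∃ j : Fin (n + 1), cumSum p j.val ≤ t ∧ t ≤ cumSum p (j.val + 1) := by
  classical
  have hP : ∃ c, t ≤ cumSum p (c + 1) := ⟨n, by rwa [cumSum_of_le p le_rfl]⟩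
  have hn : Nat.find hP ≤ n := Nat.find_min' hP (by rwa [cumSum_of_le p le_rfl])
  refine ⟨⟨Nat.find hP, by omega⟩, ?_, Nat.find_spec hP⟩
  change cumSum p (Nat.find hP) ≤ t
  rcases h : Nat.find hP with _ | c
  · exact (cumSum_zero p).trans_le h₀
  · exact (not_le.1 (Nat.find_min hP (m := c) (by omega))).le

/-- The map of prisms induced by a monotone map, on the `j`-th simplex. -/
def prismMap {m : ℕ} (θ : Fin (n + 1) →o Fin (m + 1)) (j : Fin (n + 1)) :
    Fin (n + 1 + 1) →o Fin (m + 1 + 1) where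
  toFun i := if h : i.val ≤ j.val then (θ ⟨i.val, h.trans_lt j.2⟩).castSucc
    else (θ ⟨i.val - 1, by omega⟩).succ
  monotone' i i' hi := by
    have hi' : i.val ≤ i'.val := hi
    change Fin.val _ ≤ Fin.val _
    dsimp only
    split_ifs with h₁ h₂ h₂
    · exact θ.monotone (show _ ≤ _ from hi)
    · have : (θ ⟨i.val, h₁.trans_lt j.2⟩).val ≤ (θ ⟨i'.val - 1, by omega⟩).val :=
        θ.monotone (show i.val ≤ i'.val - 1 by omega)
      simpa using this.trans (Nat.le_succ _)
    · omega
    · have : (θ ⟨i.val - 1, by omega⟩).val ≤ (θ ⟨i'.val - 1, by omega⟩).val :=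
        θ.monotone (show i.val - 1 ≤ i'.val - 1 by omega)
      simpa using this

theorem mem_prism_map {m : ℕ} (θ : Fin (n + 1) →o Fin (m + 1)) (p : stdSimplex ℝ (Fin (n + 1)))
    {t : ℝ} (j : Fin (n + 1)) (h : cumSum p j.val ≤ t ∧ t ≤ cumSum p (j.val + 1)) :
    cumSum (stdSimplex.map θ p) (θ j).val ≤ t ∧ t ≤ cumSum (stdSimplex.map θ p) ((θ j).val + 1) := by
  constructor
  · obtain ⟨d, hd, hd'⟩ := exists_forall_lt_iff θ (θ j).val
    rw [cumSum_map θ p hd']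
    refine (cumSum_mono p ?_).trans h.1
    have := (hd' j).not.1 (lt_irrefl _)
    omega
  · obtain ⟨d, hd, hd'⟩ := exists_forall_lt_iff θ ((θ j).val + 1)
    rw [cumSum_map θ p hd']
    refine h.2.trans (cumSum_mono p ?_)
    exact (hd' j).1 (Nat.lt_succ_self _)

/-- Compatibility of the decomposition with simplicial operators. Both points are compared through
their partial sums, according to the position of `c` relative to the place `θ j + 1` at which `t` is
inserted. -/
theorem map_prismPoint {m : ℕ} (θ : Fin (n + 1) →o Fin (m + 1)) (p : stdSimplex ℝ (Fin (n + 1)))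
    {t : ℝ} (j : Fin (n + 1)) (h : cumSum p j.val ≤ t ∧ t ≤ cumSum p (j.val + 1)) :
    stdSimplex.map (prismMap θ j) (prismPoint p t j h) =
      prismPoint (stdSimplex.map θ p) t (θ j) (mem_prism_map θ p j h) := by
  have hval : ∀ i : Fin (n + 1 + 1), (prismMap θ j i).val =
      if h : i.val ≤ j.val then (θ ⟨i.val, h.trans_lt j.2⟩).val
      else (θ ⟨i.val - 1, by omega⟩).val + 1 := by
    intro i
    change Fin.val (if h : i.val ≤ j.val then _ else _) = _
    split_ifs <;> simp
  refine cumSum_ext fun c hc => ?_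
  rw [cumSum_prismPoint _ _ _ _ hc]
  have hj := j.2
  have mono : ∀ {i i' : Fin (n + 1)}, i.val ≤ i'.val → (θ i).val ≤ (θ i').val :=
    fun h => θ.monotone h
  unfold prismSum
  split_ifs with h₁ h₂
  -- Below the inserted entry `prismMap θ j` pulls `c` back to the same initial segment as `θ`.
  · obtain ⟨d, hd, hd'⟩ := exists_forall_lt_iff θ c
    have hdj : d ≤ j.val := by
      have := (hd' j).not.1 (by omega)
      omega
    rw [cumSum_map θ p hd', cumSum_map (prismMap θ j) _ (d := d), cumSum_prismPoint _ _ _ _ (by omega),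
      prismSum, if_pos hdj]
    intro i
    rw [hval]
    split_ifs with hi
    · exact hd' _
    · refine ⟨fun hlt => ?_, fun hlt => by omega⟩
      have := mono (i := j) (i' := ⟨i.val - 1, by omega⟩) (by
        change j.val ≤ i.val - 1; omega)
      omega
  -- At the inserted entry the preimage is `{0, ..., j}`, whose partial sum is `t`.
  · rw [cumSum_map (prismMap θ j) _ (d := j.val + 1), cumSum_prismPoint _ _ _ _ (by omega),
      prismSum, if_neg (by omega), if_pos rfl]
    intro i
    rw [hval]
    split_ifs with hi
    · have := mono (i := ⟨i.val, hi.trans_lt j.2⟩) (i' := j) hi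
      omega
    · have := mono (i := j) (i' := ⟨i.val - 1, by omega⟩) (by
        change j.val ≤ i.val - 1; omega)
      omega
  -- Above the inserted entry both initial segments are shifted by one.
  · obtain ⟨d, hd, hd'⟩ := exists_forall_lt_iff θ (c - 1)
    have hdj : j.val + 1 ≤ d := (hd' j).1 (by omega)
    rw [cumSum_map θ p hd', cumSum_map (prismMap θ j) _ (d := d + 1),
      cumSum_prismPoint _ _ _ _ (by omega), prismSum, if_neg (by omega), if_neg (by omega),
      Nat.add_sub_cancel]
    intro i
    rw [hval]
    split_ifs with hi
    · have := mono (i := ⟨i.val, hi.trans_lt j.2⟩) (i' := j) hi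
      omega
    · have := hd' ⟨i.val - 1, by omega⟩
      change _ ↔ i.val - 1 < d at this
      omega

/-- On the common face of two successive simplices of a prism. -/
theorem prismPoint_eq_map_succAbove (p : stdSimplex ℝ (Fin (n + 1))) {t : ℝ} (j : Fin (n + 1))
    (h : cumSum p j.val ≤ t ∧ t ≤ cumSum p (j.val + 1)) (ht : t = cumSum p (j.val + 1)) :
    prismPoint p t j h = stdSimplex.map j.succ.succAbove p := by
  refine cumSum_ext fun c hc => ?_
  rw [cumSum_prismPoint _ _ _ _ hc, cumSum_map _ p (d := if c ≤ j.val + 1 then c else c - 1), ht]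
  · unfold prismSum
    split_ifs with h₁ h₂ h₃ h₄ h₅ <;> first | omega | rfl | skip
    · rw [h₃]
  · intro i
    have hv : (j.succ.succAbove i).val = if i.val < j.val + 1 then i.val else i.val + 1 := by
      rw [Fin.succAbove]
      simp only [Fin.lt_def, Fin.val_castSucc, Fin.val_succ]
      split_ifs <;> simp
    rw [hv]
    split_ifs <;> omega

theorem prismPoint_eq_map_castSucc_succAbove (p : stdSimplex ℝ (Fin (n + 1))) {t : ℝ}
    (j : Fin (n + 1)) (h : cumSum p j.val ≤ t ∧ t ≤ cumSum p (j.val + 1)) (ht : t = cumSum p j.val) :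
    prismPoint p t j h = stdSimplex.map j.castSucc.succAbove p := by
  refine cumSum_ext fun c hc => ?_
  rw [cumSum_prismPoint _ _ _ _ hc, cumSum_map _ p (d := if c ≤ j.val then c else c - 1), ht]
  · unfold prismSum
    split_ifs with h₁ h₂ <;> first | omega | rfl | skip
    · rw [h₂]; rfl
  · intro i
    have hv : (j.castSucc.succAbove i).val = if i.val < j.val then i.val else i.val + 1 := by
      rw [Fin.succAbove]
      simp only [Fin.lt_def, Fin.val_castSucc]
      split_ifs <;> simp
    rw [hv]
    split_ifs <;> omega

theorem continuous_prismPoint (j : Fin (n + 1)) :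
    Continuous fun x : {x : stdSimplex ℝ (Fin (n + 1)) × unitInterval //
      cumSum x.1 j.val ≤ x.2.1 ∧ x.2.1 ≤ cumSum x.1 (j.val + 1)} =>
        prismPoint x.1.1 x.1.2.1 j x.2 := by
  have key : ∀ c : ℕ, Continuous fun x : {x : stdSimplex ℝ (Fin (n + 1)) × unitInterval //
      cumSum x.1 j.val ≤ x.2.1 ∧ x.2.1 ≤ cumSum x.1 (j.val + 1)} =>
        prismSum x.1.1 x.1.2.1 j c := by
    intro c
    have h₁ : ∀ c, Continuous fun x : {x : stdSimplex ℝ (Fin (n + 1)) × unitInterval //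
      cumSum x.1 j.val ≤ x.2.1 ∧ x.2.1 ≤ cumSum x.1 (j.val + 1)} => cumSum x.1.1 c := fun c =>
      (continuous_cumSum c).comp (continuous_fst.comp continuous_subtype_val)
    unfold prismSum
    split_ifs
    · exact h₁ c
    · exact continuous_subtype_val.comp (continuous_snd.comp continuous_subtype_val)
    · exact h₁ _
  exact Continuous.subtype_mk (continuous_pi fun i => (key _).sub (key _)) _

end Prism

/-! ### Points of the realization and maps out of it, through the adjunction with the singular
complex. -/

section Realization

/-- The point of the realization of `X` with barycentric coordinates `p` in the simplex `x`. -/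
def point {X : SSet.{u}} {k : SimplexCategory} (x : X.obj (op k))
    (p : stdSimplex ℝ (Fin (k.len + 1))) : SSet.toTop.obj X :=
  TopCat.toSSetObjEquiv _ (op k) ((sSetTopAdj.unit.app X).app (op k) x) p

theorem continuous_point {X : SSet.{u}} {k : SimplexCategory} (x : X.obj (op k)) :
    Continuous (point x) :=
  (TopCat.toSSetObjEquiv _ (op k) ((sSetTopAdj.unit.app X).app (op k) x)).continuous

/-- Naturality of the unit of the adjunction in the simplicial degree; this is the gluing relation
of the realization. -/
theorem point_map {X : SSet.{u}} {k l : SimplexCategory} (θ : l ⟶ k) (x : X.obj (op k))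
    (p : stdSimplex ℝ (Fin (l.len + 1))) :
    point (X.map θ.op x) p = point x (stdSimplex.map θ.toOrderHom p) := by
  have h := ConcreteCategory.congr_hom ((sSetTopAdj.unit.app X).naturality θ.op) x
  exact congrArg (fun z => TopCat.toSSetObjEquiv _ (op l) z p) h

theorem toTop_map_point {X Y : SSet.{u}} (f : X ⟶ Y) {k : SimplexCategory} (x : X.obj (op k))
    (p : stdSimplex ℝ (Fin (k.len + 1))) :
    (SSet.toTop.map f).hom (point x p) = point (f.app _ x) p := by
  have h := ConcreteCategory.congr_hom (congrArg (fun z => NatTrans.app z (op k))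
    (sSetTopAdj.unit.naturality f)) x
  exact congrArg (fun z => TopCat.toSSetObjEquiv _ (op k) z p) h.symm

/-- A map out of the realization is the same as its adjoint into the singular complex, whose values
are exactly the composites with `point x`. -/
theorem toTop_hom_ext {X : SSet.{u}} {Z : TopCat.{u}} {f g : SSet.toTop.obj X ⟶ Z}
    (h : ∀ (k : SimplexCategory) (x : X.obj (op k)) (p), f.hom (point x p) = g.hom (point x p)) :
    f = g := by
  refine (sSetTopAdj.homEquiv X Z).injective ?_
  rw [Adjunction.homEquiv_unit, Adjunction.homEquiv_unit]
  ext k x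
  refine (TopCat.toSSetObjEquiv Z k).injective (ContinuousMap.ext fun p => ?_)
  exact h k.unop x p

/-- A map out of the realization is determined by compatible maps out of the simplices. -/
theorem exists_toTop_hom {X : SSet.{u}} {Z : TopCat.{u}}
    (c : ∀ (k : SimplexCategory) (x : X.obj (op k)), C(stdSimplex ℝ (Fin (k.len + 1)), Z))
    (hc : ∀ {k l : SimplexCategory} (θ : l ⟶ k) (x : X.obj (op k)) (p),
      c l (X.map θ.op x) p = c k x (stdSimplex.map θ.toOrderHom p)) :
    ∃ f : SSet.toTop.obj X ⟶ Z, ∀ (k : SimplexCategory) (x : X.obj (op k)) (p),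
      f.hom (point x p) = c k x p := by
  let g : X ⟶ TopCat.toSSet.obj Z :=
    { app := fun k => TypeCat.ofHom fun x => (TopCat.toSSetObjEquiv Z k).symm (c k.unop x)
      naturality := fun k l θ => by
        ext x
        refine (TopCat.toSSetObjEquiv Z l).injective (ContinuousMap.ext fun p => ?_)
        exact hc θ.unop x p }
  refine ⟨(sSetTopAdj.homEquiv X Z).symm g, fun k x p => ?_⟩
  have h : sSetTopAdj.unit.app X ≫ TopCat.toSSet.map ((sSetTopAdj.homEquiv X Z).symm g) = g :=
    (Adjunction.homEquiv_unit _ _ _ _).symm.trans (Equiv.apply_symm_apply _ _)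
  have h' := ConcreteCategory.congr_hom (congrArg (fun z => NatTrans.app z (op k)) h) x
  exact congrArg (fun z => TopCat.toSSetObjEquiv Z (op k) z p) h'

end Realization

/-! ### Realization of simplicial homotopies. -/

section

open Simplicial

/-- A simplicial homotopy between maps of simplicial sets, i.e. a map out of the product with
`Δ[1]`. -/
structure SimplicialHomotopy {X Y : SSet.{u}} (f g : X ⟶ Y) where
  h : ∀ {k : SimplexCategory}, (k ⟶ ⦋1⦌) → X.obj (op k) → Y.obj (op k)
  map_h : ∀ {k l : SimplexCategory} (θ : l ⟶ k) (χ : k ⟶ ⦋1⦌) (x : X.obj (op k)),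
    Y.map θ.op (h χ x) = h (θ ≫ χ) (X.map θ.op x)
  h_zero : ∀ {k : SimplexCategory} (x : X.obj (op k)),
    h (SimplexCategory.const k ⦋1⦌ 0) x = f.app (op k) x
  h_one : ∀ {k : SimplexCategory} (x : X.obj (op k)),
    h (SimplexCategory.const k ⦋1⦌ 1) x = g.app (op k) x

namespace SimplicialHomotopy

variable {X Y : SSet.{u}} {f g : X ⟶ Y} (H : SimplicialHomotopy f g)

/-- The map `[n + 1] → [1]` that sends `i` to `0` if and only if `i ≤ j`. -/
def cut {n : ℕ} (j : Fin (n + 1)) : (⦋n + 1⦌ : SimplexCategory) ⟶ ⦋1⦌ :=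
  SimplexCategory.Hom.mk
    { toFun := fun i => if i.val ≤ j.val then 0 else 1
      monotone' := fun i i' hi => by
        have : i.val ≤ i'.val := hi
        dsimp only
        split_ifs <;> first | omega | simp }

/-- The values of the homotopy on the `j`-th simplex of a prism. -/
def side {n : ℕ} (x : X.obj (op ⦋n⦌)) (j : Fin (n + 1)) : Y.obj (op ⦋n + 1⦌) :=
  H.h (cut j) (X.map (SimplexCategory.σ j).op x)

/-- Two identities in the simplex category: `prismMap θ j` followed by the cut at `θ j` is the cut
at `j`, and it intertwines the degeneracies `σ j` and `σ (θ j)` over `θ`. -/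
theorem map_side {n m : ℕ} (θ : (⦋n⦌ : SimplexCategory) ⟶ ⦋m⦌) (x : X.obj (op ⦋m⦌))
    (j : Fin (n + 1)) :
    H.side (X.map θ.op x) j = Y.map (Quiver.Hom.op (X := (⦋n + 1⦌ : SimplexCategory))
      (Y := ⦋m + 1⦌) (SimplexCategory.Hom.mk (prismMap θ.toOrderHom j))) (H.side x (θ.toOrderHom j)) := by
  rw [side, side, H.map_h, ← ConcreteCategory.comp_apply, ← ConcreteCategory.comp_apply,
    ← X.map_comp, ← X.map_comp, ← op_comp, ← op_comp]
  have mono : ∀ {i i' : Fin (n + 1)}, i.val ≤ i'.val →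
      (θ.toOrderHom i).val ≤ (θ.toOrderHom i').val := fun h => θ.toOrderHom.monotone h
  have hval : ∀ i : Fin (n + 1 + 1), (prismMap θ.toOrderHom j i) =
      if h : i.val ≤ j.val then (θ.toOrderHom ⟨i.val, h.trans_lt j.2⟩).castSucc
      else (θ.toOrderHom ⟨i.val - 1, show i.val - 1 < n + 1 by omega⟩).succ := fun i => rfl
  refine congrArg₂ H.h ?_ (congrArg (fun z : (⦋n + 1⦌ : SimplexCategory) ⟶ ⦋m⦌ => X.map z.op x) ?_)
  · ext i : 3
    have hi : i.val < n + 1 + 1 := i.2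
    change (if i.val ≤ j.val then (0 : Fin 2) else 1) =
      if (prismMap θ.toOrderHom j i).val ≤ (θ.toOrderHom j).val then 0 else 1
    rw [hval]
    split_ifs with h₁ h₂ h₂ <;> first | rfl | skip
    · exact absurd (mono (i := ⟨i.val, h₁.trans_lt j.2⟩) h₁) h₂
    · have := mono (i := j) (i' := ⟨i.val - 1, show i.val - 1 < n + 1 by omega⟩)
        (by change j.val ≤ i.val - 1; omega)
      simp only [Fin.val_succ] at h₂
      omega
  · ext i : 3
    have hi : i.val < n + 1 + 1 := i.2
    change θ.toOrderHom (Fin.predAbove j i) =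
      Fin.predAbove (θ.toOrderHom j) (prismMap θ.toOrderHom j i)
    rw [hval]
    split_ifs with h₁
    · rw [Fin.predAbove_of_le_castSucc _ _ (show i.val ≤ j.val from h₁),
        Fin.predAbove_castSucc_of_le _ _ (mono (i := ⟨i.val, h₁.trans_lt j.2⟩) h₁)]
      rfl
    · have := mono (i := j) (i' := ⟨i.val - 1, show i.val - 1 < n + 1 by omega⟩)
        (by change j.val ≤ i.val - 1; omega)
      rw [Fin.predAbove_of_castSucc_lt _ _ (show j.val < i.val by omega),
        Fin.predAbove_succ_of_le _ _ this]
      rfl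

/-- The faces numbered `j` and `j + 1` are both sections of `σ j`, so the degeneracy of `x` cancels
and only the restricted cut is left. These are the faces shared by neighbouring simplices of the
prism, or its two ends. -/
theorem succ_succAbove_side {n : ℕ} (x : X.obj (op ⦋n⦌)) (j : Fin (n + 1)) :
    Y.map (SimplexCategory.δ j.succ).op (H.side x j) =
      H.h (SimplexCategory.δ j.succ ≫ cut j) x := by
  rw [side, H.map_h, ← ConcreteCategory.comp_apply, ← X.map_comp, ← op_comp,
    SimplexCategory.δ_comp_σ_succ]
  simp

theorem castSucc_succAbove_side {n : ℕ} (x : X.obj (op ⦋n⦌)) (j : Fin (n + 1)) :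
    Y.map (SimplexCategory.δ j.castSucc).op (H.side x j) =
      H.h (SimplexCategory.δ j.castSucc ≫ cut j) x := by
  rw [side, H.map_h, ← ConcreteCategory.comp_apply, ← X.map_comp, ← op_comp,
    SimplexCategory.δ_comp_σ_self]
  simp

/-- The homotopy of realizations on the `j`-th simplex of a prism. -/
def prismValue {n : ℕ} (x : X.obj (op ⦋n⦌)) (p : stdSimplex ℝ (Fin (n + 1))) (t : ℝ)
    (j : Fin (n + 1)) (h : cumSum p j.val ≤ t ∧ t ≤ cumSum p (j.val + 1)) : SSet.toTop.obj Y :=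
  point (k := ⦋n + 1⦌) (H.side x j) (prismPoint p t j h)

theorem prismValue_of_eq_succ {n : ℕ} (x : X.obj (op ⦋n⦌)) (p : stdSimplex ℝ (Fin (n + 1)))
    (t : ℝ) (j : Fin (n + 1)) (h) (ht : t = cumSum p (j.val + 1)) :
    H.prismValue x p t j h = point (k := ⦋n⦌) (H.h (SimplexCategory.δ j.succ ≫ cut j) x) p := by
  rw [← succ_succAbove_side, point_map, prismValue, prismPoint_eq_map_succAbove p j h ht]
  rfl

theorem prismValue_of_eq {n : ℕ} (x : X.obj (op ⦋n⦌)) (p : stdSimplex ℝ (Fin (n + 1)))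
    (t : ℝ) (j : Fin (n + 1)) (h) (ht : t = cumSum p j.val) :
    H.prismValue x p t j h = point (k := ⦋n⦌) (H.h (SimplexCategory.δ j.castSucc ≫ cut j) x) p := by
  rw [← castSucc_succAbove_side, point_map, prismValue, prismPoint_eq_map_castSucc_succAbove p j h ht]
  rfl

/-- A point of two neighbouring simplices has `t = cumSum p (j + 1)`, hence lies on their common
face. There the cuts at `j` and at `j + 1` agree, since they differ only at the omitted vertex `j +
1`. -/
theorem prismValue_succ {n : ℕ} (x : X.obj (op ⦋n⦌)) (p : stdSimplex ℝ (Fin (n + 1)))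
    (t : ℝ) (j j' : Fin (n + 1)) (h) (h') (hj : j'.val = j.val + 1) :
    H.prismValue x p t j h = H.prismValue x p t j' h' := by
  have h'' := h'
  rw [hj] at h''
  have ht : t = cumSum p (j.val + 1) := le_antisymm h.2 h''.1
  rw [prismValue_of_eq_succ H x p t j h ht, prismValue_of_eq H x p t j' h' (by rw [hj]; exact ht)]
  congr 2
  ext i : 3
  change (if (j.succ.succAbove i).val ≤ j.val then (0 : Fin 2) else 1) =
    if (j'.castSucc.succAbove i).val ≤ j'.val then 0 else 1
  have e : j'.castSucc = j.succ := Fin.ext hj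
  rw [e]
  simp only [Fin.succAbove, Fin.lt_def, Fin.val_castSucc, Fin.val_succ, hj]
  split_ifs with h₁ h₂ h₃ h₂ h₃ <;> simp at * <;> omega

/-- If `(p, t)` lies in simplices `j ≤ j'`, monotonicity of the partial sums puts it in every
simplex between them. Neighbours can then be compared one at a time. -/
theorem prismValue_unique {n : ℕ} (x : X.obj (op ⦋n⦌)) (p : stdSimplex ℝ (Fin (n + 1)))
    (t : ℝ) (j j' : Fin (n + 1)) (h) (h') :
    H.prismValue x p t j h = H.prismValue x p t j' h' := by
  wlog hj : j.val ≤ j'.val generalizing j j'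
  · exact (this j' j h' h (by omega)).symm
  obtain ⟨d, hd⟩ := Nat.exists_eq_add_of_le hj
  induction d generalizing j' with
  | zero => obtain rfl : j' = j := Fin.ext hd; rfl
  | succ d ih =>
    have hlt : j.val + d < n + 1 := by omega
    have hm : cumSum p (j.val + d) ≤ t ∧ t ≤ cumSum p (j.val + d + 1) :=
      ⟨(cumSum_mono p (by omega)).trans h'.1, h.2.trans (cumSum_mono p (by omega))⟩
    exact (ih ⟨j.val + d, hlt⟩ hm (Nat.le_add_right _ _) rfl).trans
      (H.prismValue_succ x p t _ _ _ _ hd)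

/-- The homotopy of realizations on a simplex. -/
def value {n : ℕ} (x : X.obj (op ⦋n⦌)) (z : stdSimplex ℝ (Fin (n + 1)) × unitInterval) :
    SSet.toTop.obj Y :=
  H.prismValue x z.1 z.2.1 (exists_mem_prism z.1 z.2.2.1 z.2.2.2).choose
    (exists_mem_prism z.1 z.2.2.1 z.2.2.2).choose_spec

theorem value_eq {n : ℕ} (x : X.obj (op ⦋n⦌)) (p : stdSimplex ℝ (Fin (n + 1))) (t : unitInterval)
    (j : Fin (n + 1)) (h : cumSum p j.val ≤ t.1 ∧ t.1 ≤ cumSum p (j.val + 1)) :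
    H.value x (p, t) = H.prismValue x p t j h :=
  H.prismValue_unique _ _ _ _ _ _ _

/-- The simplices form a finite closed cover of the prism, and on each of them the value is the
continuous map `point` after `prismPoint`. -/
theorem continuous_value {n : ℕ} (x : X.obj (op ⦋n⦌)) : Continuous (H.value x) := by
  let C : Fin (n + 1) → Set (stdSimplex ℝ (Fin (n + 1)) × unitInterval) := fun j =>
    {z | cumSum z.1 j.val ≤ z.2.1 ∧ z.2.1 ≤ cumSum z.1 (j.val + 1)}
  refine (locallyFinite_of_finite C).continuous ?_ ?_ ?_
  · exact Set.iUnion_eq_univ_iff.2 fun z => exists_mem_prism z.1 z.2.2.1 z.2.2.2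
  · intro j
    have h₁ : ∀ c, Continuous fun z : stdSimplex ℝ (Fin (n + 1)) × unitInterval =>
        cumSum z.1 c := fun c => (continuous_cumSum c).comp continuous_fst
    have h₂ : Continuous fun z : stdSimplex ℝ (Fin (n + 1)) × unitInterval => z.2.1 :=
      continuous_subtype_val.comp continuous_snd
    exact (isClosed_le (h₁ _) h₂).inter (isClosed_le h₂ (h₁ _))
  · intro j
    rw [continuousOn_iff_continuous_domRestrict]
    refine ((continuous_point (k := ⦋n + 1⦌) (H.side x j)).comp (continuous_prismPoint j)).congr ?_
    intro z
    exact (H.value_eq x z.1.1 z.1.2 j z.2).symm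

theorem value_map {n m : ℕ} (θ : (⦋n⦌ : SimplexCategory) ⟶ ⦋m⦌) (x : X.obj (op ⦋m⦌))
    (p : stdSimplex ℝ (Fin (n + 1))) (t : unitInterval) :
    H.value (X.map θ.op x) (p, t) = H.value x (stdSimplex.map θ.toOrderHom p, t) := by
  obtain ⟨j, hj⟩ := exists_mem_prism p t.2.1 t.2.2
  rw [H.value_eq _ p t j hj, H.value_eq _ _ t _ (mem_prism_map θ.toOrderHom p j hj), prismValue,
    prismValue, ← map_prismPoint, map_side, point_map]
  rfl

/-- The parameter runs against the simplicial direction: at `t = 0` the point lies on face `0` of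
the first simplex, where the cut at `0` is constantly `1`, so the value comes from `g`. At `t = 1`
it comes from `f`. -/
theorem value_zero {n : ℕ} (x : X.obj (op ⦋n⦌)) (p : stdSimplex ℝ (Fin (n + 1))) :
    H.value x (p, 0) = point (k := ⦋n⦌) (g.app _ x) p := by
  have h : cumSum p (0 : Fin (n + 1)).val ≤ (0 : unitInterval).1 ∧
      (0 : unitInterval).1 ≤ cumSum p ((0 : Fin (n + 1)).val + 1) :=
    ⟨(cumSum_zero p).le, (cumSum_zero p).ge.trans (cumSum_mono p (Nat.zero_le _))⟩
  rw [H.value_eq x p 0 0 h, H.prismValue_of_eq x p _ 0 h (cumSum_zero p).symm, ← H.h_one]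
  congr 2

theorem value_one {n : ℕ} (x : X.obj (op ⦋n⦌)) (p : stdSimplex ℝ (Fin (n + 1))) :
    H.value x (p, 1) = point (k := ⦋n⦌) (f.app _ x) p := by
  have e : cumSum p ((Fin.last n).val + 1) = 1 := cumSum_of_le p le_rfl
  have h : cumSum p (Fin.last n).val ≤ (1 : unitInterval).1 ∧
      (1 : unitInterval).1 ≤ cumSum p ((Fin.last n).val + 1) :=
    ⟨(cumSum_mono p (Nat.le_succ _)).trans e.le, e.ge⟩
  rw [H.value_eq x p 1 (Fin.last n) h, H.prismValue_of_eq_succ x p _ _ h e.symm, ← H.h_zero]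
  congr 2
  ext i : 3
  change (if ((Fin.last n).succ.succAbove i).val ≤ n then (0 : Fin 2) else 1) = 0
  rw [Fin.succ_last, Fin.succAbove_last]
  exact if_pos (Nat.le_of_lt_succ i.2)

/-- Simplicially homotopic maps have homotopic realizations. -/
theorem homotopic_toTop (H : SimplicialHomotopy f g) :
    ContinuousMap.Homotopic (SSet.toTop.map f).hom (SSet.toTop.map g).hom := by
  -- The homotopy is built as a map from the realization of `X` to the path space of the realization
  -- of `Y`. The universal property of the realization then applies directly, without a comparison
  -- of the realization of a product with a product.
  obtain ⟨F, hF⟩ := exists_toTop_hom (X := X) (Z := TopCat.of C(unitInterval, SSet.toTop.obj Y))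
    (fun k x => ContinuousMap.curry ⟨H.value (n := k.len) x, H.continuous_value x⟩)
    (fun {k l} θ x p => ContinuousMap.ext fun t => H.value_map (n := l.len) (m := k.len) θ x p t)
  let G : C(unitInterval × SSet.toTop.obj X, SSet.toTop.obj Y) :=
    ⟨fun z => F.hom z.2 z.1, by
      have : Continuous fun z : unitInterval × SSet.toTop.obj X => (F.hom z.2, z.1) := by fun_prop
      -- Uncurrying is continuous because the unit interval is locally compact.
      exact ContinuousEval.continuous_eval.comp this⟩
  -- The constructed homotopy starts at `g` and ends at `f`.
  refine ContinuousMap.Homotopic.symm ⟨⟨G, fun y => ?_, fun y => ?_⟩⟩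
  · let ev : TopCat.of C(unitInterval, SSet.toTop.obj Y) ⟶ SSet.toTop.obj Y :=
      TopCat.ofHom ⟨fun c => c 0, ContinuousEvalConst.continuous_eval_const _⟩
    have : F ≫ ev = SSet.toTop.map g := toTop_hom_ext fun k x p => by
      refine (congrArg (fun c : C(unitInterval, SSet.toTop.obj Y) => c 0) (hF k x p)).trans ?_
      exact (H.value_zero (n := k.len) x p).trans (toTop_map_point g x p).symm
    exact congrArg (fun z => z.hom y) this
  · let ev : TopCat.of C(unitInterval, SSet.toTop.obj Y) ⟶ SSet.toTop.obj Y :=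
      TopCat.ofHom ⟨fun c => c 1, ContinuousEvalConst.continuous_eval_const _⟩
    have : F ≫ ev = SSet.toTop.map f := toTop_hom_ext fun k x p => by
      refine (congrArg (fun c : C(unitInterval, SSet.toTop.obj Y) => c 1) (hF k x p)).trans ?_
      exact (H.value_one (n := k.len) x p).trans (toTop_map_point f x p).symm
    exact congrArg (fun z => z.hom y) this

end SimplicialHomotopy

end

/-! ## Homotopy equivalences -/

/-- A continuous map with a homotopy inverse. -/
def IsHomotopyEquiv {X Y : Type u} [TopologicalSpace X] [TopologicalSpace Y] (f : C(X, Y)) : Prop :=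
  ∃ g : C(Y, X), (g.comp f).Homotopic (ContinuousMap.id X) ∧
    (f.comp g).Homotopic (ContinuousMap.id Y)

theorem IsHomotopyEquiv.of_homotopic {X Y : Type u} [TopologicalSpace X] [TopologicalSpace Y]
    {f f' : C(X, Y)} (hf : IsHomotopyEquiv f) (h : f.Homotopic f') : IsHomotopyEquiv f' := by
  obtain ⟨g, h₁, h₂⟩ := hf
  exact ⟨g, (ContinuousMap.Homotopic.comp (.refl g) h.symm).trans h₁,
    (ContinuousMap.Homotopic.comp h.symm (.refl g)).trans h₂⟩

theorem IsHomotopyEquiv.comp {X Y Z : Type u} [TopologicalSpace X] [TopologicalSpace Y]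
    [TopologicalSpace Z] {f : C(X, Y)} {f' : C(Y, Z)} (hf : IsHomotopyEquiv f)
    (hf' : IsHomotopyEquiv f') : IsHomotopyEquiv (f'.comp f) := by
  obtain ⟨g, h₁, h₂⟩ := hf
  obtain ⟨g', h₁', h₂'⟩ := hf'
  exact ⟨g.comp g',
    (ContinuousMap.Homotopic.comp (.refl g) (ContinuousMap.Homotopic.comp h₁' (.refl f))).trans h₁,
    (ContinuousMap.Homotopic.comp (.refl f')
      (ContinuousMap.Homotopic.comp h₂ (.refl g'))).trans h₂'⟩

/-- With `g` a homotopy inverse of `f'`, the map `f` is homotopic to `g ∘ (f' ∘ f)`, a composite of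
two equivalences. -/
theorem IsHomotopyEquiv.of_comp_right {X Y Z : Type u} [TopologicalSpace X] [TopologicalSpace Y]
    [TopologicalSpace Z] {f : C(X, Y)} {f' : C(Y, Z)} (hf' : IsHomotopyEquiv f')
    (h : IsHomotopyEquiv (f'.comp f)) : IsHomotopyEquiv f := by
  obtain ⟨g, h₁, h₂⟩ := hf'
  have hg : IsHomotopyEquiv g := ⟨f', h₂, h₁⟩
  exact (h.comp hg).of_homotopic (ContinuousMap.Homotopic.comp h₁ (.refl f))

/-! ### Weak equivalences of enriched functors. -/

section

variable {E F G : SCat.{u}}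

theorem isWeakEquiv_iff (p : E ⟶ F) :
    IsWeakEquiv p ↔ IsHomotopyEquiv (classifyingSpace.map p).hom := by
  constructor
  · rintro ⟨e, he⟩
    exact ⟨e.invFun, he ▸ e.left_inv, he ▸ e.right_inv⟩
  · rintro ⟨g, h₁, h₂⟩
    exact ⟨⟨_, g, h₁, h₂⟩, rfl⟩

theorem classifyingSpace_map_comp (p : E ⟶ F) (q : F ⟶ G) :
    (classifyingSpace.map (p ≫ q)).hom =
      (classifyingSpace.map q).hom.comp (classifyingSpace.map p).hom := by
  rw [Functor.map_comp]; rfl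

theorem classifyingSpace_map_id (E : SCat.{u}) :
    (classifyingSpace.map (𝟙 E)).hom = ContinuousMap.id _ := by
  rw [CategoryTheory.Functor.map_id]; rfl

theorem IsWeakEquiv.comp {p : E ⟶ F} {q : F ⟶ G} (hp : IsWeakEquiv p) (hq : IsWeakEquiv q) :
    IsWeakEquiv (p ≫ q) := by
  rw [isWeakEquiv_iff] at *
  rw [classifyingSpace_map_comp]
  exact hp.comp hq

theorem IsWeakEquiv.of_comp_right {p : E ⟶ F} {q : F ⟶ G} (hq : IsWeakEquiv q)
    (h : IsWeakEquiv (p ≫ q)) : IsWeakEquiv p := by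
  rw [isWeakEquiv_iff] at *
  rw [classifyingSpace_map_comp] at h
  exact hq.of_comp_right h

theorem isWeakEquiv_of_simplicialHomotopy (p : E ⟶ F) (s : F ⟶ E)
    (h₁ : Nonempty (SimplicialHomotopy (diagNerve.map (p ≫ s)) (diagNerve.map (𝟙 E))))
    (h₂ : Nonempty (SimplicialHomotopy (diagNerve.map (s ≫ p)) (diagNerve.map (𝟙 F)))) :
    IsWeakEquiv p := by
  rw [isWeakEquiv_iff]
  refine ⟨(classifyingSpace.map s).hom, ?_, ?_⟩
  · rw [← classifyingSpace_map_comp, ← classifyingSpace_map_id]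
    exact h₁.some.homotopic_toTop
  · rw [← classifyingSpace_map_comp, ← classifyingSpace_map_id]
    exact h₂.some.homotopic_toTop

end

/-! ## Cylinders on natural transformations -/

section Cylinder

variable {C C' : Type u} [Category.{v} C] [Category.{w} C'] {P Q : C ⥤ C'} (α : P ⟶ Q)

/-- The values of the two functors. -/
def cylObj (P Q : C ⥤ C') : Fin 2 → C → C'
  | 0, A => P.obj A
  | 1, A => Q.obj A

/-- The values of the functor `[1] × C ⥤ C'` on morphisms. -/
def cylMap : ∀ (i j : Fin 2) (_ : i ≤ j) {A B : C} (_ : A ⟶ B), cylObj P Q i A ⟶ cylObj P Q j B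
  | 0, 0, _, _, _, f => P.map f
  | 0, 1, _, _, B, f => P.map f ≫ α.app B
  | 1, 1, _, _, _, f => Q.map f

theorem cylMap_id : ∀ (i : Fin 2) (A : C), cylMap α i i le_rfl (𝟙 A) = 𝟙 (cylObj P Q i A)
  | 0, A => P.map_id A
  | 1, A => Q.map_id A

theorem cylMap_comp : ∀ (i j l : Fin 2) (h : i ≤ j) (h' : j ≤ l) {A B M : C} (f : A ⟶ B) (g : B ⟶ M),
    cylMap α i l (h.trans h') (f ≫ g) = cylMap α i j h f ≫ cylMap α j l h' g
  | 0, 0, 0, _, _, _, _, _, f, g => P.map_comp f g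
  | 0, 0, 1, _, _, _, _, M, f, g =>
    (congrArg (· ≫ α.app M) (P.map_comp f g)).trans (Category.assoc _ _ _)
  | 0, 1, 1, _, _, A, B, M, f, g => by
    change P.map (f ≫ g) ≫ α.app M = (P.map f ≫ α.app B) ≫ Q.map g
    rw [P.map_comp, Category.assoc, Category.assoc, α.naturality]
  | 1, 1, 1, _, _, _, _, _, f, g => Q.map_comp f g

/-- The functor on `[1] × C` that corresponds to a natural transformation. -/
def cyl : Fin 2 × C ⥤ C' where
  obj X := cylObj P Q X.1 X.2
  map {X Y} f := cylMap α X.1 Y.1 (leOfHom f.1) f.2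
  map_id X := cylMap_id α X.1 X.2
  map_comp {X Y Z} f g := cylMap_comp α X.1 Y.1 Z.1 (leOfHom f.1) (leOfHom g.1) f.2 g.2

end Cylinder

/-- The functor that corresponds to a morphism of the simplex category. -/
abbrev orderFunctor {k l : SimplexCategory} (χ : k ⟶ l) : Fin (k.len + 1) ⥤ Fin (l.len + 1) :=
  χ.toOrderHom.monotone.functor

/-! ## Natural transformations of enriched functors -/

section Transformation

variable {E F : SCat.{u}}

/-- The action of an enriched functor on paths. -/
abbrev EFunctor.cell (p : E ⟶ F) {A B : E.Obj} {k : SimplexCategoryᵒᵖ} (x : E.Cell k A B) :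
    F.Cell k (EFunctor.obj p A) (EFunctor.obj p B) :=
  ((EFunctor.map p A B).app k).toFunctor.mapArrow.obj x

/-- An enriched natural transformation. -/
structure Transformation (p q : E ⟶ F) where
  app : ∀ A : E.Obj, EFunctor.obj p A ⟶ EFunctor.obj q A
  natural : ∀ {A B : E.Obj} {k : SimplexCategoryᵒᵖ} (x : E.Cell k A B),
    hcomp (EFunctor.cell p x) (cst (app B) k) = hcomp (cst (app A) k) (EFunctor.cell q x)

variable {p q : E ⟶ F} (η : Transformation p q)

/-- The natural transformation of functors between the categories `E_k` and `F_k`. -/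
def Transformation.level (k : SimplexCategoryᵒᵖ) : levelFunctor p k ⟶ levelFunctor q k where
  app A := (Functor.const _).obj (Mor.app (η.app A) k)
  naturality A B G := functor_ext fun f => η.natural (Arrow.mk (G.map f))

theorem Transformation.levelsMap_app {k l : SimplexCategoryᵒᵖ} (θ : k ⟶ l) (A : E.Obj) :
    (levelsMap F θ).map ((η.level k).app A) = (η.level l).app A :=
  functor_ext fun f => (mapArrow_const _ _).trans (congrArg const (Mor.map_app (η.app A) θ))

theorem levelsMap_levelFunctor (p : E ⟶ F) {k l : SimplexCategoryᵒᵖ} (θ : k ⟶ l) {A B : Level E k}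
    (G : A ⟶ B) : (levelsMap F θ).map ((levelFunctor p k).map G) =
      (levelFunctor p l).map ((levelsMap E θ).map G) :=
  functor_ext fun f => congrArg (fun H => H.toFunctor.mapArrow.obj (Arrow.mk (G.map
    ((SimplexCategory.toCat.map θ.unop).toFunctor.map f)))) ((EFunctor.map p A B).naturality θ).symm

/-- The equality is heterogeneous because source and target match definitionally only once the
endpoints `i` and `j` are concrete. -/
theorem Transformation.levelsMap_cylMap {k l : SimplexCategoryᵒᵖ} (θ : k ⟶ l) :
    ∀ (i j : Fin 2) (h : i ≤ j) {A B : Level E k} (f : A ⟶ B),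
      (levelsMap F θ).map (cylMap (η.level k) i j h f) ≍
        cylMap (η.level l) i j h ((levelsMap E θ).map f)
  | 0, 0, _, _, _, f => heq_of_eq (levelsMap_levelFunctor p θ f)
  | 0, 1, _, A, B, f => heq_of_eq (((levelsMap F θ).map_comp ((levelFunctor p k).map f)
      ((η.level k).app B)).trans
    ((congrArg (· ≫ (levelsMap F θ).map ((η.level k).app B)) (levelsMap_levelFunctor p θ f)).trans
      (congrArg ((levelFunctor p l).map ((levelsMap E θ).map f) ≫ ·) (η.levelsMap_app θ B))))
  | 1, 1, _, _, _, f => heq_of_eq (levelsMap_levelFunctor q θ f)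

theorem levelsMap_cylObj {k l : SimplexCategoryᵒᵖ} (θ : k ⟶ l) : ∀ (i : Fin 2) (A : Level E k),
    (levelsMap F θ).obj (cylObj (levelFunctor p k) (levelFunctor q k) i A) =
      cylObj (levelFunctor p l) (levelFunctor q l) i ((levelsMap E θ).obj A)
  | 0, _ => rfl
  | 1, _ => rfl

/-- A simplicial operator on the diagonal acts both on the nerve direction and on the degree of the
morphisms. This lemma handles the second action on the homotopy; the first is precomposition. -/
theorem Transformation.cyl_levelsMap {k l : SimplexCategoryᵒᵖ} (θ : k ⟶ l) :
    cyl (η.level k) ⋙ levelsMap F θ = (𝟭 (Fin 2)).prod (levelsMap E θ) ⋙ cyl (η.level l) :=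
  Functor.hext (fun X => levelsMap_cylObj θ X.1 X.2)
    fun X Y f => η.levelsMap_cylMap θ X.1 Y.1 (leOfHom f.1) f.2

/-- An enriched natural transformation induces a homotopy of nerves. -/
def Transformation.simplicialHomotopy :
    SimplicialHomotopy (diagNerve.map p) (diagNerve.map q) where
  h {k} χ (x : Fin (k.len + 1) ⥤ Level E (op k)) := Functor.prod' (orderFunctor χ) x ⋙ cyl (η.level (op k))
  map_h {k l} θ χ (x : Fin (k.len + 1) ⥤ Level E (op k)) := congrArg (fun z =>
    orderFunctor θ ⋙ Functor.prod' (orderFunctor χ) x ⋙ z) (η.cyl_levelsMap θ.op)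
  h_zero {k} (x : Fin (k.len + 1) ⥤ Level E (op k)) := rfl
  h_one {k} (x : Fin (k.len + 1) ⥤ Level E (op k)) := rfl

end Transformation

/-! ## Full images -/

section Induced

variable (F : SCat.{u}) {T : Type u} (φ : T → F.Obj)

/-- The category enriched over simplicial categories with the morphisms of `F` and with objects
indexed by a map to the objects of `F`. -/
def SCat.induced : SCat.{u} where
  Obj := T
  Hom A B := F.Hom (φ A) (φ B)
  unit A k := F.unit (φ A) k
  comp k := F.comp k
  map_unit A := F.map_unit (φ A)
  map_comp := F.map_comp
  unit_comp := F.unit_comp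
  comp_unit := F.comp_unit
  assoc := F.assoc

/-- The inclusion of a full image. -/
def SCat.inducedFunctor : F.induced φ ⟶ F where
  obj A := φ A
  map A B := 𝟙 _
  map_unit _ _ := rfl
  map_comp _ _ := rfl

variable {F φ} {σ : F.Obj → T} (e : ∀ B, φ (σ B) ≅ B)

/-- Conjugation with isomorphisms, on categories of morphisms. -/
def conj (k : SimplexCategoryᵒᵖ) (B C : F.Obj) :
    (F.Hom B C).obj k ⥤ (F.Hom (φ (σ B)) (φ (σ C))).obj k :=
  Functor.prod' (Functor.prod' ((Functor.const _).obj (Mor.app (e B).hom k)) (𝟭 _) ⋙ F.comp k)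
    ((Functor.const _).obj (Mor.app (e C).inv k)) ⋙ F.comp k

theorem cst_hom_inv_hcomp {B C M : F.Obj} (i : B ≅ C) {k : SimplexCategoryᵒᵖ} (x : F.Cell k B M) :
    hcomp (cst i.hom k) (hcomp (cst i.inv k) x) = x := by
  rw [← hcomp_assoc, ← cst_comp, i.hom_inv_id, cst_id_hcomp]

theorem cst_inv_hom_hcomp {B C M : F.Obj} (i : B ≅ C) {k : SimplexCategoryᵒᵖ} (x : F.Cell k C M) :
    hcomp (cst i.inv k) (hcomp (cst i.hom k) x) = x := cst_hom_inv_hcomp i.symm x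

/-- The functor to a full image given by a choice of preimages of objects up to isomorphism. -/
def SCat.inducedInverse : F ⟶ F.induced φ where
  obj B := σ B
  map B C :=
    { app := fun k => (conj e k B C).toCatHom
      naturality := fun k l θ => Cat.ext (functor_ext_arrow fun x => by
        change hcomp (hcomp (cst (e B).hom l) (F.res θ x)) (cst (e C).inv l) =
          F.res θ (hcomp (hcomp (cst (e B).hom k) x) (cst (e C).inv k))
        rw [res_hcomp, res_hcomp, res_cst, res_cst]) }
  map_unit B k := by
    refine congrArg Comma.left (?_ : hcomp (hcomp (cst (e B).hom k) (cst (𝟙 B) k))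
      (cst (e B).inv k) = cst (𝟙 (φ (σ B))) k)
    rw [hcomp_cst_id, ← cst_comp, Iso.hom_inv_id]
  map_comp {A B C k} x y := by
    change hcomp (hcomp (cst (e A).hom k) (hcomp x y)) (cst (e C).inv k) =
      hcomp (E := F) (hcomp (hcomp (cst (e A).hom k) x) (cst (e B).inv k))
        (hcomp (hcomp (cst (e B).hom k) y) (cst (e C).inv k))
    simp only [hcomp_assoc, cst_inv_hom_hcomp]

/-- The full image of an essentially surjective map is weakly equivalent to the whole. -/
theorem isWeakEquiv_inducedFunctor (h : ∀ B : F.Obj, ∃ A, Nonempty (φ A ≅ B)) :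
    IsWeakEquiv (F.inducedFunctor φ) := by
  choose σ e using h
  replace e := fun B => (e B).some
  -- The naturality square of `e` for conjugated paths. It serves both composites, since the full
  -- image has the same categories of morphisms.
  have key : ∀ {B C : F.Obj} {k : SimplexCategoryᵒᵖ} (x : F.Cell k B C),
      hcomp (hcomp (hcomp (cst (e B).hom k) x) (cst (e C).inv k)) (cst (e C).hom k) =
        hcomp (cst (e B).hom k) x := by
    intro B C k x
    rw [hcomp_assoc, ← cst_comp, Iso.inv_hom_id, hcomp_cst_id]
  refine isWeakEquiv_of_simplicialHomotopy _ (SCat.inducedInverse e) ⟨Transformation.simplicialHomotopy ?_⟩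
    ⟨Transformation.simplicialHomotopy ?_⟩
  · exact
      { app := fun A => ⟨(e (φ A)).hom.app, (e (φ A)).hom.map_app⟩
        natural := fun {A B k} x => key (B := φ A) (C := φ B) x }
  · exact
      { app := fun B => (e B).hom
        natural := fun x => key x }

end Induced

/-! ## Enriched functors with unique good lifts -/

/-- The functor of categories of morphisms in simplicial degree `k`. -/
abbrev EFunctor.hom {E F : SCat.{u}} (p : E ⟶ F) (A B : E.Obj) (k : SimplexCategoryᵒᵖ) :
    (E.Hom A B).obj k ⥤ (F.Hom (EFunctor.obj p A) (EFunctor.obj p B)).obj k :=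
  ((EFunctor.map p A B).app k).toFunctor

/-- A class of good objects in the categories of morphisms such that every object of the target
has a unique good lift and such that morphisms out of good objects lift uniquely: the good objects
form coreflective subcategories that are equivalent to the categories of morphisms of the
target. -/
structure GoodLifts {E F : SCat.{u}} (p : E ⟶ F) where
  good : ∀ {A B : E.Obj} {k : SimplexCategoryᵒᵖ}, (E.Hom A B).obj k → Prop
  good_unit : ∀ (A : E.Obj) (k : SimplexCategoryᵒᵖ), good (E.unit A k)
  good_comp : ∀ {A B C : E.Obj} {k : SimplexCategoryᵒᵖ} {f : (E.Hom A B).obj k}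
    {g : (E.Hom B C).obj k}, good f → good g → good ((E.comp k).obj (f, g))
  good_res : ∀ {A B : E.Obj} {k l : SimplexCategoryᵒᵖ} (θ : k ⟶ l) {f : (E.Hom A B).obj k},
    good f → good (((E.Hom A B).map θ).toFunctor.obj f)
  exists_lift : ∀ {A B : E.Obj} {k : SimplexCategoryᵒᵖ}
    (y : (F.Hom (EFunctor.obj p A) (EFunctor.obj p B)).obj k),
    ∃ t, good t ∧ (EFunctor.hom p A B k).obj t = y
  lift_unique : ∀ {A B : E.Obj} {k : SimplexCategoryᵒᵖ} {t t' : (E.Hom A B).obj k}, good t →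
    good t' → (EFunctor.hom p A B k).obj t = (EFunctor.hom p A B k).obj t' → t = t'
  exists_map : ∀ {A B : E.Obj} {k : SimplexCategoryᵒᵖ} {t : (E.Hom A B).obj k}, good t →
    ∀ (f : (E.Hom A B).obj k) (v : F.Cell k (EFunctor.obj p A) (EFunctor.obj p B)),
      v.left = (EFunctor.hom p A B k).obj t → v.right = (EFunctor.hom p A B k).obj f →
        ∃ ψ : t ⟶ f, Arrow.mk ((EFunctor.hom p A B k).map ψ) = v
  map_unique : ∀ {A B : E.Obj} {k : SimplexCategoryᵒᵖ} {t f : (E.Hom A B).obj k}, good t →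
    ∀ ψ ψ' : t ⟶ f, (EFunctor.hom p A B k).map ψ = (EFunctor.hom p A B k).map ψ' → ψ = ψ'

namespace GoodLifts

variable {E F : SCat.{u}} {p : E ⟶ F} (L : GoodLifts p) {A B C : E.Obj} {k l : SimplexCategoryᵒᵖ}

/-- Out of a good object, a path is determined by its endpoints and its image. All strict identities
for the retraction below reduce to this, because after `p` they become evident. -/
theorem cell_ext {x y : E.Cell k A B} (hx : L.good x.left) (hl : x.left = y.left)
    (hr : x.right = y.right) (h : EFunctor.cell p x = EFunctor.cell p y) : x = y := by
  obtain ⟨f, g, a, rfl⟩ := x.mk_surjective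
  obtain ⟨f', g', a', rfl⟩ := y.mk_surjective
  dsimp at hl hr
  subst hl hr
  exact congrArg Arrow.mk (L.map_unique hx a a' (Arrow.mk_injective _ _ h))

theorem good_cell_ext {x y : E.Cell k A B} (hx : L.good x.left) (hy : L.good y.left)
    (hx' : L.good x.right) (hy' : L.good y.right) (h : EFunctor.cell p x = EFunctor.cell p y) :
    x = y :=
  L.cell_ext hx (L.lift_unique hx hy (congrArg Comma.left h))
    (L.lift_unique hx' hy' (congrArg Comma.right h)) h

/-- The good lift. -/
def lift (y : (F.Hom (EFunctor.obj p A) (EFunctor.obj p B)).obj k) : (E.Hom A B).obj k :=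
  (L.exists_lift y).choose

theorem good_lift (y : (F.Hom (EFunctor.obj p A) (EFunctor.obj p B)).obj k) :
    L.good (L.lift y) := (L.exists_lift y).choose_spec.1

theorem hom_lift (y : (F.Hom (EFunctor.obj p A) (EFunctor.obj p B)).obj k) :
    (EFunctor.hom p A B k).obj (L.lift y) = y := (L.exists_lift y).choose_spec.2

/-- The lift of a morphism that starts at the image of a good object. -/
def liftMap {t f : (E.Hom A B).obj k} (ht : L.good t)
    (v : F.Cell k (EFunctor.obj p A) (EFunctor.obj p B))
    (hl : v.left = (EFunctor.hom p A B k).obj t) (hr : v.right = (EFunctor.hom p A B k).obj f) :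
    t ⟶ f := (L.exists_map ht f v hl hr).choose

theorem mk_map_liftMap {t f : (E.Hom A B).obj k} (ht : L.good t)
    (v : F.Cell k (EFunctor.obj p A) (EFunctor.obj p B)) (hl hr) :
    Arrow.mk ((EFunctor.hom p A B k).map (L.liftMap (f := f) ht v hl hr)) = v :=
  (L.exists_map ht f v hl hr).choose_spec

variable (A B k) in
/-- The good lift, as a functor. -/
def liftFunctor :
    (F.Hom (EFunctor.obj p A) (EFunctor.obj p B)).obj k ⥤ (E.Hom A B).obj k where
  obj y := L.lift y
  map {y y'} u := L.liftMap (L.good_lift y) (Arrow.mk u) (L.hom_lift y).symm (L.hom_lift y').symm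
  map_id y := by
    -- Lifts out of good objects are unique, so functoriality may be checked after applying `p`.
    refine L.map_unique (L.good_lift y) _ _ (Arrow.mk_injective _ _ ?_)
    rw [mk_map_liftMap, CategoryTheory.Functor.map_id]
    exact (congrArg const (L.hom_lift y)).symm
  map_comp {y y' y''} u u' := by
    refine L.map_unique (L.good_lift y) _ _ (Arrow.mk_injective _ _ ?_)
    rw [mk_map_liftMap, CategoryTheory.Functor.map_comp, ← paste_mk, ← paste_mk]
    exact (paste_congr _ (L.mk_map_liftMap _ _ _ _) (L.mk_map_liftMap _ _ _ _)).symm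

theorem cell_liftFunctor (x : F.Cell k (EFunctor.obj p A) (EFunctor.obj p B)) :
    EFunctor.cell p ((L.liftFunctor A B k).mapArrow.obj x) = x :=
  L.mk_map_liftMap (L.good_lift _) (Arrow.mk x.hom) (L.hom_lift _).symm (L.hom_lift _).symm

theorem mk_map_comp {K K' : Type u} [Category.{u} K] [Category.{u} K'] (P : K ⥤ K') {f g g' : K}
    (a : f ⟶ g) (b : g ⟶ g') :
    Arrow.mk (P.map (a ≫ b)) = paste (Arrow.mk (P.map a)) (Arrow.mk (P.map b)) rfl := by
  rw [P.map_comp, paste_mk]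

theorem cell_res (p : E ⟶ F) (θ : k ⟶ l) (x : E.Cell k A B) :
    EFunctor.cell p (E.res θ x) = F.res θ (EFunctor.cell p x) :=
  congrArg (fun H => H.toFunctor.mapArrow.obj x) ((EFunctor.map p A B).naturality θ)

/-- Good lifts, as an enriched functor. -/
def section_ : F.induced (EFunctor.obj p) ⟶ E where
  obj A := A
  map A B :=
    { app := fun k => (L.liftFunctor A B k).toCatHom
      -- The lifts were chosen, but uniqueness of good lifts and stability of goodness under
      -- restriction force strict compatibility with the simplicial structure.
      naturality := fun k l θ => Cat.ext (functor_ext_arrow fun x => by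
        refine L.good_cell_ext (L.good_lift _) (L.good_res θ (L.good_lift _)) (L.good_lift _)
          (L.good_res θ (L.good_lift _)) ?_
        refine (L.cell_liftFunctor (F.res θ x)).trans ((congrArg _ (L.cell_liftFunctor x)).symm.trans
          (cell_res p θ _).symm)) }
  map_unit A k := L.lift_unique (L.good_lift _) (L.good_unit A k)
    ((L.hom_lift _).trans (EFunctor.map_unit p A k).symm)
  map_comp {A B C k} x y := by
    refine L.good_cell_ext (L.good_lift _) (L.good_comp (L.good_lift _) (L.good_lift _))
      (L.good_lift _) (L.good_comp (L.good_lift _) (L.good_lift _)) ?_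
    refine (L.cell_liftFunctor _).trans (Eq.trans ?_ (EFunctor.map_comp p _ _).symm)
    exact (congrArg₂ hcomp (L.cell_liftFunctor _) (L.cell_liftFunctor _)).symm

/-- The factorization of an enriched functor through its full image. -/
def toInduced (p : E ⟶ F) : E ⟶ F.induced (EFunctor.obj p) where
  obj A := A
  map A B := EFunctor.map p A B
  map_unit := EFunctor.map_unit p
  map_comp := EFunctor.map_comp p

theorem toInduced_inducedFunctor (p : E ⟶ F) : toInduced p ≫ F.inducedFunctor _ = p := rfl

/-- The full image has the objects of the source, so the section is the identity on objects and the
equality is strict. -/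
theorem section_toInduced : L.section_ ≫ toInduced p = 𝟙 _ := by
  refine EFunctor.ext rfl (heq_of_eq ?_)
  funext A B
  ext k : 2
  exact functor_ext_arrow
    (F := EFunctor.hom (L.section_ ≫ toInduced p) A B k)
    (G := EFunctor.hom (𝟙 (F.induced (EFunctor.obj p))) A B k) fun x => L.cell_liftFunctor x

theorem mk_map_liftMap_const (f : (E.Hom A B).obj k) :
    Arrow.mk ((EFunctor.hom p A B k).map (L.liftMap (f := f) (L.good_lift _)
      (const ((EFunctor.hom p A B k).obj f)) (L.hom_lift _).symm rfl)) =
      const ((EFunctor.hom p A B k).obj f) :=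
  L.mk_map_liftMap (L.good_lift _) (const ((EFunctor.hom p A B k).obj f)) (L.hom_lift _).symm rfl

variable (A B k) in
/-- The comparison of a good lift with the object it came from. -/
def counit : EFunctor.hom p A B k ⋙ L.liftFunctor A B k ⟶ 𝟭 _ where
  app f := L.liftMap (L.good_lift _) (const ((EFunctor.hom p A B k).obj f)) (L.hom_lift _).symm rfl
  naturality f g a := by
    -- The counit lies over an identity, so both sides of the naturality square lie over the image
    -- of `a`.
    refine L.map_unique (L.good_lift _) _ _ (Arrow.mk_injective _ _ ?_)
    refine (mk_map_comp _ _ _).trans (Eq.trans ?_ (mk_map_comp _ _ _).symm)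
    refine (paste_congr _ (L.cell_liftFunctor (Arrow.mk ((EFunctor.hom p A B k).map a)))
      (L.mk_map_liftMap_const g)).trans
      (Eq.trans ?_ (paste_congr _ (L.mk_map_liftMap_const f) rfl).symm)
    exact (paste_const _ _ rfl).trans (const_paste _ _ rfl).symm

/-- The homotopy on categories of morphisms, on paths. -/
def cylCell (i j : Fin 2) (h : i ≤ j) (x : E.Cell k A B) : E.Cell k A B :=
  Arrow.mk (cylMap (L.counit A B k) i j h x.hom)

/-- The homotopy is constant after projection: the lifts of a path lie over its image and the counit
lies over an identity. -/
theorem cell_cylCell : ∀ (i j : Fin 2) (h : i ≤ j) (x : E.Cell k A B),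
    EFunctor.cell p (L.cylCell i j h x) = EFunctor.cell p x
  | 0, 0, _, x => L.cell_liftFunctor (EFunctor.cell p x)
  | 0, 1, _, x => (mk_map_comp _ _ _).trans ((paste_congr _
      (L.cell_liftFunctor (EFunctor.cell p x)) (L.mk_map_liftMap_const x.right)).trans
      (paste_const _ (EFunctor.cell p x) rfl))
  | 1, 1, _, x => rfl

theorem cylCell_unit : ∀ (i j : Fin 2) (h : i ≤ j),
    L.cylCell i j h (const (E.unit A k)) = const (E.unit A k)
  | 0, 0, _ => L.good_cell_ext (L.good_lift _) (L.good_unit A k) (L.good_lift _) (L.good_unit A k)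
    (L.cell_cylCell 0 0 _ _)
  | 0, 1, _ => L.cell_ext (L.good_lift _) (L.lift_unique (L.good_lift _) (L.good_unit A k)
    (L.hom_lift _)) rfl (L.cell_cylCell 0 1 (by decide) _)
  | 1, 1, _ => rfl

theorem cell_cylCell_hcomp (i j : Fin 2) (h : i ≤ j) (x : E.Cell k A B) (y : E.Cell k B C) :
    EFunctor.cell p (L.cylCell i j h (hcomp x y)) =
      EFunctor.cell p (hcomp (L.cylCell i j h x) (L.cylCell i j h y)) := by
  refine (L.cell_cylCell i j h _).trans ((EFunctor.map_comp p x y).trans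
    (Eq.trans ?_ (EFunctor.map_comp p _ _).symm))
  exact (congrArg₂ hcomp (L.cell_cylCell i j h x) (L.cell_cylCell i j h y)).symm

/-- The homotopy respects composition strictly. Paths from the `0`-end start at a good lift and are
compared by uniqueness; at the `0`-end good objects are closed under composition, while at the
`1`-end nothing is changed. The statements for units and for restriction follow the same pattern. -/
theorem cylCell_hcomp : ∀ (i j : Fin 2) (h : i ≤ j) (x : E.Cell k A B) (y : E.Cell k B C),
    L.cylCell i j h (hcomp x y) = hcomp (L.cylCell i j h x) (L.cylCell i j h y)
  | 0, 0, h, x, y => L.good_cell_ext (x := L.cylCell 0 0 h (hcomp x y))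
    (y := hcomp (L.cylCell 0 0 h x) (L.cylCell 0 0 h y)) (L.good_lift _)
    (L.good_comp (L.good_lift _) (L.good_lift _)) (L.good_lift _)
    (L.good_comp (L.good_lift _) (L.good_lift _)) (L.cell_cylCell_hcomp 0 0 h x y)
  | 0, 1, h, x, y => L.cell_ext (x := L.cylCell 0 1 h (hcomp x y))
    (y := hcomp (L.cylCell 0 1 h x) (L.cylCell 0 1 h y)) (L.good_lift _)
    (L.lift_unique (L.good_lift _) (L.good_comp (L.good_lift _) (L.good_lift _))
      (congrArg Comma.left (L.cell_cylCell_hcomp 0 1 h x y))) rfl (L.cell_cylCell_hcomp 0 1 h x y)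
  | 1, 1, h, x, y => rfl

theorem cell_res_cylCell (θ : k ⟶ l) (i j : Fin 2) (h : i ≤ j) (x : E.Cell k A B) :
    EFunctor.cell p (E.res θ (L.cylCell i j h x)) =
      EFunctor.cell p (L.cylCell i j h (E.res θ x)) := by
  rw [cell_cylCell, cell_res, cell_res, cell_cylCell]

theorem res_cylCell (θ : k ⟶ l) : ∀ (i j : Fin 2) (h : i ≤ j) (x : E.Cell k A B),
    E.res θ (L.cylCell i j h x) = L.cylCell i j h (E.res θ x)
  | 0, 0, h, x => L.good_cell_ext (x := E.res θ (L.cylCell 0 0 h x))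
    (y := L.cylCell 0 0 h (E.res θ x)) (L.good_res θ (L.good_lift _)) (L.good_lift _)
    (L.good_res θ (L.good_lift _)) (L.good_lift _) (L.cell_res_cylCell θ 0 0 h x)
  | 0, 1, h, x => L.cell_ext (x := E.res θ (L.cylCell 0 1 h x))
    (y := L.cylCell 0 1 h (E.res θ x)) (L.good_res θ (L.good_lift _))
    (L.lift_unique (L.good_res θ (L.good_lift _)) (L.good_lift _)
      (congrArg Comma.left (L.cell_res_cylCell θ 0 1 h x))) rfl (L.cell_res_cylCell θ 0 1 h x)
  | 1, 1, h, x => rfl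

/-- The functor `E_k ⥤ E_k` that applies good lifts at the vertices sent to `0`. -/
def cylLevel {k : SimplexCategory} (χ : k ⟶ SimplexCategory.mk 1) :
    Level E (op k) ⥤ Level E (op k) where
  obj A := A
  -- A morphism of `E_k` is itself a chain in a category of morphisms. The counits therefore deform
  -- each such chain, rather than the objects, and `χ` tells which vertices of the chain are
  -- replaced by good lifts.
  map {A B} G := Functor.prod' (orderFunctor χ) G ⋙ cyl (L.counit A B (op k))
  map_id A := functor_ext fun f => L.cylCell_unit _ _ _
  map_comp G G' := functor_ext fun f => L.cylCell_hcomp _ _ _ (Arrow.mk (G.map f))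
    (Arrow.mk (G'.map f))

theorem cylLevel_levelsMap {k l : SimplexCategory} (θ : l ⟶ k) (χ : k ⟶ SimplexCategory.mk 1) :
    L.cylLevel χ ⋙ levelsMap E θ.op = levelsMap E θ.op ⋙ L.cylLevel (θ ≫ χ) :=
  Functor.hext (fun _ => rfl) fun A B G => heq_of_eq (functor_ext fun f =>
    L.res_cylCell θ.op _ _ _ (Arrow.mk (G.map ((SimplexCategory.toCat.map θ).toFunctor.map f))))

/-- Good lifts form a deformation retract. -/
def simplicialHomotopy :
    SimplicialHomotopy (diagNerve.map (toInduced p ≫ L.section_)) (diagNerve.map (𝟙 E)) where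
  h {k} χ (x : Fin (k.len + 1) ⥤ Level E (op k)) := x ⋙ L.cylLevel χ
  map_h {k l} θ χ (x : Fin (k.len + 1) ⥤ Level E (op k)) :=
    congrArg (fun z => orderFunctor θ ⋙ x ⋙ z) (L.cylLevel_levelsMap θ χ)
  h_zero {k} (x : Fin (k.len + 1) ⥤ Level E (op k)) := rfl
  h_one {k} (x : Fin (k.len + 1) ⥤ Level E (op k)) := rfl

theorem isWeakEquiv_toInduced (L : GoodLifts p) : IsWeakEquiv (toInduced p) := by
  refine isWeakEquiv_of_simplicialHomotopy _ L.section_ ⟨L.simplicialHomotopy⟩ ?_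
  -- The other composite is the identity, so the homotopy induced by the identity transformation
  -- suffices.
  rw [L.section_toInduced]
  exact ⟨Transformation.simplicialHomotopy
    { app := fun A => 𝟙 A
      natural := fun x => (hcomp_cst_id x).trans (cst_id_hcomp x).symm }⟩

/-- An essentially surjective enriched functor with unique good lifts is a weak equivalence. -/
theorem isWeakEquiv (L : GoodLifts p) (h : ∀ B : F.Obj, ∃ A, Nonempty (EFunctor.obj p A ≅ B)) :
    IsWeakEquiv p := by
  have e := L.isWeakEquiv_toInduced.comp (isWeakEquiv_inducedFunctor h)
  rwa [toInduced_inducedFunctor] at e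

end GoodLifts

/-! ## The symmetric monoidal structure of the underlying category -/

section Monoidal

/-- The axioms are stated for paths. This transfers them to the underlying category, whose morphisms
are seen as constant paths in all degrees. -/
theorem Mor.ext_cst {E : SCat.{u}} {A B : E.Obj} {f g : A ⟶ B} (h : ∀ k, cst f k = cst g k) :
    f = g :=
  Mor.ext (funext fun k => congrArg Comma.left (h k))

theorem madd_id {D : SumSCat.{u}} (A B : D.Obj) : madd (𝟙 A) (𝟙 B) = 𝟙 (A + B) :=
  Mor.ext_cst fun k => (cst_madd _ _ k).trans (hadd_cst_id A B)

theorem madd_comp {D : SumSCat.{u}} {A A' A'' B B' B'' : D.Obj} (f : A ⟶ A') (f' : A' ⟶ A'')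
    (g : B ⟶ B') (g' : B' ⟶ B'') : madd (f ≫ f') (g ≫ g') = madd f g ≫ madd f' g' :=
  Mor.ext_cst fun k => by
    rw [cst_madd, cst_comp, cst_comp, hadd_hcomp, cst_comp, cst_madd, cst_madd]

theorem madd_eqToHom {D : SumSCat.{u}} {A A' B B' : D.Obj} (h : A = A') (h' : B = B') :
    madd (eqToHom h) (eqToHom h') = eqToHom (congrArg₂ (· + ·) h h') := by
  subst h h'
  exact madd_id A B

variable {D : PermSCat.{u}}

theorem madd_assoc {A A' B B' C C' : D.Obj} (f : A ⟶ A') (g : B ⟶ B') (h : C ⟶ C') :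
    madd (madd f g) h ≫ eqToHom (add_assoc A' B' C') =
      eqToHom (add_assoc A B C) ≫ madd f (madd g h) :=
  Mor.ext_cst fun k => by
    rw [cst_comp, cst_comp, cst_madd, cst_madd, cst_madd, cst_madd]
    exact D.isPermutative.assoc _ _ _

theorem zero_madd {A A' : D.Obj} (f : A ⟶ A') :
    madd (𝟙 (0 : D.Obj)) f ≫ eqToHom (zero_add A') = eqToHom (zero_add A) ≫ f :=
  Mor.ext_cst fun k => by
    rw [cst_comp, cst_comp, cst_madd]
    exact D.isPermutative.zero_hadd _

theorem madd_zero {A A' : D.Obj} (f : A ⟶ A') :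
    madd f (𝟙 (0 : D.Obj)) ≫ eqToHom (add_zero A') = eqToHom (add_zero A) ≫ f :=
  Mor.ext_cst fun k => by
    rw [cst_comp, cst_comp, cst_madd]
    exact D.isPermutative.hadd_zero _

theorem braid_natural {A A' B B' : D.Obj} (f : A ⟶ A') (g : B ⟶ B') :
    madd f g ≫ D.braid A' B' = D.braid A B ≫ madd g f :=
  Mor.ext_cst fun k => by
    rw [cst_comp, cst_comp, cst_madd, cst_madd]
    exact D.isPermutative.natural _ _

/-- The underlying category is symmetric monoidal with identities as associators and unitors. This
gives access to general coherence for the interchange of middle summands, needed for sums of objects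
of the `Γ`-categories. -/
instance : MonoidalCategoryStruct D.Obj where
  tensorObj A B := A + B
  tensorHom f g := madd f g
  whiskerLeft A _ _ f := madd (𝟙 A) f
  whiskerRight f B := madd f (𝟙 B)
  tensorUnit := (0 : D.Obj)
  associator A B C := eqToIso (add_assoc A B C)
  leftUnitor A := eqToIso (zero_add A)
  rightUnitor A := eqToIso (add_zero A)

instance : MonoidalCategory D.Obj :=
  MonoidalCategory.ofTensorHom
    (id_tensorHom_id := fun A B => madd_id A B)
    (id_tensorHom := fun _ _ _ _ => rfl)
    (tensorHom_id := fun _ _ => rfl)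
    (tensorHom_comp_tensorHom := fun f g f' g' => (madd_comp f f' g g').symm)
    (associator_naturality := fun f g h => madd_assoc f g h)
    (leftUnitor_naturality := fun f => zero_madd f)
    (rightUnitor_naturality := fun f => madd_zero f)
    (pentagon := fun A B C M => by
      change madd (eqToHom (add_assoc A B C)) (eqToHom rfl) ≫ eqToHom (add_assoc A (B + C) M) ≫
          madd (eqToHom rfl) (eqToHom (add_assoc B C M)) =
        eqToHom (add_assoc (A + B) C M) ≫ eqToHom (add_assoc A B (C + M))
      rw [madd_eqToHom, madd_eqToHom, eqToHom_trans, eqToHom_trans, eqToHom_trans])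
    (triangle := fun A B => by
      change eqToHom (add_assoc A 0 B) ≫ madd (eqToHom rfl) (eqToHom (zero_add B)) =
        madd (eqToHom (add_zero A)) (eqToHom rfl)
      rw [madd_eqToHom, madd_eqToHom, eqToHom_trans])

/-- The symmetry, as an isomorphism. -/
def braidIso (A B : D.Obj) : A + B ≅ B + A where
  hom := D.braid A B
  inv := D.braid B A
  hom_inv_id := D.isPermutative.braid_braid A B
  inv_hom_id := D.isPermutative.braid_braid B A

/-- The axiom splits the first summand. Splitting the second follows by inverting that formula,
because `braid A (B + C)` and `braid (B + C) A` are inverse to each other. -/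
theorem braid_add' (A B C : D.Obj) : D.braid A (B + C) =
    eqToHom (add_assoc A B C).symm ≫ madd (D.braid A B) (𝟙 C) ≫ eqToHom (add_assoc B A C) ≫
      madd (𝟙 B) (D.braid A C) ≫ eqToHom (add_assoc B C A).symm := by
  have e : ∀ {M N : D.Obj} (f : M ⟶ N) (g h : N ⟶ M), f ≫ g = 𝟙 _ → h ≫ f = 𝟙 _ → h = g := by
    intro M N f g h h₁ h₂
    rw [← Category.comp_id h, ← h₁, reassoc_of% h₂]
  refine e (D.braid (B + C) A) _ _ ?_ (D.isPermutative.braid_braid _ _)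
  rw [D.isPermutative.braid_add]
  have h₁ : madd (D.braid B A) (𝟙 C) ≫ madd (D.braid A B) (𝟙 C) = 𝟙 _ := by
    rw [← madd_comp, D.isPermutative.braid_braid, Category.comp_id, madd_id]
  have h₂ : madd (𝟙 B) (D.braid C A) ≫ madd (𝟙 B) (D.braid A C) = 𝟙 _ := by
    rw [← madd_comp, D.isPermutative.braid_braid, Category.comp_id, madd_id]
  simp only [Category.assoc, eqToHom_trans_assoc, eqToHom_refl, Category.id_comp, reassoc_of% h₁,
    reassoc_of% h₂, eqToHom_trans]

instance : SymmetricCategory D.Obj where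
  braiding A B := braidIso A B
  braiding_naturality_right A _ _ f := braid_natural (𝟙 A) f
  braiding_naturality_left f B := braid_natural f (𝟙 B)
  hexagon_forward A B C := by
    change eqToHom (add_assoc A B C) ≫ D.braid A (B + C) ≫ eqToHom (add_assoc B C A) =
      madd (D.braid A B) (𝟙 C) ≫ eqToHom (add_assoc B A C) ≫ madd (𝟙 B) (D.braid A C)
    rw [braid_add']
    simp only [Category.assoc, eqToHom_trans_assoc, eqToHom_refl, Category.id_comp, eqToHom_trans,
      Category.comp_id]
  hexagon_reverse A B C := by
    change eqToHom (add_assoc A B C).symm ≫ D.braid (A + B) C ≫ eqToHom (add_assoc C A B).symm =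
      madd (𝟙 A) (D.braid B C) ≫ eqToHom (add_assoc A C B).symm ≫ madd (D.braid A C) (𝟙 B)
    rw [D.isPermutative.braid_add]
    simp only [Category.assoc, eqToHom_trans_assoc, eqToHom_refl, Category.id_comp, eqToHom_trans,
      Category.comp_id]
  symmetry A B := D.isPermutative.braid_braid A B

end Monoidal

section

open MonoidalCategory

/-- Symmetry, and not merely a braiding, is needed: the crossing of the two middle factors occurs in
opposite senses on the two sides. The lemma provides the symmetry axiom for a sum of objects. -/
theorem tensorμ_braiding {C : Type*} [Category* C] [MonoidalCategory C] [SymmetricCategory C]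
    (X X' Y Y' : C) : tensorμ X X' Y Y' ≫ (β_ (X ⊗ Y) (X' ⊗ Y')).hom =
      ((β_ X X').hom ⊗ₘ (β_ Y Y').hom) ≫ tensorμ X' X Y' Y := by
  simp [tensorμ, SymmetricCategory.braiding_swap_eq_inv_braiding Y X', MonoidalCategory.tensorHom_def]

end

/-! ## Sums of objects -/

section Sum

variable {D : PermSCat.{u}} {X : FinPtd}

/-- The interchange of the two middle summands. -/
def interchange (A B A' B' : D.Obj) : (A + B) + (A' + B') ⟶ (A + A') + (B + B') :=
  MonoidalCategory.tensorμ (C := D.Obj) A B A' B'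

/-- Together with the next two statements, this is what the axioms for `a_{S,T}` require of the
interchange that rearranges a sum of two decompositions. -/
theorem interchange_natural {A B A' B' M N M' N' : D.Obj} (f : A ⟶ M) (g : B ⟶ N) (f' : A' ⟶ M')
    (g' : B' ⟶ N') : madd (madd f g) (madd f' g') ≫ interchange M N M' N' =
      interchange A B A' B' ≫ madd (madd f f') (madd g g') :=
  MonoidalCategory.tensorμ_natural (C := D.Obj) f g f' g'

theorem interchange_assoc (A B C A' B' C' : D.Obj) :
    interchange (A + B) C (A' + B') C' ≫ madd (interchange A B A' B') (𝟙 (C + C')) ≫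
        eqToHom (add_assoc _ _ _) =
      madd (eqToHom (add_assoc _ _ _)) (eqToHom (add_assoc _ _ _)) ≫
        interchange A (B + C) A' (B' + C') ≫ madd (𝟙 (A + A')) (interchange B C B' C') :=
  MonoidalCategory.associator_monoidal (C := D.Obj) A B C A' B' C'

theorem interchange_braid (A B A' B' : D.Obj) :
    interchange A B A' B' ≫ D.braid (A + A') (B + B') =
      madd (D.braid A B) (D.braid A' B') ≫ interchange B A B' A' :=
  tensorμ_braiding (C := D.Obj) A B A' B'

instance (A B A' B' : D.Obj) : IsIso (interchange A B A' B') :=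
  ⟨MonoidalCategory.tensorδ (C := D.Obj) A B A' B',
    MonoidalCategory.tensorμ_tensorδ (C := D.Obj) _ _ _ _,
    MonoidalCategory.tensorδ_tensorμ (C := D.Obj) _ _ _ _⟩

theorem isIso_madd {A A' B B' : D.Obj} (f : A ⟶ A') (g : B ⟶ B') [IsIso f] [IsIso g] :
    IsIso (madd f g) :=
  ⟨madd (inv f) (inv g), by rw [← madd_comp, IsIso.hom_inv_id, IsIso.hom_inv_id, madd_id],
    by rw [← madd_comp, IsIso.inv_hom_id, IsIso.inv_hom_id, madd_id]⟩

/-- Only the symmetry with `0` on the right is an axiom; its inverse gives this case. -/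
theorem braid_zero_left {A B : D.Obj} (h : A = 0) :
    D.braid A B = eqToHom (by rw [h, add_zero, zero_add]) := by
  subst h
  have e := D.isPermutative.braid_braid B 0
  rw [D.isPermutative.braid_zero] at e
  rw [← Category.id_comp (D.braid 0 B), ← eqToHom_refl _ rfl,
    ← eqToHom_trans ((zero_add B).trans (add_zero B).symm) ((add_zero B).trans (zero_add B).symm),
    Category.assoc, e, Category.comp_id]

theorem braid_zero_right {A B : D.Obj} (h : B = 0) :
    D.braid A B = eqToHom (by rw [h, add_zero, zero_add]) := by
  subst h
  exact D.isPermutative.braid_zero A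

/-- The interchange is built from the braiding of the middle summands and from identities. If one
middle summand is `0`, the whole is an identity, which gives the unit axioms for a sum. -/
theorem interchange_eqToHom {A B A' B' : D.Obj} {h : B + A' = A' + B}
    (e : D.braid B A' = eqToHom h) :
    interchange A B A' B' = eqToHom (by
      rw [add_assoc, ← add_assoc B, h, add_assoc A' B, ← add_assoc A A']) := by
  change eqToHom (add_assoc A B (A' + B')) ≫ madd (𝟙 A) (eqToHom (add_assoc B A' B').symm) ≫
    madd (𝟙 A) (madd (D.braid B A') (𝟙 B')) ≫ madd (𝟙 A) (eqToHom (add_assoc A' B B')) ≫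
      eqToHom (add_assoc A A' (B + B')).symm = _
  rw [e]
  simp only [← eqToHom_refl _ rfl, madd_eqToHom, eqToHom_trans]

/-- The sum of two objects. -/
def GammaObj.sum (A A' : GammaObj D X) : GammaObj D X where
  A S := A.A S + A'.A S
  a {S T W} h := madd (A.a h) (A'.a h) ≫ interchange (A.A S) (A.A T) (A'.A S) (A'.A T)
  A_empty := by rw [A.A_empty, A'.A_empty, add_zero]
  a_isIso {S T W} h := by
    have := A.a_isIso h
    have := A'.a_isIso h
    have := isIso_madd (A.a h) (A'.a h)
    infer_instance
  a_empty_left {S} h := by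
    rw [A.a_empty_left, A'.a_empty_left, madd_eqToHom,
      interchange_eqToHom (braid_zero_right A'.A_empty), eqToHom_trans]
  a_empty_right {S} h := by
    rw [A.a_empty_right, A'.a_empty_right, madd_eqToHom,
      interchange_eqToHom (braid_zero_left A.A_empty), eqToHom_trans]
  a_assoc {S T U ST TU STU} h₁ h₂ h₃ h₄ := by
    have e : ∀ {M N P : D.Obj} (f : M ⟶ N) (g : N ⟶ P) (Q : D.Obj),
        madd (f ≫ g) (𝟙 Q) = madd f (𝟙 Q) ≫ madd g (𝟙 Q) := by
      intro M N P f g Q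
      rw [← madd_comp, Category.comp_id]
    have e' : ∀ {M N P : D.Obj} (f : M ⟶ N) (g : N ⟶ P) (Q : D.Obj),
        madd (𝟙 Q) (f ≫ g) = madd (𝟙 Q) f ≫ madd (𝟙 Q) g := by
      intro M N P f g Q
      rw [← madd_comp, Category.comp_id]
    -- Naturality moves the inner decompositions past the interchange. Associativity then splits
    -- into that of the two summands and that of the interchange.
    have n₁ := interchange_natural (A.a h₁) (𝟙 (A.A U)) (A'.a h₁) (𝟙 (A'.A U))
    have n₂ := interchange_natural (𝟙 (A.A S)) (A.a h₃) (𝟙 (A'.A S)) (A'.a h₃)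
    rw [madd_id] at n₁ n₂
    rw [e, e', Category.assoc, Category.assoc, Category.assoc, ← reassoc_of% n₁,
      interchange_assoc, ← reassoc_of% n₂, ← Category.assoc, ← Category.assoc, ← madd_comp,
      ← madd_comp, Category.assoc, Category.assoc, A.a_assoc h₁ h₂ h₃ h₄, A'.a_assoc h₁ h₂ h₃ h₄,
      madd_comp, Category.assoc]
  a_symm {S T W} h := by
    rw [Category.assoc, interchange_braid, ← Category.assoc, ← madd_comp, A.a_symm, A'.a_symm]

open Classical in
/-- The object `M` at the subsets that contain `j`, and `0` at all others. -/
def GammaObj.delta (j : Fin (X.n + 1)) (M : D.Obj) : GammaObj D X where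
  A S := if j ∈ S.1 then M else 0
  a {S T W} h := eqToHom (by
    have h₁ := h.union j
    have h₂ := h.disjoint j
    by_cases hS : j ∈ S.1
    · rw [if_pos (h₁.mpr (Or.inl hS)), if_pos hS, if_neg (h₂ hS), add_zero]
    · by_cases hT : j ∈ T.1
      · rw [if_pos (h₁.mpr (Or.inr hT)), if_neg hS, if_pos hT, zero_add]
      · rw [if_neg (fun hW => (h₁.mp hW).elim hS hT), if_neg hS, if_neg hT, zero_add])
  A_empty := if_neg fun h => h
  a_isIso h := inferInstance
  a_empty_left h := rfl
  a_empty_right h := rfl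
  a_assoc h₁ h₂ h₃ h₄ := by simp only [← eqToHom_refl _ rfl, madd_eqToHom, eqToHom_trans]
  a_symm {S T W} h := by
    -- Disjoint subsets cannot both contain `j`, so one of the two components is `0` and the
    -- symmetry is an identity.
    by_cases hS : j ∈ S.1
    · rw [braid_zero_right (if_neg (h.disjoint j hS)), eqToHom_trans]
    · rw [braid_zero_left (if_neg hS), eqToHom_trans]

theorem GammaObj.delta_single (i j : Fin X.n) (M : D.Obj) :
    (GammaObj.delta (X := X) i.succ M).A (single j) = if i = j then M else 0 := by
  have e : i.succ ∈ (single j).1 ↔ i = j := Fin.succ_inj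
  split_ifs with h
  · exact if_pos (e.mpr h)
  · exact if_neg (mt e.mp h)

/-- Any family of objects is the family of components of an object. -/
theorem GammaObj.exists_single (M : Fin X.n → D.Obj) :
    ∃ A : GammaObj D X, ∀ i, A.A (single i) = M i := by
  -- Objects concentrated at single elements are added along a list without repetitions. At a
  -- one-element subset at most one summand is nonzero, so strict unitality gives equalities of
  -- objects and not only isomorphisms.
  have key : ∀ l : List (Fin X.n), l.Nodup → ∃ A : GammaObj D X, ∀ i,
      A.A (single i) = if i ∈ l then M i else 0 := by
    intro l
    induction l with
    -- The zero object: with value `0` the choice of `j` is irrelevant.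
    | nil => exact fun _ => ⟨GammaObj.delta 0 0, fun i => (ite_self _).trans (by simp)⟩
    | cons j l ih =>
      intro hl
      rw [List.nodup_cons] at hl
      obtain ⟨A, hA⟩ := ih hl.2
      refine ⟨(GammaObj.delta j.succ (M j)).sum A, fun i => ?_⟩
      change (GammaObj.delta (X := X) j.succ (M j)).A (single i) + A.A (single i) = _
      rw [hA, GammaObj.delta_single]
      by_cases h : j = i
      · subst h
        simp [hl.1]
      · have h' : ¬ i = j := fun e => h e.symm
        simp [h, h']
  obtain ⟨A, hA⟩ := key (List.finRange X.n) (List.nodup_finRange _)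
  exact ⟨A, fun i => (hA i).trans (if_pos (List.mem_finRange i))⟩

end Sum

/-! ## Families indexed by subsets -/

namespace PtSub

variable {X : FinPtd}

theorem ext {S T : PtSub X} (h : ∀ j, j ∈ S.1 ↔ j ∈ T.1) : S = T := Subtype.ext (Set.ext h)

/-- The union of two subsets. -/
def union (S T : PtSub X) : PtSub X := ⟨S.1 ∪ T.1, fun h => h.elim S.2 T.2⟩

theorem isUnion_union {S T : PtSub X} (h : ∀ j, j ∈ S.1 → j ∈ T.1 → False) :
    IsUnion S T (S.union T) := ⟨h, fun j => Iff.rfl⟩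

theorem isUnion_empty_left (S : PtSub X) : IsUnion (empty X) S S :=
  ⟨fun j h _ => h, fun j => ⟨Or.inr, fun h => h.elim (fun h => h.elim) id⟩⟩

theorem IsUnion.eq {S T W W' : PtSub X} (h : IsUnion S T W) (h' : IsUnion S T W') : W = W' :=
  ext fun j => (h.union j).trans (h'.union j).symm

/-- The subset with the elements `i + 1` for `i` in a finite set. -/
def ofFinset (s : Finset (Fin X.n)) : PtSub X :=
  ⟨{j | ∃ i ∈ s, i.succ = j}, fun ⟨i, _, h⟩ => Fin.succ_ne_zero i h⟩

open Classical in
/-- The finite set of all `i` with `i + 1` in the given subset. -/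
def toFinset (S : PtSub X) : Finset (Fin X.n) := Finset.univ.filter fun i => i.succ ∈ S.1

theorem mem_toFinset {S : PtSub X} {i : Fin X.n} : i ∈ S.toFinset ↔ i.succ ∈ S.1 := by
  simp [toFinset]

theorem ofFinset_toFinset (S : PtSub X) : ofFinset S.toFinset = S := ext fun j => by
  constructor
  · rintro ⟨i, hi, rfl⟩
    exact mem_toFinset.mp hi
  · intro hj
    obtain ⟨i, rfl⟩ := Fin.exists_succ_eq_of_ne_zero (x := j) fun h => S.2 (h ▸ hj)
    exact ⟨i, mem_toFinset.mpr hj, rfl⟩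

theorem ofFinset_empty : ofFinset (∅ : Finset (Fin X.n)) = empty X := ext fun j =>
  ⟨fun ⟨_, hi, _⟩ => absurd hi (Finset.notMem_empty _), fun h => h.elim⟩

theorem isUnion_insert [DecidableEq (Fin X.n)] {i : Fin X.n} {s : Finset (Fin X.n)} (h : i ∉ s) :
    IsUnion (single i) (ofFinset s) (ofFinset (insert i s)) where
  disjoint := by
    rintro j hj ⟨i', hi', rfl⟩
    exact h (Fin.succ_injective _ (show i'.succ = i.succ from hj) ▸ hi')
  union j := by
    constructor
    · rintro ⟨i', hi', rfl⟩
      rcases Finset.mem_insert.mp hi' with rfl | hi'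
      · exact Or.inl rfl
      · exact Or.inr ⟨i', hi', rfl⟩
    · rintro (hj | ⟨i', hi', rfl⟩)
      · exact ⟨i, Finset.mem_insert_self _ _, hj.symm⟩
      · exact ⟨i', Finset.mem_insert_of_mem hi', rfl⟩

/-- Induction on subsets. -/
theorem induction {P : PtSub X → Prop} (h_empty : P (empty X)) (h_single : ∀ i, P (single i))
    (h_union : ∀ {S T W : PtSub X}, IsUnion S T W → P S → P T → P W) (S : PtSub X) : P S := by
  rw [← ofFinset_toFinset S]
  induction S.toFinset using Finset.induction_on with
  | empty => rwa [ofFinset_empty]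
  | insert i s hi ih => exact h_union (isUnion_insert hi) (h_single i) ih

/-- A family of sets indexed by subsets, with partially defined sums. -/
structure Sums (M : PtSub X → Type u) where
  add : ∀ {S T W : PtSub X}, IsUnion S T W → M S → M T → M W
  zero : M (empty X)
  add_assoc : ∀ {S T U ST TU STU : PtSub X} (h₁ : IsUnion S T ST) (h₂ : IsUnion ST U STU)
    (h₃ : IsUnion T U TU) (h₄ : IsUnion S TU STU) (x : M S) (y : M T) (z : M U),
    add h₂ (add h₁ x y) z = add h₄ x (add h₃ y z)
  add_comm : ∀ {S T W : PtSub X} (h : IsUnion S T W) (x : M S) (y : M T),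
    add h.symm y x = add h x y
  zero_add : ∀ {S : PtSub X} (h : IsUnion (empty X) S S) (x : M S), add h zero x = x

namespace Sums

variable {M : PtSub X → Type u} (R : Sums M)

/-- All elements, together with an element that serves as the sum of those that cannot be added. -/
def Total (R : Sums M) : Type u := Option (Σ S, M S)

theorem mk_add {S T W W' : PtSub X} (h : IsUnion S T W) (h' : IsUnion S T W') (x : M S) (y : M T) :
    (⟨W, R.add h x y⟩ : Σ S, M S) = ⟨W', R.add h' x y⟩ := by
  obtain rfl := h.eq h'
  rfl

open Classical in
/-- The total sum. -/
def Total.mul : R.Total → R.Total → R.Total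
  | some ⟨S, x⟩, some ⟨T, y⟩ =>
    if h : ∀ j, j ∈ S.1 → j ∈ T.1 → False then some ⟨_, R.add (isUnion_union h) x y⟩ else none
  | none, _ => none
  | some _, none => none

theorem Total.mul_none (x : R.Total) : Total.mul R x none = none := by
  cases x <;> rfl

theorem Total.mul_some {S T W : PtSub X} (h : IsUnion S T W) (x : M S) (y : M T) :
    Total.mul R (some ⟨S, x⟩) (some ⟨T, y⟩) = some ⟨W, R.add h x y⟩ :=
  (dif_pos h.disjoint).trans (congrArg some (R.mk_add _ _ x y))

theorem Total.mul_of_not {S T : PtSub X} (h : ¬ ∀ j, j ∈ S.1 → j ∈ T.1 → False) (x : M S)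
    (y : M T) : Total.mul R (some ⟨S, x⟩) (some ⟨T, y⟩) = none := dif_neg h

/-- The element `none` is absorbing. Either bracketing of three elements gives `none` unless their
subsets are pairwise disjoint, and in that case associativity is that of the partial sum. With a
genuine commutative monoid, finite products become available and their independence of order is
automatic. -/
instance : CommMonoid R.Total where
  mul := Total.mul R
  one := some ⟨_, R.zero⟩
  mul_assoc := by
    rintro (_ | ⟨S, x⟩) (_ | ⟨T, y⟩) (_ | ⟨U, z⟩) <;> try rfl
    · exact Total.mul_none R _
    · change Total.mul R (Total.mul R _ _) _ = Total.mul R _ (Total.mul R _ _)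
      by_cases hST : ∀ j, j ∈ S.1 → j ∈ T.1 → False
      · rw [Total.mul_some R (isUnion_union hST)]
        by_cases h : ∀ j, j ∈ (S.union T).1 → j ∈ U.1 → False
        · have hTU : ∀ j, j ∈ T.1 → j ∈ U.1 → False := fun j hj => h j (Or.inr hj)
          have h₄ : IsUnion S (T.union U) ((S.union T).union U) :=
            ⟨fun j hS hj => hj.elim (hST j hS) (h j (Or.inl hS)), fun j => or_assoc⟩
          rw [Total.mul_some R (isUnion_union h), Total.mul_some R (isUnion_union hTU),
            Total.mul_some R h₄, R.add_assoc (isUnion_union hST) (isUnion_union h)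
              (isUnion_union hTU) h₄]
        · rw [Total.mul_of_not R h]
          by_cases hTU : ∀ j, j ∈ T.1 → j ∈ U.1 → False
          · rw [Total.mul_some R (isUnion_union hTU), Total.mul_of_not]
            exact fun h' => h fun j hj hU => hj.elim (fun hS => h' j hS (Or.inr hU))
              fun hT => hTU j hT hU
          · rw [Total.mul_of_not R hTU]
            rfl
      · rw [Total.mul_of_not R hST]
        by_cases hTU : ∀ j, j ∈ T.1 → j ∈ U.1 → False
        · rw [Total.mul_some R (isUnion_union hTU), Total.mul_of_not]
          · rfl
          · exact fun h' => hST fun j hS hT => h' j hS (Or.inl hT)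
        · rw [Total.mul_of_not R hTU]
          rfl
  mul_comm := by
    rintro (_ | ⟨S, x⟩) (_ | ⟨T, y⟩) <;> try rfl
    change Total.mul R _ _ = Total.mul R _ _
    by_cases h : ∀ j, j ∈ S.1 → j ∈ T.1 → False
    · rw [Total.mul_some R (isUnion_union h), Total.mul_some R (isUnion_union h).symm, R.add_comm]
    · rw [Total.mul_of_not R h, Total.mul_of_not R fun h' => h fun j hS hT => h' j hT hS]
  one_mul := by
    rintro (_ | ⟨S, x⟩)
    · rfl
    · exact (Total.mul_some R (isUnion_empty_left S) _ _).trans (by rw [R.zero_add])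
  mul_one := by
    rintro (_ | ⟨S, x⟩)
    · rfl
    · exact (Total.mul_some R (isUnion_empty_left S).symm _ _).trans
        (by rw [R.add_comm (isUnion_empty_left S), R.zero_add])

/-- The inclusion of a summand. -/
def toTotal {S : PtSub X} (x : M S) : R.Total := some ⟨S, x⟩

theorem toTotal_injective {S : PtSub X} {x y : M S} (h : R.toTotal x = R.toTotal y) : x = y :=
  eq_of_heq (Sigma.mk.inj (Option.some.inj h)).2

theorem toTotal_mul {S T W : PtSub X} (h : IsUnion S T W) (x : M S) (y : M T) :
    R.toTotal x * R.toTotal y = R.toTotal (R.add h x y) := Total.mul_some R h x y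

/-- An additive family is given by arbitrary values at the subsets with one element. -/
theorem exists_family (x : ∀ i, M (single i)) : ∃ F : ∀ S, M S, F (empty X) = R.zero ∧
    (∀ i, F (single i) = x i) ∧ ∀ {S T W : PtSub X} (h : IsUnion S T W),
      F W = R.add h (F S) (F T) := by
  -- The value at `S` is the product of the prescribed values over the elements of `S`. It never
  -- degenerates to `none`, because distinct one-element subsets are disjoint.
  have key : ∀ S, ∃ y : M S, ∏ i ∈ S.toFinset, R.toTotal (x i) = R.toTotal y := by
    intro S
    have : ∀ s : Finset (Fin X.n), ∃ y : M (ofFinset s), ∏ i ∈ s, R.toTotal (x i) = R.toTotal y := by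
      intro s
      induction s using Finset.induction_on with
      | empty => exact ofFinset_empty (X := X) ▸ ⟨R.zero, rfl⟩
      | insert i s hi ih =>
        obtain ⟨y, hy⟩ := ih
        exact ⟨_, by rw [Finset.prod_insert hi, hy, R.toTotal_mul (isUnion_insert hi)]⟩
    obtain ⟨y, hy⟩ := this S.toFinset
    have e := ofFinset_toFinset S
    generalize ofFinset S.toFinset = T at e y
    subst e
    exact ⟨y, hy⟩
  choose F hF using key
  refine ⟨F, R.toTotal_injective ?_, fun i => R.toTotal_injective ?_,
    fun {S T W} h => R.toTotal_injective ?_⟩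
  · have e : (empty X).toFinset = ∅ :=
      Finset.eq_empty_of_forall_notMem fun i hi => mem_toFinset.mp hi
    rw [← hF, e, Finset.prod_empty]
    rfl
  · have e : (single i).toFinset = {i} := by
      ext j
      rw [mem_toFinset, Finset.mem_singleton]
      exact Fin.succ_inj
    rw [← hF, e, Finset.prod_singleton]
  · have e : W.toFinset = S.toFinset ∪ T.toFinset := by
      ext j
      rw [Finset.mem_union, mem_toFinset, mem_toFinset, mem_toFinset]
      exact h.union _
    rw [← R.toTotal_mul, ← hF, ← hF, ← hF, e, Finset.prod_union]
    exact Finset.disjoint_left.mpr fun j hS hT =>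
      h.disjoint _ (mem_toFinset.mp hS) (mem_toFinset.mp hT)

end Sums

end PtSub

/-! ## Extension of families from the subsets with one element -/

namespace SCat

variable {E : SCat.{u}} {A B C : E.Obj} {k : SimplexCategoryᵒᵖ}

theorem hcomp_cst_inv_hom (f : B ⟶ C) [IsIso f] (x : E.Cell k A C) :
    hcomp (hcomp x (cst (inv f) k)) (cst f k) = x := by
  rw [hcomp_assoc, ← cst_comp, IsIso.inv_hom_id, hcomp_cst_id]

theorem hcomp_cst_injective (f : B ⟶ C) [IsIso f] {x y : E.Cell k A B}
    (h : hcomp x (cst f k) = hcomp y (cst f k)) : x = y := by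
  have e : ∀ z : E.Cell k A B, hcomp (hcomp z (cst f k)) (cst (inv f) k) = z := fun z => by
    rw [hcomp_assoc, ← cst_comp, IsIso.hom_inv_id, hcomp_cst_id]
  rw [← e x, h, e]

theorem hcomp_paste_cst (x y : E.Cell k A B) (h : x.right = y.left) (f : B ⟶ C) :
    hcomp (paste x y h) (cst f k) = paste (hcomp x (cst f k)) (hcomp y (cst f k))
      (congrArg (fun z => (E.comp k).obj (z, Mor.app f k)) h) := hcomp_paste_const _ _ _ _

theorem hcomp_paste_of_const {x y : E.Cell k A B} (h : x.right = y.left) {z : E.Cell k B C}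
    (hz : ∃ f, z = const f) :
    hcomp (paste x y h) z = paste (hcomp x z) (hcomp y z) (by
      obtain ⟨f, rfl⟩ := hz
      exact congrArg (fun w => (E.comp k).obj (w, f)) h) := by
  obtain ⟨f, rfl⟩ := hz
  exact hcomp_paste_const _ _ _ _

end SCat

namespace GammaObj

variable {D : PermSCat.{u}} {X : FinPtd} {k : SimplexCategoryᵒᵖ} {A B : GammaObj D X}
  {S T U W ST TU STU : PtSub X}

theorem post_injective (h : IsUnion S T W) {M : D.Obj} {x y : D.Cell k M (B.A W)}
    (e : B.post h x = B.post h y) : x = y :=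
  have := B.a_isIso h
  hcomp_cst_injective (B.a h) e

/-- The inverse of `post`. -/
def unpost (B : GammaObj D X) (h : IsUnion S T W) {M : D.Obj} (x : D.Cell k M (B.A S + B.A T)) :
    D.Cell k M (B.A W) :=
  have := B.a_isIso h
  hcomp x (cst (inv (B.a h)) k)

theorem post_unpost (h : IsUnion S T W) {M : D.Obj} (x : D.Cell k M (B.A S + B.A T)) :
    B.post h (B.unpost h x) = x :=
  have := B.a_isIso h
  hcomp_cst_inv_hom (B.a h) x

theorem unpost_eq (h : IsUnion S T W) {M : D.Obj} {x : D.Cell k M (B.A S + B.A T)}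
    {y : D.Cell k M (B.A W)} (e : x = B.post h y) : B.unpost h x = y :=
  post_injective h ((post_unpost h x).trans e)

theorem pre_symm (h : IsUnion S T W) {M N : D.Obj} (x : D.Cell k (A.A S) M)
    (y : D.Cell k (A.A T) N) : A.pre h.symm y x = hcomp (A.pre h x y) (cst (D.braid M N) k) := by
  rw [pre, pre, ← A.a_symm h, cst_comp, hcomp_assoc, hcomp_assoc]
  exact congrArg (hcomp _) (D.isPermutative.natural x y).symm

theorem post_symm (h : IsUnion S T W) {M : D.Obj} (x : D.Cell k M (B.A W)) :
    B.post h.symm x = hcomp (B.post h x) (cst (D.braid (B.A S) (B.A T)) k) := by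
  rw [post, post, ← B.a_symm h, cst_comp, hcomp_assoc]

/-- Associativity of the sum on paths, combined with the associativity of the decomposition of `A`
at three disjoint subsets. -/
theorem pre_assoc (h₁ : IsUnion S T ST) (h₂ : IsUnion ST U STU) (h₃ : IsUnion T U TU)
    (h₄ : IsUnion S TU STU) {M N P : D.Obj} (x : D.Cell k (A.A S) M) (y : D.Cell k (A.A T) N)
    (z : D.Cell k (A.A U) P) :
    hcomp (A.pre h₂ (A.pre h₁ x y) z) (cst (eqToHom (add_assoc M N P)) k) =
      A.pre h₄ x (A.pre h₃ y z) := by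
  have e := congrArg (fun z => cst z k) (A.a_assoc h₁ h₂ h₃ h₄)
  rw [cst_comp, cst_comp, cst_comp, cst_madd, cst_madd] at e
  have e₁ : hadd (A.pre h₁ x y) z =
      hcomp (hadd (cst (A.a h₁) k) (cst (𝟙 (A.A U)) k)) (hadd (hadd x y) z) := by
    rw [← hadd_hcomp, cst_id_hcomp, pre]
  have e₂ : hadd x (A.pre h₃ y z) =
      hcomp (hadd (cst (𝟙 (A.A S)) k) (cst (A.a h₃) k)) (hadd x (hadd y z)) := by
    rw [← hadd_hcomp, cst_id_hcomp, pre]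
  rw [pre, e₁, pre.eq_def A h₄, e₂, ← hcomp_assoc, hcomp_assoc, D.isPermutative.assoc,
    ← hcomp_assoc, ← hcomp_assoc, ← e, hcomp_assoc (cst (A.a h₂) k)]

/-- The isomorphism from the component of a union of three subsets. -/
def split₃ (B : GammaObj D X) (h₁ : IsUnion S T ST) (h₂ : IsUnion ST U STU) :
    B.A STU ⟶ B.A S + (B.A T + B.A U) :=
  B.a h₂ ≫ madd (B.a h₁) (𝟙 (B.A U)) ≫ eqToHom (add_assoc _ _ _)

theorem isIso_split₃ (h₁ : IsUnion S T ST) (h₂ : IsUnion ST U STU) : IsIso (B.split₃ h₁ h₂) := by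
  have := B.a_isIso h₁
  have := B.a_isIso h₂
  have := isIso_madd (B.a h₁) (𝟙 (B.A U))
  unfold split₃
  infer_instance

theorem cst_split₃_left (h₁ : IsUnion S T ST) (h₂ : IsUnion ST U STU) :
    cst (B.split₃ h₁ h₂) k = hcomp (cst (B.a h₂) k) (hcomp
      (hadd (cst (B.a h₁) k) (cst (𝟙 (B.A U)) k)) (cst (eqToHom (add_assoc _ _ _)) k)) := by
  rw [split₃, cst_comp, cst_comp, cst_madd]

theorem cst_split₃_right (h₁ : IsUnion S T ST) (h₂ : IsUnion ST U STU) (h₃ : IsUnion T U TU)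
    (h₄ : IsUnion S TU STU) :
    cst (B.split₃ h₁ h₂) k = hcomp (cst (B.a h₄) k)
      (hadd (cst (𝟙 (B.A S)) k) (cst (B.a h₃) k)) := by
  rw [split₃, B.a_assoc h₁ h₂ h₃ h₄, cst_comp, cst_madd]

/-- Components at the empty set equal `0` only propositionally. The zero objects are therefore
variables, to be substituted before strict unitality is applied. -/
theorem cst_eqToHom_hadd {Z Z' M M' : D.Obj} (hZ : Z = 0) (hZ' : Z' = 0) (x : D.Cell k M M')
    (e : M = Z + M) (e' : M' = Z' + M') :
    hcomp (cst (eqToHom e) k) (hadd (cst (eqToHom (hZ.trans hZ'.symm)) k) x) =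
      hcomp x (cst (eqToHom e') k) := by
  subst hZ hZ'
  refine hcomp_cst_injective (eqToHom (zero_add M')) ?_
  rw [hcomp_assoc, hcomp_assoc]
  refine (congrArg (hcomp _) (D.isPermutative.zero_hadd x)).trans ?_
  rw [← hcomp_assoc, ← cst_comp, ← cst_comp, eqToHom_trans, eqToHom_trans, eqToHom_refl,
    eqToHom_refl, cst_id_hcomp, hcomp_cst_id]

theorem pre_empty (h : IsUnion (empty X) S S) (x : D.Cell k (A.A S) (B.A S)) :
    A.pre h (cst (eqToHom (A.A_empty.trans B.A_empty.symm)) k) x = B.post h x := by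
  rw [pre, post, A.a_empty_left, B.a_empty_left]
  exact cst_eqToHom_hadd A.A_empty B.A_empty x _ _

/-- Paths with sums `b⁻¹ ∘ (x + y) ∘ a`. -/
def cellSums (k : SimplexCategoryᵒᵖ) (A B : GammaObj D X) :
    Sums fun S => D.Cell k (A.A S) (B.A S) where
  add h x y := B.unpost h (A.pre h x y)
  zero := cst (eqToHom (A.A_empty.trans B.A_empty.symm)) k
  add_assoc {S T U ST TU STU} h₁ h₂ h₃ h₄ x y z := by
    have := B.isIso_split₃ h₁ h₂
    -- Composing with the invertible three-fold decomposition of `B` removes the inverses of `b`.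
    -- Both bracketings then become the three-fold sum precomposed with the decomposition of `A`.
    refine hcomp_cst_injective (B.split₃ h₁ h₂) ?_
    refine Eq.trans (b := A.pre h₄ x (A.pre h₃ y z)) ?_ ?_
    · rw [cst_split₃_left, ← hcomp_assoc, ← hcomp_assoc]
      change hcomp (hcomp (B.post h₂ (B.unpost h₂ _)) _) _ = _
      rw [post_unpost, ← pre_post_left, post_unpost, pre_assoc]
    · rw [cst_split₃_right h₁ h₂ h₃ h₄, ← hcomp_assoc]
      change _ = hcomp (B.post h₄ (B.unpost h₄ _)) _
      rw [post_unpost, ← pre_post_right, post_unpost]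
  add_comm h x y := unpost_eq _ (by rw [pre_symm h, post_symm h, post_unpost])
  zero_add h x := unpost_eq _ (pre_empty h x)

end GammaObj

/-- A family of objects of categories of morphisms extends to a strict family. -/
theorem ThinHom.exists_f {D : PermSCat.{u}} {X : FinPtd} {k : SimplexCategoryᵒᵖ}
    {A B : GammaObj D X} (y : ∀ i, (D.Hom (A.A (single i)) (B.A (single i))).obj k) :
    ∃ t : ThinHom k A B, ∀ i, t.f (single i) = y i := by
  obtain ⟨F, hF, hF', hF''⟩ := (cellSums k A B).exists_family fun i => const (y i)
  have hF'' : ∀ {S T W : PtSub X} (h : IsUnion S T W), F W = B.unpost h (A.pre h (F S) (F T)) :=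
    hF''
  -- Sums of constant paths are constant, so the additive family of paths is an additive family of
  -- objects.
  have key : ∀ S, ∃ Z, F S = const Z := PtSub.induction ⟨_, hF⟩ (fun i => ⟨_, hF' i⟩)
    fun {S T W} h hS hT => by
      rw [hF'' h]
      exact ex_hcomp (ex_hcomp (ex_cst _) (ex_hadd hS hT)) (ex_cst _)
  choose f hf using key
  refine ⟨⟨f, congrArg Comma.left ((hf _).symm.trans hF), fun {S T W} h => ?_⟩,
    fun i => congrArg Comma.left ((hf _).symm.trans (hF' i))⟩
  rw [← hf, ← hf, ← hf, hF'' h, post_unpost]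

/-! ### Addition of paths that end at the components of a family with paths. -/

namespace FatHom

variable {D : PermSCat.{u}} {X : FinPtd} {k : SimplexCategoryᵒᵖ} {A B : GammaObj D X}

theorem pre_right (f : FatHom k A B) {S T W : PtSub X} (h : IsUnion S T W)
    {x : D.Cell k (A.A S) (B.A S)} {y : D.Cell k (A.A T) (B.A T)} (hx : x.right = f.f S)
    (hy : y.right = f.f T) : (A.pre h x y).right = (f.φ h).left := by
  rw [f.φ_left h, ← hx, ← hy]; rfl

/-- The iterated sum bracketed to the left is brought to a normal form: the three-fold sum of `x`,
`y`, `z` followed by the composite path of `f` bracketed to the right. The cocycle condition on `φ`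
enters exactly here. -/
theorem split₃_left (f : FatHom k A B) {S T U ST TU STU : PtSub X} (h₁ : IsUnion S T ST)
    (h₂ : IsUnion ST U STU) (h₃ : IsUnion T U TU) (h₄ : IsUnion S TU STU)
    {x : D.Cell k (A.A S) (B.A S)} {y : D.Cell k (A.A T) (B.A T)} {z : D.Cell k (A.A U) (B.A U)}
    {u : D.Cell k (A.A ST) (B.A ST)} {p : D.Cell k (A.A STU) (B.A STU)} (hx : x.right = f.f S)
    (hy : y.right = f.f T) (hz : z.right = f.f U) (hu : u.right = f.f ST)
    (eu : B.post h₁ u = paste (A.pre h₁ x y) (f.φ h₁) (f.pre_right h₁ hx hy))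
    (ep : B.post h₂ p = paste (A.pre h₂ u z) (f.φ h₂) (f.pre_right h₂ hu hz)) (q₁) :
    hcomp p (cst (B.split₃ h₁ h₂) k) = paste (A.pre h₄ x (A.pre h₃ y z))
      (paste (A.pre h₄ (const (f.f S)) (f.φ h₃))
        (hcomp (f.φ h₄) (hadd (cst (𝟙 (B.A S)) k) (cst (B.a h₃) k)))
        (GammaObj.glue_right h₃ h₄ (f.φ_right h₃) (f.φ_left h₄))) q₁ := by
  have q₂ : (A.pre h₂ (A.pre h₁ x y) z).right = (A.pre h₂ (f.φ h₁) (const (f.f U))).left := by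
    change _ = (D.comp k).obj (_, (D.add k).obj ((f.φ h₁).left, f.f U))
    rw [← f.pre_right h₁ hx hy, ← hz]
    rfl
  have e₁ : hcomp (A.pre h₂ u z) (hadd (cst (B.a h₁) k) (cst (𝟙 (B.A U)) k)) =
      paste (A.pre h₂ (A.pre h₁ x y) z) (A.pre h₂ (f.φ h₁) (const (f.f U))) q₂ := by
    rw [← pre_post_left, eu]
    exact (congrArg (A.pre h₂ _) (paste_const _ z hz).symm).trans
      (pre_paste h₂ (f.pre_right h₁ hx hy) hz)
  have e₂ : hcomp (B.post h₂ p) (hadd (cst (B.a h₁) k) (cst (𝟙 (B.A U)) k)) =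
      paste (A.pre h₂ (A.pre h₁ x y) z) (paste (A.pre h₂ (f.φ h₁) (const (f.f U)))
        (hcomp (f.φ h₂) (hadd (cst (B.a h₁) k) (cst (𝟙 (B.A U)) k)))
        (GammaObj.glue_left h₁ h₂ (f.φ_right h₁) (f.φ_left h₂))) q₂ := by
    rw [ep, hcomp_paste_of_const _ (ex_hadd (ex_cst _) (ex_cst _))]
    exact (paste_congr _ e₁ rfl).trans (paste_assoc _ _ _ _ _)
  rw [cst_split₃_left, ← hcomp_assoc, ← hcomp_assoc]
  refine (congrArg (fun w => hcomp w _) e₂).trans ((hcomp_paste_cst _ _ _ _).trans ?_)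
  exact paste_congr _ (pre_assoc h₁ h₂ h₃ h₄ x y z) (f.φ_assoc h₁ h₂ h₃ h₄)

/-- The sum bracketed to the right has the same normal form, already without the cocycle condition.
-/
theorem split₃_right (f : FatHom k A B) {S T U ST TU STU : PtSub X} (h₁ : IsUnion S T ST)
    (h₂ : IsUnion ST U STU) (h₃ : IsUnion T U TU) (h₄ : IsUnion S TU STU)
    {x : D.Cell k (A.A S) (B.A S)} {y : D.Cell k (A.A T) (B.A T)} {z : D.Cell k (A.A U) (B.A U)}
    {u : D.Cell k (A.A TU) (B.A TU)} {p : D.Cell k (A.A STU) (B.A STU)} (hx : x.right = f.f S)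
    (hy : y.right = f.f T) (hz : z.right = f.f U) (hu : u.right = f.f TU)
    (eu : B.post h₃ u = paste (A.pre h₃ y z) (f.φ h₃) (f.pre_right h₃ hy hz))
    (ep : B.post h₄ p = paste (A.pre h₄ x u) (f.φ h₄) (f.pre_right h₄ hx hu)) (q₁) :
    hcomp p (cst (B.split₃ h₁ h₂) k) = paste (A.pre h₄ x (A.pre h₃ y z))
      (paste (A.pre h₄ (const (f.f S)) (f.φ h₃))
        (hcomp (f.φ h₄) (hadd (cst (𝟙 (B.A S)) k) (cst (B.a h₃) k)))
        (GammaObj.glue_right h₃ h₄ (f.φ_right h₃) (f.φ_left h₄))) q₁ := by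
  have e₁ : hcomp (A.pre h₄ x u) (hadd (cst (𝟙 (B.A S)) k) (cst (B.a h₃) k)) =
      paste (A.pre h₄ x (A.pre h₃ y z)) (A.pre h₄ (const (f.f S)) (f.φ h₃)) q₁ := by
    rw [← pre_post_right, eu]
    exact (congrArg (fun w => A.pre h₄ w _) (paste_const _ x hx).symm).trans
      (pre_paste h₄ hx (f.pre_right h₃ hy hz))
  rw [cst_split₃_right h₁ h₂ h₃ h₄, ← hcomp_assoc]
  change hcomp (B.post h₄ p) _ = _
  rw [ep, hcomp_paste_of_const _ (ex_hadd (ex_cst _) (ex_cst _))]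
  exact (paste_congr _ e₁ rfl).trans (paste_assoc _ _ _ _
    (GammaObj.glue_right h₃ h₄ (f.φ_right h₃) (f.φ_left h₄)))

theorem right_unpost (f : FatHom k A B) {S T W : PtSub X} (h : IsUnion S T W)
    {x : D.Cell k (A.A S) (B.A S)} {y : D.Cell k (A.A T) (B.A T)} (hx : x.right = f.f S)
    (hy : y.right = f.f T) :
    (B.unpost h (paste (A.pre h x y) (f.φ h) (f.pre_right h hx hy))).right = f.f W := by
  have := B.a_isIso h
  have e : hcomp (B.post h (const (f.f W))) (cst (inv (B.a h)) k) = const (f.f W) :=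
    unpost_eq h rfl
  refine Eq.trans ?_ (congrArg Comma.right e)
  change (D.comp k).obj ((f.φ h).right, _) = (D.comp k).obj ((B.post h (const (f.f W))).right, _)
  rw [f.φ_right h]

/-- The paths that end at the components of `f`, with sums defined by the paths of `f`. -/
def sums (f : FatHom k A B) :
    Sums fun S => {x : D.Cell k (A.A S) (B.A S) // x.right = f.f S} where
  add {S T W} h x y := ⟨B.unpost h (paste (A.pre h x.1 y.1) (f.φ h) (f.pre_right h x.2 y.2)),
    f.right_unpost h x.2 y.2⟩
  zero := ⟨cst (eqToHom (A.A_empty.trans B.A_empty.symm)) k, f.f_empty.symm⟩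
  add_assoc {S T U ST TU STU} h₁ h₂ h₃ h₄ x y z := by
    have := B.isIso_split₃ h₁ h₂
    refine Subtype.ext (hcomp_cst_injective (B.split₃ h₁ h₂) ?_)
    refine (f.split₃_left h₁ h₂ h₃ h₄ x.2 y.2 z.2 (f.right_unpost h₁ x.2 y.2) (post_unpost _ _)
      (post_unpost _ _) ?_).trans (f.split₃_right h₁ h₂ h₃ h₄ x.2 y.2 z.2
      (f.right_unpost h₃ y.2 z.2) (post_unpost _ _) (post_unpost _ _) ?_).symm
    all_goals
      change _ = (D.comp k).obj (_, (D.add k).obj (f.f S, (f.φ h₃).left))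
      rw [← f.pre_right h₃ y.2 z.2]
      exact congrArg (fun w => (D.comp k).obj (_, (D.add k).obj (w, _))) x.2
  -- Commutativity is the symmetry condition on `φ`, and the unit law below is its normalization.
  add_comm {S T W} h x y := Subtype.ext (unpost_eq _ (by
    rw [post_symm h, post_unpost, hcomp_paste_cst]
    exact paste_congr _ (pre_symm h _ _) (f.φ_symm h)))
  zero_add {S} h x := Subtype.ext (unpost_eq _ (by
    refine (paste_congr _ (pre_empty h x.1) (f.φ_empty_left h)).trans ?_
    exact (paste_congr _ rfl (hcomp_const_const _ _)).trans (paste_const _ _ _)))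

end FatHom

/-! ## Strict families -/

theorem exists_mk_eq {C : Type u} [Category.{u} C] {a b : C} (x : Arrow C) (hl : x.left = a)
    (hr : x.right = b) : ∃ g : a ⟶ b, Arrow.mk g = x := by
  subst hl hr
  exact ⟨x.hom, rfl⟩

namespace FatHom

variable {D : PermSCat.{u}} {X : FinPtd} {k : SimplexCategoryᵒᵖ} {A B : GammaObj D X}
  {t t' f : FatHom k A B}

theorem ex_post {S T W : PtSub X} (h : IsUnion S T W) {M : D.Obj} (g : (D.Hom M (B.A W)).obj k) :
    ∃ Z, B.post h (const g) = const Z := ⟨_, hcomp_const_const _ _⟩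

/-- A family whose paths are constant. -/
def IsStrict (t : FatHom k A B) : Prop :=
  ∀ ⦃S T W : PtSub X⦄ (h : IsUnion S T W), t.φ h = B.post h (const (t.f W))

theorem isStrict_ofThin (t : ThinHom k A B) : (FatHom.ofThin t).IsStrict :=
  fun _ _ _ _ => rfl

theorem IsStrict.pre_eq (ht : t.IsStrict) {S T W : PtSub X} (h : IsUnion S T W) :
    A.pre h (const (t.f S)) (const (t.f T)) = B.post h (const (t.f W)) := by
  rw [← const_φ_left, ht h]
  exact (hcomp_const_const _ _).symm

/-- A strict family is determined by its components at the subsets with one element. -/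
theorem IsStrict.ext (ht : t.IsStrict) (ht' : t'.IsStrict)
    (h : ∀ i, t.f (single i) = t'.f (single i)) : t = t' := by
  -- Strictness expresses the component at a disjoint union through those at the parts, since
  -- composition with `b` is injective on paths; induction on subsets finishes.
  have key : ∀ S, t.f S = t'.f S := PtSub.induction (t.f_empty.trans t'.f_empty.symm) h
    fun {S T W} h hS hT => congrArg Comma.left (post_injective h (x := const (t.f W))
      (y := const (t'.f W)) (by rw [← ht.pre_eq, ← ht'.pre_eq, hS, hT]))
  refine FatHom.ext (funext key) ?_
  funext S T W h
  rw [ht h, ht' h, key W]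

theorem exists_isStrict (y : ∀ i, (D.Hom (A.A (single i)) (B.A (single i))).obj k) :
    ∃ t : FatHom k A B, t.IsStrict ∧ ∀ i, t.f (single i) = y i := by
  obtain ⟨t, ht⟩ := ThinHom.exists_f y
  exact ⟨FatHom.ofThin t, isStrict_ofThin t, ht⟩

/-- With constant paths at the source, compatibility becomes a formula for the component at a union.
It says that `ψ` is an additive family for `f.sums`. -/
theorem IsStrict.post_ψ (ht : t.IsStrict) (ψ : FatHom₂ t f) {S T W : PtSub X}
    (h : IsUnion S T W) : B.post h (Arrow.mk (ψ.ψ W)) =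
      paste (A.pre h (Arrow.mk (ψ.ψ S)) (Arrow.mk (ψ.ψ T))) (f.φ h) (f.φ_left h).symm := by
  obtain ⟨Z, hZ⟩ := ex_post h (t.f W)
  exact ((ψ.comm h).trans (ex_paste ⟨Z, (ht h).trans hZ⟩ _)).symm

/-- A morphism that starts at a strict family is determined by its components at the subsets with
one element. -/
theorem IsStrict.hom_ext (ht : t.IsStrict) {ψ ψ' : FatHom₂ t f}
    (h : ∀ i, ψ.ψ (single i) = ψ'.ψ (single i)) : ψ = ψ' := by
  have key : ∀ S, Arrow.mk (ψ.ψ S) = Arrow.mk (ψ'.ψ S) := PtSub.induction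
    (ψ.ψ_empty.trans ψ'.ψ_empty.symm) (fun i => congrArg Arrow.mk (h i))
    fun {S T W} h hS hT => post_injective h (by
      rw [ht.post_ψ, ht.post_ψ]
      exact paste_congr _ (congrArg₂ (A.pre h) hS hT) rfl)
  exact FatHom₂.ext (funext fun S => Arrow.mk_injective _ _ (key S))

/-- The prescribed components are paths ending at components of `f` and extend additively for
`f.sums`. It remains to see that the extended paths start at the components of `t`. -/
theorem IsStrict.exists_hom (ht : t.IsStrict) (f : FatHom k A B)
    (v : ∀ i, t.f (single i) ⟶ f.f (single i)) :
    ∃ ψ : FatHom₂ t f, ∀ i, ψ.ψ (single i) = v i := by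
  obtain ⟨F, hF, hF', hF''⟩ := f.sums.exists_family fun i => ⟨Arrow.mk (v i), rfl⟩
  have hF'' : ∀ {S T W : PtSub X} (h : IsUnion S T W), B.post h (F W).1 =
      paste (A.pre h (F S).1 (F T).1) (f.φ h) (f.pre_right h (F S).2 (F T).2) := fun h => by
    rw [hF'' h]
    exact post_unpost h _
  -- The starting points satisfy the same recursion as the strict family `t` and agree with it at
  -- the empty set and at one-element subsets.
  have hl : ∀ S, (F S).1.left = t.f S := PtSub.induction
    ((congrArg (fun x => x.1.left) hF).trans t.f_empty.symm)
    (fun i => congrArg (fun x => x.1.left) (hF' i))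
    fun {S T W} h hS hT => by
      refine congrArg Comma.left (post_injective h (x := const (F W).1.left)
        (y := const (t.f W)) ?_)
      rw [← ht.pre_eq h, pre_const, ← hS, ← hT]
      exact (hcomp_const_const _ _).trans (congrArg (fun x => const x.left) (hF'' h))
  choose ψ hψ using fun S => exists_mk_eq (F S).1 (hl S) (F S).2
  refine ⟨⟨ψ, ?_, fun {S T W} h => ?_⟩, fun i => Arrow.mk_injective _ _ ?_⟩
  · rw [hψ, hF, t.f_empty]
    rfl
  · obtain ⟨Z, hZ⟩ := ex_post h (t.f W)
    refine (paste_congr _ (congrArg₂ (A.pre h) (hψ S) (hψ T)) rfl).trans ((hF'' h).symm.trans ?_)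
    rw [← hψ W]
    exact (ex_paste ⟨Z, (ht h).trans hZ⟩ _).symm
  · rw [hψ, hF']

theorem isStrict_unit (k : SimplexCategoryᵒᵖ) (A : GammaObj D X) : (FatHom.unit k A).IsStrict :=
  fun S T W h => (cst_id_hcomp (cst (A.a h) k)).symm

theorem IsStrict.comp {C : GammaObj D X} {g : FatHom k B C} (hf : f.IsStrict) (hg : g.IsStrict) :
    ((FatHom.compFunctor k A B C).obj (f, g)).IsStrict :=
  fun S T W h => compφ_of_const f g h (hf h) (hg h)

theorem IsStrict.res {l : SimplexCategoryᵒᵖ} (θ : k ⟶ l) (hf : f.IsStrict) :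
    (f.res θ).IsStrict := fun S T W h =>
  (congrArg (D.res θ) (hf h)).trans ((res_post θ h _).trans (congrArg (B.post h) (res_const θ _)))

end FatHom

/-! ## The projections -/

section Projections

variable (D : PermSCat.{u}) (X : FinPtd)

open FatHom

/-- Strict families are good lifts along the projection. -/
def goodLiftsProj : GoodLifts (proj D X) where
  good {A B : GammaObj D X} {k} (f : FatHom k A B) := f.IsStrict
  good_unit (A : GammaObj D X) k := isStrict_unit k A
  good_comp {A B C : GammaObj D X} {k f g} hf hg := IsStrict.comp hf hg
  good_res {A B : GammaObj D X} {k l} θ f hf := IsStrict.res θ hf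
  exists_lift {A B : GammaObj D X} {k} y := by
    obtain ⟨t, ht, h⟩ := exists_isStrict (A := A) (B := B) y
    exact ⟨t, ht, funext h⟩
  lift_unique {A B : GammaObj D X} {k t t'} ht ht' h := ht.ext ht' fun i => congrFun h i
  exists_map {A B : GammaObj D X} {k t} ht (f : FatHom k A B) v hl hr := by
    obtain ⟨g, hg⟩ := exists_mk_eq v hl hr
    obtain ⟨ψ, hψ⟩ := IsStrict.exists_hom ht f g
    exact ⟨ψ, (congrArg Arrow.mk (funext hψ)).trans hg⟩
  map_unique {A B : GammaObj D X} {k t f} ht ψ ψ' h := ht.hom_ext fun i => congrFun h i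

/-- All objects are good lifts along the restriction of the projection to the standard
`Γ`-category. -/
def goodLiftsInclProj : GoodLifts ((incl D).app X ≫ proj D X) where
  good _ := True
  good_unit _ _ := trivial
  good_comp _ _ := trivial
  good_res _ _ _ := trivial
  exists_lift {A B : GammaObj D X} {k} y := by
    obtain ⟨t, h⟩ := ThinHom.exists_f (A := A) (B := B) y
    exact ⟨t, trivial, funext h⟩
  lift_unique {A B : GammaObj D X} {k} (t t' : ThinHom k A B) _ _ h :=
    ThinHom.ext (congrArg FatHom.f ((isStrict_ofThin t).ext (isStrict_ofThin t')
      fun i => congrFun h i))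
  exists_map {A B : GammaObj D X} {k} (t : ThinHom k A B) _ (f : ThinHom k A B) v hl hr := by
    obtain ⟨g, hg⟩ := exists_mk_eq v hl hr
    obtain ⟨ψ, hψ⟩ := (isStrict_ofThin t).exists_hom (FatHom.ofThin f) g
    -- Between families with constant paths the compatibility with paths reduces to the strict
    -- equation, so the lift lies in the standard `Γ`-category.
    exact ⟨(⟨ψ.ψ, ψ.ψ_empty, fun h => (((isStrict_ofThin t).post_ψ ψ h).trans
      ((paste_congr _ rfl (hcomp_const_const _ _)).trans (paste_const _ _ _))).symm⟩ :
        ThinHom₂ t f), (congrArg Arrow.mk (funext hψ)).trans hg⟩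
  map_unique {A B : GammaObj D X} {k} (t f : ThinHom k A B) _ (ψ ψ' : ThinHom₂ t f) h :=
    ThinHom₂.ext (congrArg FatHom₂.ψ ((isStrict_ofThin t).hom_ext
      (ψ := (ThinHom.incl k A B).map ψ) (ψ' := (ThinHom.incl k A B).map ψ')
      fun i => congrFun h i))

/-- Strict families are good lifts along the projection to the only component. -/
def goodLiftsProjComponent : GoodLifts (projComponent D (FinPtd.mk 1) 0) where
  good {A B : GammaObj D (FinPtd.mk 1)} {k} (f : FatHom k A B) := f.IsStrict
  good_unit (A : GammaObj D (FinPtd.mk 1)) k := isStrict_unit k A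
  good_comp {A B C : GammaObj D (FinPtd.mk 1)} {k f g} hf hg := IsStrict.comp hf hg
  good_res {A B : GammaObj D (FinPtd.mk 1)} {k l} θ f hf := IsStrict.res θ hf
  exists_lift {A B : GammaObj D (FinPtd.mk 1)} {k} y := by
    obtain ⟨t, ht, h⟩ := exists_isStrict (A := A) (B := B)
      -- There is only one one-element subset, so a single value is a full family of prescribed
      -- components.
      (Fin.cases (n := 0) y fun j => j.elim0)
    exact ⟨t, ht, h 0⟩
  lift_unique {A B : GammaObj D (FinPtd.mk 1)} {k t t'} ht ht' h :=
    ht.ext ht' (Fin.forall_fin_one.mpr h)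
  exists_map {A B : GammaObj D (FinPtd.mk 1)} {k t} ht (f : FatHom k A B) v hl hr := by
    obtain ⟨g, hg⟩ := exists_mk_eq v hl hr
    obtain ⟨ψ, hψ⟩ := IsStrict.exists_hom ht f (Fin.cases (n := 0) g fun j => j.elim0)
    exact ⟨ψ, (congrArg Arrow.mk (hψ 0)).trans hg⟩
  map_unique {A B : GammaObj D (FinPtd.mk 1)} {k t f} ht ψ ψ' h :=
    ht.hom_ext (Fin.forall_fin_one.mpr h)

theorem isWeakEquiv_proj : IsWeakEquiv (proj D X) :=
  (goodLiftsProj D X).isWeakEquiv fun M => by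
    obtain ⟨A, hA⟩ := GammaObj.exists_single M
    exact ⟨A, ⟨eqToIso (funext hA)⟩⟩

/-- Two-out-of-three: both the projection and its restriction to the standard `Γ`-category are
equivalences. -/
theorem isWeakEquiv_incl : IsWeakEquiv ((incl D).app X) :=
  (isWeakEquiv_proj D X).of_comp_right ((goodLiftsInclProj D X).isWeakEquiv fun M => by
    obtain ⟨A, hA⟩ := GammaObj.exists_single M
    exact ⟨A, ⟨eqToIso (funext hA)⟩⟩)

end Projections

/-! ## The Segal maps -/

section Segal

/-- The projection from a product. -/
def SCat.eval {ι : Type} (E : ι → SCat.{u}) (i : ι) : SCat.pi E ⟶ E i where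
  obj A := A i
  map A B := { app := fun k => (Pi.eval _ i).toCatHom
               naturality := fun _ _ _ => rfl }
  map_unit _ _ := rfl
  map_comp _ _ := rfl

/-- The product of enriched functors. -/
def SCat.piMap {ι : Type} {E F : ι → SCat.{u}} (p : ∀ i, E i ⟶ F i) : SCat.pi E ⟶ SCat.pi F :=
  SCat.lift fun i => SCat.eval E i ≫ p i

/-- Good lifts along a product of enriched functors. -/
def GoodLifts.pi {ι : Type} {E F : ι → SCat.{u}} {p : ∀ i, E i ⟶ F i} (L : ∀ i, GoodLifts (p i)) :
    GoodLifts (SCat.piMap p) where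
  good f := ∀ i, (L i).good (f i)
  good_unit A k i := (L i).good_unit (A i) k
  good_comp hf hg i := (L i).good_comp (hf i) (hg i)
  good_res θ _ hf i := (L i).good_res θ (hf i)
  exists_lift {A B k} y := by
    choose t ht h using fun i => (L i).exists_lift (A := A i) (B := B i) (y i)
    exact ⟨t, ht, funext h⟩
  lift_unique ht ht' h := funext fun i => (L i).lift_unique (ht i) (ht' i) (congrFun h i)
  exists_map {A B k t} ht f v hl hr := by
    obtain ⟨g, hg⟩ := exists_mk_eq v hl hr
    choose ψ hψ using fun i => (L i).exists_map (ht i) (f i) (Arrow.mk (g i)) rfl rfl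
    exact ⟨ψ, (congrArg Arrow.mk (funext fun i => Arrow.mk_injective _ _ (hψ i))).trans hg⟩
  map_unique ht ψ ψ' h := funext fun i => (L i).map_unique (ht i) (ψ i) (ψ' i) (congrFun h i)

variable (D : PermSCat.{u}) (X : FinPtd)

/-- The projection onto the component of a subset. -/
def projAt (S : PtSub X) : (fatGamma D).obj X ⟶ D.toSCat where
  obj (A : GammaObj D X) := A.A S
  map (A B : GammaObj D X) :=
    { app := fun k => Functor.toCatHom (C := FatHom k A B)
        { obj := fun f => f.f S
          map := fun a => FatHom₂.ψ a S
          map_id := fun _ => rfl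
          map_comp := fun _ _ => rfl }
      naturality := fun _ _ _ => rfl }
  map_unit _ _ := rfl
  map_comp _ _ := rfl

theorem preimage_segal (i : Fin X.n) :
    (single (X := FinPtd.mk 1) 0).preimage (X.segal i) = single i := PtSub.ext fun j => by
  change (if j = i.succ then (1 : Fin 2) else 0) = 1 ↔ j = i.succ
  split_ifs with h <;> simp [h]

/-- The composite reads off the component at the preimage of `{1}`. This preimage equals a
one-element subset only propositionally, so the composite is first written with `projAt`, where the
subset can be rewritten. -/
theorem segalMap_piMap : segalMap (fatGamma D) X ≫
    SCat.piMap (fun _ => projComponent D (FinPtd.mk 1) 0) = proj D X := by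
  have e : segalMap (fatGamma D) X ≫ SCat.piMap (fun _ => projComponent D (FinPtd.mk 1) 0) =
      SCat.lift fun i => projAt D X ((single (X := FinPtd.mk 1) 0).preimage (X.segal i)) := rfl
  rw [e]
  simp only [preimage_segal]
  rfl

/-- Two-out-of-three for the Segal map, the product of the projections in degree one, and `proj`.
Good lifts are formed componentwise in a product, so products of classifying spaces need not be
considered. -/
theorem isSpecial_fatGamma : IsSpecial (fatGamma D) := fun X => by
  refine IsWeakEquiv.of_comp_right (q := SCat.piMap fun _ => projComponent D (FinPtd.mk 1) 0)
    ((GoodLifts.pi fun _ => goodLiftsProjComponent D).isWeakEquiv fun M => ?_) ?_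
  · have h : ∀ i, ∃ A : GammaObj D (FinPtd.mk 1), A.A (single 0) = M i := fun i => by
      obtain ⟨A, hA⟩ := GammaObj.exists_single (X := FinPtd.mk 1) fun _ => M i
      exact ⟨A, hA 0⟩
    choose A hA using h
    exact ⟨A, ⟨eqToIso (funext hA)⟩⟩
  · rw [segalMap_piMap]
    exact isWeakEquiv_proj D X

end Segal

end SegalGamma

end

theorem proposition5p2 (D : SegalGamma.PermSCat.{u}) :
    (∀ X : SegalGamma.FinPtd, SegalGamma.IsWeakEquiv ((SegalGamma.incl D).app X)) ∧
    (∀ X : SegalGamma.FinPtd, SegalGamma.IsWeakEquiv (SegalGamma.proj D X)) ∧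
    SegalGamma.IsSpecial (SegalGamma.fatGamma D) :=
  ⟨SegalGamma.isWeakEquiv_incl D, SegalGamma.isWeakEquiv_proj D, SegalGamma.isSpecial_fatGamma D⟩
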